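/- All alphabets are finite, $\log$ and $\exp$ have base $2$, $\log 0=-\infty$, $\log\infty=\infty$, and $|x|^+=\max\{x,0\}$. $\mathcal P(\mathcal X)$ denotes the set of probability distributions on $\mathcal X$. **Rényi quantities.** For nonnegative vectors $P,Q$ on a finite set, the order-$\alpha$ Rényi divergence is $D_\alpha(P\|Q)=-\log F_\alpha(P,Q)$, where $F_\alpha(P,Q)=\big(\sum_x P(x)^\alpha Q(x)^{1-\alpha}\big)^{1/(1-\alpha)}$ for $\alpha\in(0,1)\cup(1,\infty)$ (with $0/0=0$ and $a/0=\infty$ for $a>0$ when $\alpha>1$), $F_0(P,Q)=\sum_{x:P(x)>0}Q(x)$, $F_1(P,Q)=\prod_x (Q(x)/P(x))^{P(x)}$ (factors with $P(x)=0$ being $1$), and $F_\infty(P,Q)=\min_{x:P(x)>0}Q(x)/P(x)$. Let $\mathcal X$ be nonempty and let $\mathcal W:\mathcal X\to\mathcal Y$ be a discrete memoryless channel with transition probabilities $\mathcal W(y|x)$. For $P\in\mathcal P(\mathcal X)$ write $(P\cdot\mathcal W)(x,y)=P(x)\mathcal W(y|x)$. The order-$\alpha$ Rényi capacity, $\alpha\in[0,\infty]$,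 is $$I_\alpha(\mathcal W)=\max_{P\in\mathcal P(\mathcal X)}\ \min_{Q\in\mathcal P(\mathcal Y)} D_\alpha(P\cdot\mathcal W\,\|\,P\times Q).$$ **Simulation.** A channel $\mathcal N:\mathcal X\to\mathcal Y$ is a simulation with communication cost at most $c$ bits if there are an integer $M\ge1$ with $\log M\le c$, a finite set $\mathcal K$ with a distribution $P_K$ (shared randomness), and stochastic maps $\mathcal E:\mathcal X\times\mathcal K\to\{1,\dots,M\}$ and $\mathcal D:\{1,\dots,M\}\times\mathcal K\to\mathcal Y$ such that $$\mathcal N(y|x)=\sum_{k\in\mathcal K}\sum_{j=1}^{M}P_K(k)\,\mathcal E(j|x,k)\,\mathcal D(y|j,k).$$ Let $\mathsf D_\alpha(\mathcal W,c)$ be the minimum, over all such $\mathcal N$, of $\max_{P\in\mathcal P(\mathcal X)}D_\alpha(P\cdot\mathcal W\,\|\,P\cdot\mathcal N)$ (it is $\infty$ if $c<0$). With $\mathcal W^{\times n}$ denoting $n$ independent uses of $\mathcal W$, the reliability function is $$E_{\rm rf}^{(\alpha)}(\mathcal W,r)=\sup\Big\{\liminf_{n\to\infty}\frac{-1}{n}\log\mathsf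 D_\alpha(\mathcal W^{\times n},c_n)\ \Big|\ \limsup_{n\to\infty}\frac{c_n}{n}\le r\Big\},$$ the supremum being over real sequences $(c_n)_{n\ge1}$. **Theorem 2.** For every discrete memoryless channel $\mathcal W:\mathcal X\to\mathcal Y$: 1. If $0\le r<I_\infty(\mathcal W)$, then $$E_{\rm rf}^{(\alpha)}(\mathcal W,r)=\begin{cases}\sup\limits_{\beta\ge1}(\beta-1)\big(r-I_\beta(\mathcal W)\big),&\alpha\in(0,1],\\[4pt]\Big|\sup\limits_{\beta\ge\alpha}(\beta-1)\big(r-I_\beta(\mathcal W)\big)\Big|^+,&\alpha\in(1,\infty],\end{cases}$$ where $\beta$ ranges over extended reals up to and including $\infty$, and the term for $\beta=\infty$ is $-\infty$ (so the value for $\alpha=\infty$ is $0$). 2. If $r\ge I_\infty(\mathcal W)$, then $E_{\rm rf}^{(\alpha)}(\mathcal W,r)=\infty$ for every $\alpha\in[0,\infty]$. 3. For $\alpha=0$: $E_{\rm rf}^{(0)}(\mathcal W,r)=\infty$ if $r>I_0(\mathcal W)$, and $E_{\rm rf}^{(0)}(\mathcal W,r)=0$ if $0\le r<I_0(\mathcal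 W)$. -/

import Mathlib

open Filter
open scoped ENNReal

noncomputable section

namespace ChannelSimulation

/-- Logarithm to base `2` on `[0, ∞]`, with `log 0 = -∞` and `log ∞ = ∞`. -/
def log2 (x : ℝ≥0∞) : EReal := ENNReal.log x / ((Real.log 2 : ℝ) : EReal)

/-- Order-`α` fidelity of two nonnegative vectors on a finite alphabet, `α ∈ [0, ∞]`.
The arithmetic of `[0, ∞]` supplies the conventions `0 / 0 = 0` and `a / 0 = ∞` (`a > 0`)
for `P ^ α * Q ^ (1 - α)` when `α > 1`. -/
def fidelity {ι : Type*} [Fintype ι] (α : ℝ≥0∞) (P Q : ι → ℝ≥0∞) : ℝ≥0∞ :=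
  if α = 0 then ∑ x, (Function.support P).indicator Q x
  else if α = 1 then ∏ x, (Q x / P x) ^ (P x).toReal
  else if α = ∞ then ⨅ x ∈ Function.support P, Q x / P x
  else (∑ x, P x ^ α.toReal * Q x ^ (1 - α.toReal)) ^ (1 / (1 - α.toReal))

/-- Order-`α` Rényi divergence (in bits). -/
def renyiDiv {ι : Type*} [Fintype ι] (α : ℝ≥0∞) (P Q : ι → ℝ≥0∞) : EReal :=
  -log2 (fidelity α P Q)

/-- A discrete memoryless channel: `W x y` is the probability of output `y` on input `x`. -/
abbrev Channel (X Y : Type*) := X → PMF Y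

/-- The joint distribution `P · W` of input and output. -/
def joint {X Y : Type*} (P : PMF X) (W : Channel X Y) : X × Y → ℝ≥0∞ :=
  fun z => P z.1 * W z.1 z.2

/-- The product distribution `P × Q`. -/
def prodDist {X Y : Type*} (P : PMF X) (Q : PMF Y) : X × Y → ℝ≥0∞ :=
  fun z => P z.1 * Q z.2

/-- Rényi mutual information of order `α` of the joint distribution `P · W`. -/
def mutualInfo {X Y : Type*} [Fintype X] [Fintype Y] (α : ℝ≥0∞) (P : PMF X)
    (W : Channel X Y) : EReal :=
  ⨅ Q : PMF Y, renyiDiv α (joint P W) (prodDist P Q)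

/-- Rényi capacity of order `α`. -/
def capacity {X Y : Type*} [Fintype X] [Fintype Y] (α : ℝ≥0∞) (W : Channel X Y) : EReal :=
  ⨆ P : PMF X, mutualInfo α P W

/-- `n` independent uses of `W`. -/
def power {X Y : Type*} [Fintype Y] (W : Channel X Y) (n : ℕ) :
    Channel (Fin n → X) (Fin n → Y) := fun x =>
  PMF.ofFintype (fun y => ∏ i, W (x i) (y i)) (by
    classical
    rw [← Fintype.prod_sum (fun i b => W (x i) b)]
    exact Finset.prod_eq_one fun i _ => by simpa [tsum_fintype] using (W (x i)).tsum_coe)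

/-- `N` is realised by a simulation with shared randomness and at most `c` bits of
communication: the parties share `k ∼ PK`, the sender applies the stochastic map `E` to `(x, k)`
and sends the resulting symbol `j`, one of `M`, and the receiver applies the stochastic map `D`
to `(j, k)`. -/
def IsSimulation {X Y : Type*} (N : Channel X Y) (c : ℝ) : Prop :=
  ∃ M : ℕ, 1 ≤ M ∧ Real.logb 2 M ≤ c ∧
    ∃ (K : Type) (_ : Fintype K) (PK : PMF K)
      (E : Channel (X × K) (Fin M)) (D : Channel (Fin M × K) Y),
      ∀ x y, N x y = ∑ k, ∑ j, PK k * E (x, k) j * D (j, k) y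

/-- Order-`α` Rényi divergence between two channels. -/
def channelDiv {X Y : Type*} [Fintype X] [Fintype Y] (α : ℝ≥0∞) (W N : Channel X Y) : EReal :=
  ⨆ P : PMF X, renyiDiv α (joint P W) (joint P N)

/-- Least order-`α` divergence from `W` of a simulation using at most `c` bits. -/
def simDiv {X Y : Type*} [Fintype X] [Fintype Y] (α : ℝ≥0∞) (W : Channel X Y) (c : ℝ) : EReal :=
  ⨅ (N : Channel X Y) (_ : IsSimulation N c), channelDiv α W N

/-- The reliability function: the best exponential rate of decay of the simulation divergence of
`n` uses of `W`, over all sequences of communication costs of rate at most `r`. Since `simDiv`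
is nonnegative, `toENNReal` only changes its type. -/
def reliability {X Y : Type*} [Fintype X] [Fintype Y] (α : ℝ≥0∞) (W : Channel X Y)
    (r : ℝ) : EReal :=
  ⨆ (c : ℕ → ℝ) (_ : limsup (fun n : ℕ => ((c n / n : ℝ) : EReal)) atTop ≤ (r : EReal)),
    liminf (fun n : ℕ =>
      ((-1 / n : ℝ) : EReal) * log2 (simDiv α (power W n) (c n)).toENNReal) atTop

end ChannelSimulation

end

/-! Both directions rest on one description of simulations. With `M` messages every simulated
channel satisfies `N(y|x) ≤ M q(y)` for a single output distribution `q` (`IsSimulation.exists_le`).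
Conversely, rejection sampling from `q` realises any subchannel below `L q` up to the factor `1 -
exp (-M / L)` (`exists_isSimulationOfSize`), and `M ≈ n² L` makes this loss superexponential at no
cost in rate. What remains is how well `W^n` can be approximated from below `2^(nr) q`.

Achievability: truncate `W^n` to `min (W^n) (L q^n)` with `L = 2^(nr)`. For finite `β ≥ α > 1` a
Chernoff bound controls the excess of the order-`α` affinity over one by `L^(1-β) ∑ W^β q^(1-β)`
(`channelDiv_le_of_truncation`). Sion's theorem supplies one `q` for which this is about
`2^(-n(β-1)(r - I_β))` on all rows at once (`exists_output_of_scaledInfo_lt`). Orders `α ≤ 1`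
inherit the bound of every finite `β > 1` by comparison through order one.

Converse: for an input `P`, `scaledInfo` is `(b - 1)` times the order-`b` mutual information; it is
additive over products, convex and differentiable in `b`. A second minimax
(`exists_input_forall_order`) produces one `P` for which `(b - 1) r - scaledInfo` is bounded for all
`b ≥ max α 1`; `r < I_∞` leaves room to do so at a rate slightly above `r`. Tilting to the order
that maximises this expression, as in Cramér's theorem, shows that for every `Q` the set where `W^n`
far exceeds `2^(nr) Q` carries enough probability, or enough order-`α` moment if `α > 1`
(`eventually_exp_le_sum_tail`). There `W^n / N` is large, which moves the affinity away from one by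
a comparable amount.

Boundary regimes: for `r ≥ I_∞` the channel is already below `2^r q` and needs no truncation. For `α
= ∞` and `r < I_∞`, summing column maxima bounds the divergence below. Order zero only sees the mass
that `N` puts on the support of `W`, which a linear minimax handles. -/

noncomputable section

namespace ChannelSimulation

open Real Topology

/-! ### Minimax -/

/-- Sion's minimax theorem in attained form: if every `y` has a response `x` with `f x y ≤ C`,
then some `x` works for all `y` at once. -/
theorem exists_forall_le_of_forall_exists_le {E F : Type*}
    [TopologicalSpace E] [AddCommGroup E] [Module ℝ E] [IsTopologicalAddGroup E]
    [ContinuousSMul ℝ E] [TopologicalSpace F] [AddCommGroup F] [Module ℝ F]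
    [IsTopologicalAddGroup F] [ContinuousSMul ℝ F]
    {S : Set E} {T : Set F} {f : E → F → ℝ} {C : ℝ}
    (neS : S.Nonempty) (cS : Convex ℝ S) (kS : IsCompact S) (cT : Convex ℝ T)
    (hcont : ∀ y ∈ T, ContinuousOn (fun x => f x y) S)
    (hconv : ∀ y ∈ T, QuasiconvexOn ℝ S fun x => f x y)
    (hcont' : ∀ x ∈ S, ContinuousOn (fun y => f x y) T)
    (hconc : ∀ x ∈ S, QuasiconcaveOn ℝ T fun y => f x y)
    (h : ∀ y ∈ T, ∃ x ∈ S, f x y ≤ C) : ∃ x ∈ S, ∀ y ∈ T, f x y ≤ C := by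
  by_contra! hne
  have hU : ∀ y : T, ∃ U : Set E, IsOpen U ∧ {x ∈ S | C < f x y} = U ∩ S := by
    intro y
    obtain ⟨U, hU, hU'⟩ := (continuousOn_iff'.mp (hcont y y.2)) (Set.Ioi C) isOpen_Ioi
    refine ⟨U, hU, ?_⟩
    rw [← hU']
    ext x
    simp [and_comm]
  choose U hUo hUS using hU
  -- If no `x` worked, the open sets `C < f · y` would cover `S`; a finite subcover and the finite
  -- form of Sion's theorem then give one `y` that beats `C` everywhere, against `h`.
  have hcover : S ⊆ ⋃ y, U y := by
    intro x hx
    obtain ⟨y, hy, hxy⟩ := hne x hx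
    have : x ∈ U ⟨y, hy⟩ ∩ S := by
      rw [← hUS]
      exact ⟨hx, hxy⟩
    exact Set.mem_iUnion.mpr ⟨_, this.1⟩
  obtain ⟨t, ht⟩ := kS.elim_finite_subcover U hUo hcover
  obtain ⟨y, hy, hyC⟩ := Sion.exists_lt_iInf_of_lt_iInf_of_finite neS kS
    (fun y hy => (hcont y hy).lowerSemicontinuousOn) hconv cT
    (fun x hx => (hcont' x hx).upperSemicontinuousOn) hconc cS
    (s := ((↑) : T → F) '' (t : Set T)) (t.finite_toSet.image _)
    (by rintro _ ⟨y, _, rfl⟩; exact y.2) (t := C) (by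
      intro x hx
      obtain ⟨y, hyt, hxy⟩ : ∃ y ∈ t, x ∈ U y := by simpa using ht hx
      have : x ∈ {x ∈ S | C < f x y} := by
        rw [hUS]
        exact ⟨hxy, hx⟩
      exact ⟨y, ⟨y, hyt, rfl⟩, this.2⟩)
  obtain ⟨x, hx, hxC⟩ := h y hy
  exact absurd hxC (not_le.mpr (hyC x hx))

/-! ### Hölder inequalities -/

/-- Hölder's inequality for a weighted geometric mean. -/
theorem sum_rpow_mul_rpow_le {ι : Type*} (s : Finset ι) {f g : ι → ℝ} {t : ℝ}
    (hf : ∀ i ∈ s, 0 ≤ f i) (hg : ∀ i ∈ s, 0 ≤ g i) (ht0 : 0 < t) (ht1 : t < 1) :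
    ∑ i ∈ s, f i ^ t * g i ^ (1 - t) ≤ (∑ i ∈ s, f i) ^ t * (∑ i ∈ s, g i) ^ (1 - t) := by
  have h1t : 0 < 1 - t := by linarith
  have hpq : (1 / t).HolderConjugate (1 / (1 - t)) := by
    rw [Real.holderConjugate_iff]
    refine ⟨by rw [lt_div_iff₀ ht0]; linarith, by simp⟩
  have := Real.inner_le_Lp_mul_Lq_of_nonneg s (f := fun i => f i ^ t)
    (g := fun i => g i ^ (1 - t)) hpq (fun i hi => rpow_nonneg (hf i hi) _)
    (fun i hi => rpow_nonneg (hg i hi) _)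
  refine this.trans (le_of_eq ?_)
  rw [one_div_one_div, one_div_one_div]
  congr 2
  · refine Finset.sum_congr rfl fun i hi => ?_
    rw [← rpow_mul (hf i hi), mul_one_div_cancel ht0.ne', rpow_one]
  · refine Finset.sum_congr rfl fun i hi => ?_
    rw [← rpow_mul (hg i hi), mul_one_div_cancel h1t.ne', rpow_one]

/-- Reverse Hölder inequality for `p ^ b * q ^ (1 - b)` with `b ≥ 1`. -/
theorem rpow_sum_le_sum_rpow_mul_rpow {ι : Type*} (s : Finset ι) {p q : ι → ℝ} {b : ℝ}
    (hp : ∀ i ∈ s, 0 ≤ p i) (hq : ∀ i ∈ s, 0 ≤ q i) (hpq : ∀ i ∈ s, p i ≠ 0 → q i ≠ 0)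
    (hb : 1 ≤ b) (hq1 : ∑ i ∈ s, q i ≤ 1) :
    (∑ i ∈ s, p i) ^ b ≤ ∑ i ∈ s, p i ^ b * q i ^ (1 - b) := by
  rcases hb.eq_or_lt with rfl | hb
  · simp
  have hb0 : 0 < b := by linarith
  have hnn : ∀ i ∈ s, 0 ≤ p i ^ b * q i ^ (1 - b) := fun i hi =>
    mul_nonneg (rpow_nonneg (hp i hi) _) (rpow_nonneg (hq i hi) _)
  -- With weight `1 / b` on `p ^ b * q ^ (1 - b)` and `1 - 1 / b` on `q`, the powers of `q` cancel
  -- and the geometric mean is `p`.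
  have key := sum_rpow_mul_rpow_le s (f := fun i => p i ^ b * q i ^ (1 - b)) (g := q)
    (t := 1 / b) hnn hq (by positivity) (by rw [div_lt_one hb0]; exact hb)
  have hle : ∑ i ∈ s, p i ≤ (∑ i ∈ s, p i ^ b * q i ^ (1 - b)) ^ (1 / b) := by
    calc ∑ i ∈ s, p i
        = ∑ i ∈ s, (p i ^ b * q i ^ (1 - b)) ^ (1 / b) * q i ^ (1 - 1 / b) := by
          refine Finset.sum_congr rfl fun i hi => ?_
          rcases (hp i hi).eq_or_lt with h0 | h0
          · rw [← h0, zero_rpow hb0.ne', zero_mul, zero_rpow (by positivity), zero_mul]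
          · have hqi : 0 < q i := lt_of_le_of_ne (hq i hi) (hpq i hi h0.ne').symm
            rw [mul_rpow (by positivity) (by positivity), ← rpow_mul h0.le, ← rpow_mul hqi.le,
              mul_assoc, ← rpow_add hqi]
            have e1 : b * (1 / b) = 1 := by field_simp
            have e2 : (1 - b) * (1 / b) + (1 - 1 / b) = 0 := by field_simp; ring
            rw [e1, e2, rpow_one, rpow_zero, mul_one]
      _ ≤ _ := key
      _ ≤ (∑ i ∈ s, p i ^ b * q i ^ (1 - b)) ^ (1 / b) * 1 := by
          gcongr
          · exact rpow_nonneg (Finset.sum_nonneg hnn) _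
          · exact rpow_le_one (Finset.sum_nonneg hq) hq1
              (by rw [sub_nonneg, div_le_one hb0]; exact hb.le)
      _ = _ := mul_one _
  calc (∑ i ∈ s, p i) ^ b
      ≤ ((∑ i ∈ s, p i ^ b * q i ^ (1 - b)) ^ (1 / b)) ^ b :=
        rpow_le_rpow (Finset.sum_nonneg hp) hle hb0.le
    _ = _ := by
        rw [← rpow_mul (Finset.sum_nonneg hnn), one_div_mul_cancel hb0.ne', rpow_one]

/-- Negative powers are convex on the positive half-line. -/
theorem convexOn_rpow_of_nonpos {s : ℝ} (hs : s ≤ 0) :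
    ConvexOn ℝ (Set.Ioi 0) fun x : ℝ => x ^ s := by
  refine ⟨convex_Ioi 0, fun x hx y hy a b ha hb hab => ?_⟩
  simp only [Set.mem_Ioi, smul_eq_mul] at *
  -- Weighted AM-GM twice: once on the bases, reversed by the negative power, and once on the
  -- powers.
  have h1 := Real.geom_mean_le_arith_mean2_weighted ha hb hx.le hy.le hab
  have h2 := Real.geom_mean_le_arith_mean2_weighted ha hb (rpow_nonneg hx.le s)
    (rpow_nonneg hy.le s) hab
  calc (a * x + b * y) ^ s ≤ (x ^ a * y ^ b) ^ s :=
        rpow_le_rpow_of_nonpos (by positivity) h1 hs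
    _ = (x ^ s) ^ a * (y ^ s) ^ b := by
        rw [mul_rpow (by positivity) (by positivity), ← rpow_mul hx.le, ← rpow_mul hy.le,
          ← rpow_mul hx.le, ← rpow_mul hy.le, mul_comm a, mul_comm b]
    _ ≤ _ := h2

/-! ### The Sibson functional -/

section Sibson

variable {X Y : Type*} [Fintype X] [Fintype Y]

/-- The `b`-th moment of the column `w · y` under the input distribution `P`. -/
def columnMoment (P : X → ℝ) (w : X → Y → ℝ) (b : ℝ) (y : Y) : ℝ := ∑ x, P x * w x y ^ b

/-- Sibson's functional: the sum of the `L^b(P)` norms of the columns of `w`. -/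
def sibson (P : X → ℝ) (w : X → Y → ℝ) (b : ℝ) : ℝ := ∑ y, columnMoment P w b y ^ (1 / b)

/-- `(b - 1)` times the order-`b` Rényi mutual information (in nats) of `P · w`. -/
def scaledInfo (P : X → ℝ) (w : X → Y → ℝ) (b : ℝ) : ℝ := b * log (sibson P w b)

/-- The output distribution minimising the order-`b` divergence. -/
def sibsonOutput (P : X → ℝ) (w : X → Y → ℝ) (b : ℝ) (y : Y) : ℝ :=
  columnMoment P w b y ^ (1 / b) / sibson P w b

variable {P : X → ℝ} {w : X → Y → ℝ}

theorem columnMoment_nonneg (hP : P ∈ stdSimplex ℝ X) (hw : ∀ x, w x ∈ stdSimplex ℝ Y) (b : ℝ)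
    (y : Y) : 0 ≤ columnMoment P w b y :=
  Finset.sum_nonneg fun x _ => mul_nonneg (hP.1 x) (rpow_nonneg ((hw x).1 y) _)

theorem columnMoment_pos (hP : P ∈ stdSimplex ℝ X) (hw : ∀ x, w x ∈ stdSimplex ℝ Y) (b : ℝ)
    {x : X} {y : Y} (h : P x * w x y ≠ 0) : 0 < columnMoment P w b y := by
  have h1 : 0 < P x := lt_of_le_of_ne (hP.1 x) (left_ne_zero_of_mul h).symm
  have h2 : 0 < w x y := lt_of_le_of_ne ((hw x).1 y) (right_ne_zero_of_mul h).symm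
  refine Finset.sum_pos' (fun x _ => mul_nonneg (hP.1 x) (rpow_nonneg ((hw x).1 y) _))
    ⟨x, Finset.mem_univ _, by positivity⟩

theorem exists_pos_of_mem_stdSimplex {ι : Type*} [Fintype ι] {p : ι → ℝ}
    (hp : p ∈ stdSimplex ℝ ι) : ∃ i, 0 < p i := by
  by_contra! h
  have : ∑ i, p i ≤ 0 := Finset.sum_nonpos fun i _ => h i
  linarith [hp.2]

theorem sibson_pos (hP : P ∈ stdSimplex ℝ X) (hw : ∀ x, w x ∈ stdSimplex ℝ Y) (b : ℝ) :
    0 < sibson P w b := by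
  obtain ⟨x, hx⟩ := exists_pos_of_mem_stdSimplex hP
  obtain ⟨y, hy⟩ := exists_pos_of_mem_stdSimplex (hw x)
  exact Finset.sum_pos' (fun y _ => rpow_nonneg (columnMoment_nonneg hP hw b y) _)
    ⟨y, Finset.mem_univ _, rpow_pos_of_pos (columnMoment_pos hP hw b (mul_pos hx hy).ne') _⟩

theorem sibson_one (hP : P ∈ stdSimplex ℝ X) (hw : ∀ x, w x ∈ stdSimplex ℝ Y) :
    sibson P w 1 = 1 := by
  simp only [sibson, columnMoment, rpow_one, div_one]
  rw [Finset.sum_comm]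
  simp only [← Finset.mul_sum, (hw _).2, mul_one, hP.2]

theorem scaledInfo_one (hP : P ∈ stdSimplex ℝ X) (hw : ∀ x, w x ∈ stdSimplex ℝ Y) :
    scaledInfo P w 1 = 0 := by
  rw [scaledInfo, sibson_one hP hw, log_one, mul_zero]

theorem exp_scaledInfo (hP : P ∈ stdSimplex ℝ X) (hw : ∀ x, w x ∈ stdSimplex ℝ Y) (b : ℝ) :
    exp (scaledInfo P w b) = sibson P w b ^ b := by
  rw [scaledInfo, rpow_def_of_pos (sibson_pos hP hw b), mul_comm]

theorem sum_sum_eq_sum_columnMoment (b : ℝ) (v : Y → ℝ) :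
    ∑ x, ∑ y, P x * (w x y ^ b * v y) = ∑ y, columnMoment P w b y * v y := by
  rw [Finset.sum_comm]
  refine Finset.sum_congr rfl fun y _ => ?_
  rw [columnMoment, Finset.sum_mul]
  exact Finset.sum_congr rfl fun x _ => by ring

/-- Every output distribution has order-`b` moment at least `sibson ^ b`. -/
theorem exp_scaledInfo_le (hP : P ∈ stdSimplex ℝ X) (hw : ∀ x, w x ∈ stdSimplex ℝ Y) {b : ℝ}
    (hb : 1 ≤ b) {Q : Y → ℝ} (hQ : ∀ y, 0 ≤ Q y) (hQ1 : ∑ y, Q y ≤ 1)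
    (hPQ : ∀ x y, P x * w x y ≠ 0 → Q y ≠ 0) :
    exp (scaledInfo P w b) ≤ ∑ x, ∑ y, P x * (w x y ^ b * Q y ^ (1 - b)) := by
  have hb0 : 0 < b := by linarith
  rw [exp_scaledInfo hP hw, sum_sum_eq_sum_columnMoment b (fun y => Q y ^ (1 - b))]
  -- Reverse Hölder over the columns, applied to the `1 / b`-th powers of the column moments.
  refine (rpow_sum_le_sum_rpow_mul_rpow Finset.univ (q := Q)
    (fun y _ => rpow_nonneg (columnMoment_nonneg hP hw b y) _) (fun y _ => hQ y) ?_ hb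
    hQ1).trans (le_of_eq ?_)
  · intro y _ hy
    by_contra hQy
    apply hy
    have : columnMoment P w b y = 0 := by
      refine Finset.sum_eq_zero fun x _ => ?_
      by_cases h : P x * w x y = 0
      · rcases mul_eq_zero.mp h with h | h
        · rw [h, zero_mul]
        · rw [h, zero_rpow hb0.ne', mul_zero]
      · exact absurd hQy (hPQ x y h)
    rw [this, zero_rpow (by positivity)]
  · refine Finset.sum_congr rfl fun y _ => ?_
    rw [← rpow_mul (columnMoment_nonneg hP hw b y), one_div_mul_cancel hb0.ne', rpow_one]

theorem sibsonOutput_mem (hP : P ∈ stdSimplex ℝ X) (hw : ∀ x, w x ∈ stdSimplex ℝ Y) (b : ℝ) :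
    sibsonOutput P w b ∈ stdSimplex ℝ Y := by
  refine ⟨fun y => div_nonneg (rpow_nonneg (columnMoment_nonneg hP hw b y) _)
    (sibson_pos hP hw b).le, ?_⟩
  simp only [sibsonOutput]
  rw [← Finset.sum_div]
  exact div_self (sibson_pos hP hw b).ne'

theorem sibsonOutput_pos (hP : P ∈ stdSimplex ℝ X) (hw : ∀ x, w x ∈ stdSimplex ℝ Y) (b : ℝ)
    {x : X} {y : Y} (h : P x * w x y ≠ 0) : 0 < sibsonOutput P w b y :=
  div_pos (rpow_pos_of_pos (columnMoment_pos hP hw b h) _) (sibson_pos hP hw b)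

/-- The equality case of `exp_scaledInfo_le`: for `Q` proportional to `columnMoment ^ (1 / b)` every
column contributes `columnMoment ^ (1 / b) * sibson ^ (b - 1)`, and the total is `sibson ^ b`. -/
theorem sum_sum_sibsonOutput (hP : P ∈ stdSimplex ℝ X) (hw : ∀ x, w x ∈ stdSimplex ℝ Y) {b : ℝ}
    (hb : 0 < b) :
    ∑ x, ∑ y, P x * (w x y ^ b * sibsonOutput P w b y ^ (1 - b)) = exp (scaledInfo P w b) := by
  have hs := sibson_pos hP hw b
  rw [exp_scaledInfo hP hw, sum_sum_eq_sum_columnMoment b (fun y => sibsonOutput P w b y ^ (1 - b))]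
  have : ∀ y, columnMoment P w b y * sibsonOutput P w b y ^ (1 - b) =
      columnMoment P w b y ^ (1 / b) * sibson P w b ^ (b - 1) := by
    intro y
    rcases (columnMoment_nonneg hP hw b y).eq_or_lt with h | h
    · rw [← h, zero_mul, zero_rpow (by positivity), zero_mul]
    · rw [sibsonOutput, div_rpow (by positivity) hs.le, ← rpow_mul h.le, div_eq_mul_inv,
        ← rpow_neg hs.le, ← mul_assoc, neg_sub]
      congr 1
      nth_rw 1 [← rpow_one (columnMoment P w b y)]
      rw [← rpow_add h]
      congr 1
      field_simp
      ring
  simp only [this]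
  rw [← Finset.sum_mul]
  change sibson P w b * _ = _
  nth_rw 1 [← rpow_one (sibson P w b)]
  rw [← rpow_add hs, add_sub_cancel]

/-- `scaledInfo` is convex in the order. -/
theorem scaledInfo_convex (hP : P ∈ stdSimplex ℝ X) (hw : ∀ x, w x ∈ stdSimplex ℝ Y) :
    ConvexOn ℝ (Set.Ioi 0) (scaledInfo P w) := by
  refine convexOn_iff_forall_pos.mpr ⟨convex_Ioi 0, ?_⟩
  intro b₁ hb₁ b₂ hb₂ s t hs ht hst
  simp only [Set.mem_Ioi, smul_eq_mul] at *
  set b := s * b₁ + t * b₂ with hb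
  have hb0 : 0 < b := by positivity
  obtain rfl : t = 1 - s := by linarith
  have hs1 : s < 1 := by linarith
  -- Hölder over the inputs: each column moment is log-convex in the order.
  have hcol : ∀ y, columnMoment P w b y ≤
      columnMoment P w b₁ y ^ s * columnMoment P w b₂ y ^ (1 - s) := by
    intro y
    refine (le_of_eq ?_).trans (sum_rpow_mul_rpow_le Finset.univ
      (fun x _ => mul_nonneg (hP.1 x) (rpow_nonneg ((hw x).1 y) _))
      (fun x _ => mul_nonneg (hP.1 x) (rpow_nonneg ((hw x).1 y) _)) hs hs1)
    refine Finset.sum_congr rfl fun x _ => ?_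
    have hPx := hP.1 x
    have hwx := (hw x).1 y
    rcases hPx.eq_or_lt with h | h
    · rw [← h]
      simp [zero_rpow hs.ne']
    rcases hwx.eq_or_lt with h' | h'
    · rw [← h']
      simp [zero_rpow hs.ne', zero_rpow hb0.ne', zero_rpow hb₁.ne']
    · rw [mul_rpow h.le (by positivity), mul_rpow h.le (by positivity), ← rpow_mul h'.le,
        ← rpow_mul h'.le]
      have e : P x ^ s * w x y ^ (b₁ * s) * (P x ^ (1 - s) * w x y ^ (b₂ * (1 - s))) =
          (P x ^ s * P x ^ (1 - s)) * (w x y ^ (b₁ * s) * w x y ^ (b₂ * (1 - s))) := by ring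
      rw [e, ← rpow_add h, ← rpow_add h', add_sub_cancel, rpow_one, hb]
      ring_nf
  -- A second Hölder, over the columns. The weight `θ` is dictated by `s / b = θ / b₁`; the
  -- prefactor `b` of `scaledInfo` turns it back into `s * b₁`.
  set θ := s * b₁ / b with hθ
  have hθ0 : 0 < θ := by positivity
  have hθ' : 1 - θ = (1 - s) * b₂ / b := by rw [hθ]; field_simp; linarith
  have hθ1 : θ < 1 := by
    have : 0 < 1 - θ := by rw [hθ']; positivity
    linarith
  have hnn := columnMoment_nonneg hP hw
  have hsib : sibson P w b ≤ sibson P w b₁ ^ θ * sibson P w b₂ ^ (1 - θ) := by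
    refine le_trans (Finset.sum_le_sum fun y _ => ?_) (sum_rpow_mul_rpow_le Finset.univ
      (fun y _ => rpow_nonneg (hnn b₁ y) (1 / b₁)) (fun y _ => rpow_nonneg (hnn b₂ y) (1 / b₂))
      hθ0 hθ1)
    refine (rpow_le_rpow (hnn b y) (hcol y) (by positivity)).trans (le_of_eq ?_)
    rw [mul_rpow (rpow_nonneg (hnn _ _) _) (rpow_nonneg (hnn _ _) _), ← rpow_mul (hnn _ _),
      ← rpow_mul (hnn _ _), ← rpow_mul (hnn _ _), ← rpow_mul (hnn _ _), hθ', hθ]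
    congr 2
    · field_simp
    · field_simp
  have p := sibson_pos hP hw
  have := log_le_log (p b) hsib
  rw [log_mul (rpow_pos_of_pos (p _) _).ne' (rpow_pos_of_pos (p _) _).ne', log_rpow (p _),
    log_rpow (p _), hθ', hθ] at this
  calc scaledInfo P w b ≤ b * (s * b₁ / b * log (sibson P w b₁) +
        (1 - s) * b₂ / b * log (sibson P w b₂)) := by
        rw [scaledInfo]; gcongr
    _ = _ := by rw [scaledInfo, scaledInfo]; field_simp

/-- Entries and columns that vanish stay zero for all positive orders, so they are locally constant;
all other terms are smooth powers of positive numbers. This permits the first-order condition at the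
optimal order. -/
theorem differentiableAt_scaledInfo (hP : P ∈ stdSimplex ℝ X) (hw : ∀ x, w x ∈ stdSimplex ℝ Y)
    {b : ℝ} (hb : 0 < b) : DifferentiableAt ℝ (scaledInfo P w) b := by
  have hterm : ∀ x y, DifferentiableAt ℝ (fun b => P x * w x y ^ b) b := by
    intro x y
    refine DifferentiableAt.const_mul ?_ _
    rcases ((hw x).1 y).eq_or_lt with h | h
    · rw [← h]
      have : (fun b : ℝ => (0 : ℝ) ^ b) =ᶠ[𝓝 b] fun _ => 0 := by
        filter_upwards [lt_mem_nhds hb] with c hc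
        exact zero_rpow hc.ne'
      exact (differentiableAt_const _).congr_of_eventuallyEq this
    · exact (Real.hasStrictDerivAt_const_rpow h b).hasDerivAt.differentiableAt
  have hcol : ∀ y, DifferentiableAt ℝ (fun b => columnMoment P w b y) b := fun y =>
    DifferentiableAt.fun_sum fun x _ => hterm x y
  have hsib : DifferentiableAt ℝ (fun b => sibson P w b) b := by
    refine DifferentiableAt.fun_sum fun y _ => ?_
    by_cases h : ∃ x, P x * w x y ≠ 0
    · obtain ⟨x, hx⟩ := h
      exact (hcol y).rpow ((differentiableAt_const _).div differentiableAt_id hb.ne')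
        (columnMoment_pos hP hw b hx).ne'
    · push Not at h
      have : (fun b => columnMoment P w b y ^ (1 / b)) =ᶠ[𝓝 b] fun _ => 0 := by
        filter_upwards [lt_mem_nhds hb] with c hc
        have : columnMoment P w c y = 0 := by
          refine Finset.sum_eq_zero fun x _ => ?_
          rcases mul_eq_zero.mp (h x) with h | h
          · rw [h, zero_mul]
          · rw [h, zero_rpow hc.ne', mul_zero]
        rw [this, zero_rpow (by positivity)]
      exact (differentiableAt_const _).congr_of_eventuallyEq this
  exact differentiableAt_id.mul (hsib.log (sibson_pos hP hw b).ne')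

/-- Column moments are linear in the input, and `t ↦ t ^ (1 / b)` is concave for `b ≥ 1`. -/
theorem concaveOn_sibson (hw : ∀ x, w x ∈ stdSimplex ℝ Y) {b : ℝ} (hb : 1 ≤ b) :
    ConcaveOn ℝ (stdSimplex ℝ X) (fun P => sibson P w b) := by
  refine ⟨convex_stdSimplex ℝ X, fun P hP P' hP' s t hs ht hst => ?_⟩
  simp only [sibson, smul_eq_mul]
  rw [Finset.mul_sum, Finset.mul_sum, ← Finset.sum_add_distrib]
  refine Finset.sum_le_sum fun y _ => ?_
  have hlin : columnMoment (s • P + t • P') w b y =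
      s * columnMoment P w b y + t * columnMoment P' w b y := by
    simp only [columnMoment, Pi.add_apply, Pi.smul_apply, smul_eq_mul, Finset.mul_sum,
      ← Finset.sum_add_distrib]
    exact Finset.sum_congr rfl fun x _ => by ring
  rw [hlin]
  exact (Real.concaveOn_rpow (by positivity) (by rw [div_le_one (by linarith)]; exact hb)).2
    (columnMoment_nonneg hP hw b y) (columnMoment_nonneg hP' hw b y) hs ht hst

theorem continuousOn_scaledInfo (hw : ∀ x, w x ∈ stdSimplex ℝ Y) {b : ℝ} (hb : 0 < b) :
    ContinuousOn (fun P => scaledInfo P w b) (stdSimplex ℝ X) := by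
  have : Continuous fun P : X → ℝ => sibson P w b := by
    refine continuous_finsetSum _ fun y _ => Continuous.rpow_const ?_ fun P => Or.inr ?_
    · unfold columnMoment
      fun_prop
    · positivity
  exact continuousOn_const.mul (this.continuousOn.log fun P hP => (sibson_pos hP hw b).ne')

end Sibson

/-! ### Products -/

section Product

variable {X Y : Type*}

/-- The `n`-fold product of a vector. -/
def prodVec (P : X → ℝ) (n : ℕ) (x : Fin n → X) : ℝ := ∏ i, P (x i)

/-- The `n`-fold product of a matrix. -/
def prodMat (w : X → Y → ℝ) (n : ℕ) (x : Fin n → X) (y : Fin n → Y) : ℝ := ∏ i, w (x i) (y i)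

theorem sum_prodVec [Fintype X] (P : X → ℝ) (n : ℕ) : ∑ x, prodVec P n x = (∑ x, P x) ^ n :=
  (Fintype.sum_pow P n).symm

theorem sum_prodMat [Fintype Y] (w : X → Y → ℝ) (n : ℕ) (x : Fin n → X) :
    ∑ y, prodMat w n x y = ∏ i, ∑ y, w (x i) y :=
  (Fintype.prod_sum fun i y => w (x i) y).symm

theorem prodVec_mem [Fintype X] {P : X → ℝ} (hP : P ∈ stdSimplex ℝ X) (n : ℕ) :
    prodVec P n ∈ stdSimplex ℝ (Fin n → X) :=
  ⟨fun x => Finset.prod_nonneg fun i _ => hP.1 (x i), by rw [sum_prodVec, hP.2, one_pow]⟩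

theorem prodMat_mem [Fintype Y] {w : X → Y → ℝ} (hw : ∀ x, w x ∈ stdSimplex ℝ Y) (n : ℕ) (x : Fin n → X) :
    prodMat w n x ∈ stdSimplex ℝ (Fin n → Y) :=
  ⟨fun y => Finset.prod_nonneg fun i _ => (hw (x i)).1 (y i), by
    rw [sum_prodMat]; exact Finset.prod_eq_one fun i _ => (hw (x i)).2⟩

theorem columnMoment_prod [Fintype X] [Fintype Y] (P : X → ℝ) {w : X → Y → ℝ} (hw : ∀ x, w x ∈ stdSimplex ℝ Y)
    (b : ℝ) (n : ℕ) (y : Fin n → Y) :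
    columnMoment (prodVec P n) (prodMat w n) b y = ∏ i, columnMoment P w b (y i) := by
  simp only [columnMoment]
  rw [Fintype.prod_sum fun i x => P x * w x (y i) ^ b]
  refine Finset.sum_congr rfl fun x _ => ?_
  rw [prodVec, prodMat, ← Real.finsetProd_rpow _ _ fun i _ => (hw (x i)).1 (y i),
    Finset.prod_mul_distrib]

/-- Column moments of a product factorise, hence so does `sibson`; this is what makes the converse
exponent single-letter. -/
theorem scaledInfo_prod [Fintype X] [Fintype Y] {P : X → ℝ} {w : X → Y → ℝ} (hP : P ∈ stdSimplex ℝ X)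
    (hw : ∀ x, w x ∈ stdSimplex ℝ Y) (b : ℝ) (n : ℕ) :
    scaledInfo (prodVec P n) (prodMat w n) b = n * scaledInfo P w b := by
  have : sibson (prodVec P n) (prodMat w n) b = sibson P w b ^ n := by
    simp only [sibson]
    rw [Fintype.sum_pow]
    refine Finset.sum_congr rfl fun y _ => ?_
    rw [columnMoment_prod P hw, Real.finsetProd_rpow _ _ fun i _ =>
      columnMoment_nonneg hP hw b (y i)]
  rw [scaledInfo, this, log_pow, scaledInfo]
  ring

end Product

/-! ### Lower bounds on tails of the likelihood ratio -/

section Tail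

variable {X Y : Type*} [Fintype X] [Fintype Y] {P : X → ℝ} {w : X → Y → ℝ}

/-- Passing between orders costs a power of the likelihood ratio, so a bound on `v / u` compares
moments of different orders. -/
theorem rpow_mul_rpow_one_sub {v u : ℝ} (hv : 0 < v) (hu : 0 < u) (b c : ℝ) :
    v ^ b * u ^ (1 - b) = (v / u) ^ (b - c) * (v ^ c * u ^ (1 - c)) := by
  rw [div_rpow hv.le hu.le, div_eq_mul_inv, ← rpow_neg hu.le]
  calc v ^ b * u ^ (1 - b) = v ^ ((b - c) + c) * u ^ (-(b - c) + (1 - c)) := by ring_nf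
    _ = _ := by rw [rpow_add hv, rpow_add hu]; ring

/-- A change of measure bound: whatever the output distribution `Q`, a multiple `B` of a
slight modification of it satisfies a lower bound on the tail `w > κ B`. -/
theorem exists_le_sum_tail (hP : P ∈ stdSimplex ℝ X) (hw : ∀ x, w x ∈ stdSimplex ℝ Y)
    {a b b₁ b₂ L κ R : ℝ} (hab : a ≤ b) (hb₁ : 1 ≤ b₁) (hb₁b : b₁ < b) (hbb₂ : b < b₂)
    (hL : 0 < L) (hκ : 0 < κ) (hR : 0 < R) {Q : Y → ℝ} (hQ : Q ∈ stdSimplex ℝ Y) :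
    ∃ B : Y → ℝ, (∀ y, 0 < B y) ∧ (∀ y, L * Q y ≤ B y) ∧
      exp (scaledInfo P w b) - (4 * κ * L) ^ (b - b₁) * (4 ^ (b₁ - 1) * exp (scaledInfo P w b₁)) -
        R ^ (b - b₂) * (4 ^ (b₂ - 1) * exp (scaledInfo P w b₂)) ≤
      (4 * L) ^ (a - 1) * R ^ (b - a) * ∑ x, ∑ y,
        if κ * B y < w x y then P x * (w x y ^ a * B y ^ (1 - a)) else 0 := by
  have hY : Nonempty Y := ⟨(exists_pos_of_mem_stdSimplex hQ).choose⟩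
  set q₁ := sibsonOutput P w b₁
  set q₂ := sibsonOutput P w b₂
  have hq₁ : q₁ ∈ stdSimplex ℝ Y := sibsonOutput_mem hP hw b₁
  have hq₂ : q₂ ∈ stdSimplex ℝ Y := sibsonOutput_mem hP hw b₂
  -- Moments of order `b₁` and `b₂` against an arbitrary `Q` may be huge. Averaging with the two
  -- Sibson optimisers keeps them within `4 ^ (c - 1)` of the minimum, `Q ≤ 4 u` keeps the
  -- domination, and the uniform part makes `u` positive.
  set u : Y → ℝ := fun y => (Q y + q₁ y + q₂ y + (Fintype.card Y : ℝ)⁻¹) / 4 with hu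
  have hcard : (0 : ℝ) < Fintype.card Y := by exact_mod_cast Fintype.card_pos
  have hu0 : ∀ y, 0 < u y := by
    intro y
    have := hQ.1 y; have := hq₁.1 y; have := hq₂.1 y
    have : 0 < (Fintype.card Y : ℝ)⁻¹ := by positivity
    simp only [hu]; linarith
  have hu1 : ∑ y, u y ≤ 1 := by
    simp only [hu]
    rw [← Finset.sum_div, Finset.sum_add_distrib, Finset.sum_add_distrib, Finset.sum_add_distrib,
      hQ.2, hq₁.2, hq₂.2]
    simp [hcard.ne']
    norm_num
  have hmoment : ∀ c, 1 ≤ c → (∀ y, sibsonOutput P w c y ≤ 4 * u y) →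
      ∑ x, ∑ y, P x * (w x y ^ c * u y ^ (1 - c)) ≤ 4 ^ (c - 1) * exp (scaledInfo P w c) := by
    intro c hc hle
    rw [← sum_sum_sibsonOutput hP hw (by linarith : 0 < c), Finset.mul_sum]
    refine Finset.sum_le_sum fun x _ => ?_
    rw [Finset.mul_sum]
    refine Finset.sum_le_sum fun y _ => ?_
    by_cases h : P x * w x y = 0
    · rcases mul_eq_zero.mp h with h | h
      · simp [h]
      · rw [h, zero_rpow (by linarith)]; simp
    · have hpos : 0 < sibsonOutput P w c y := sibsonOutput_pos hP hw c h
      have h1 : (4 * u y) ^ (1 - c) ≤ sibsonOutput P w c y ^ (1 - c) :=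
        rpow_le_rpow_of_nonpos hpos (hle y) (by linarith)
      have h2 : u y ^ (1 - c) = 4 ^ (c - 1) * (4 * u y) ^ (1 - c) := by
        rw [mul_rpow (by norm_num) (hu0 y).le, ← mul_assoc, ← rpow_add (by norm_num)]
        simp
      have h3 : 0 ≤ P x := hP.1 x
      have h4 : 0 ≤ w x y ^ c := rpow_nonneg ((hw x).1 y) _
      calc P x * (w x y ^ c * u y ^ (1 - c))
          = 4 ^ (c - 1) * (P x * (w x y ^ c * (4 * u y) ^ (1 - c))) := by rw [h2]; ring
        _ ≤ _ := by gcongr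
  have hb₁m := hmoment b₁ hb₁ fun y => by
    have := hQ.1 y; have := hq₂.1 y
    have : 0 < (Fintype.card Y : ℝ)⁻¹ := by positivity
    simp only [hu]; linarith
  have hb₂m := hmoment b₂ (by linarith) fun y => by
    have := hQ.1 y; have := hq₁.1 y
    have : 0 < (Fintype.card Y : ℝ)⁻¹ := by positivity
    simp only [hu]; linarith
  have hbm := exp_scaledInfo_le hP hw (b := b) (by linarith) (fun y => (hu0 y).le) hu1
    (fun _ y _ => (hu0 y).ne')
  refine ⟨fun y => 4 * L * u y, fun y => by have := hu0 y; positivity, fun y => ?_, ?_⟩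
  · have := hq₁.1 y; have := hq₂.1 y
    have : 0 < (Fintype.card Y : ℝ)⁻¹ := by positivity
    have : Q y ≤ 4 * u y := by simp only [hu]; linarith
    calc L * Q y ≤ L * (4 * u y) := by gcongr
      _ = _ := by ring
  -- Three ranges of the ratio `w / u`: below `4 κ L` the order `b₁` majorises, above `R` the order
  -- `b₂`, and in between the tail term of order `a`.
  have hpt : ∀ x y, P x * (w x y ^ b * u y ^ (1 - b)) ≤
      (4 * κ * L) ^ (b - b₁) * (P x * (w x y ^ b₁ * u y ^ (1 - b₁))) +
      R ^ (b - b₂) * (P x * (w x y ^ b₂ * u y ^ (1 - b₂))) +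
      (4 * L) ^ (a - 1) * R ^ (b - a) *
        if κ * (4 * L * u y) < w x y then P x * (w x y ^ a * (4 * L * u y) ^ (1 - a)) else 0 := by
    intro x y
    have hPx := hP.1 x
    have huy := hu0 y
    have hwy := (hw x).1 y
    have n1 : 0 ≤ (4 * κ * L) ^ (b - b₁) * (P x * (w x y ^ b₁ * u y ^ (1 - b₁))) := by positivity
    have n2 : 0 ≤ R ^ (b - b₂) * (P x * (w x y ^ b₂ * u y ^ (1 - b₂))) := by positivity
    have n3 : 0 ≤ (4 * L) ^ (a - 1) * R ^ (b - a) *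
        if κ * (4 * L * u y) < w x y then P x * (w x y ^ a * (4 * L * u y) ^ (1 - a)) else 0 := by
      split_ifs <;> positivity
    rcases hwy.eq_or_lt with h0 | h0
    · have : P x * (w x y ^ b * u y ^ (1 - b)) = 0 := by
        rw [← h0, zero_rpow (by linarith)]; simp
      linarith
    by_cases hlow : κ * (4 * L * u y) < w x y
    · by_cases hhigh : w x y ≤ R * u y
      · have : P x * (w x y ^ b * u y ^ (1 - b)) ≤ (4 * L) ^ (a - 1) * R ^ (b - a) *
            (P x * (w x y ^ a * (4 * L * u y) ^ (1 - a))) := by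
          have h1 : (w x y / u y) ^ (b - a) ≤ R ^ (b - a) :=
            rpow_le_rpow (by positivity) (by rwa [div_le_iff₀ huy]) (by linarith)
          have h2 : (4 * L * u y) ^ (1 - a) = (4 * L) ^ (1 - a) * u y ^ (1 - a) :=
            mul_rpow (by positivity) huy.le
          have h3 : (4 * L) ^ (a - 1) * (4 * L) ^ (1 - a) = 1 := by
            rw [← rpow_add (by positivity)]; simp
          calc P x * (w x y ^ b * u y ^ (1 - b))
              = (w x y / u y) ^ (b - a) * (P x * (w x y ^ a * u y ^ (1 - a))) := by
                rw [rpow_mul_rpow_one_sub h0 huy b a]; ring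
            _ ≤ R ^ (b - a) * (P x * (w x y ^ a * u y ^ (1 - a))) := by gcongr
            _ = ((4 * L) ^ (a - 1) * (4 * L) ^ (1 - a)) *
                (R ^ (b - a) * (P x * (w x y ^ a * u y ^ (1 - a)))) := by rw [h3, one_mul]
            _ = _ := by rw [h2]; ring
        rw [if_pos hlow]
        linarith
      · have h1 : (w x y / u y) ^ (b - b₂) ≤ R ^ (b - b₂) :=
          rpow_le_rpow_of_nonpos hR (by rw [le_div_iff₀ huy]; linarith) (by linarith)
        have : P x * (w x y ^ b * u y ^ (1 - b)) ≤
            R ^ (b - b₂) * (P x * (w x y ^ b₂ * u y ^ (1 - b₂))) := by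
          rw [rpow_mul_rpow_one_sub h0 huy b b₂]
          calc _ = (w x y / u y) ^ (b - b₂) * (P x * (w x y ^ b₂ * u y ^ (1 - b₂))) := by ring
            _ ≤ _ := by gcongr
        linarith
    · have h1 : (w x y / u y) ^ (b - b₁) ≤ (4 * κ * L) ^ (b - b₁) :=
        rpow_le_rpow (by positivity) (by rw [div_le_iff₀ huy]; linarith) (by linarith)
      have : P x * (w x y ^ b * u y ^ (1 - b)) ≤
          (4 * κ * L) ^ (b - b₁) * (P x * (w x y ^ b₁ * u y ^ (1 - b₁))) := by
        rw [rpow_mul_rpow_one_sub h0 huy b b₁]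
        calc _ = (w x y / u y) ^ (b - b₁) * (P x * (w x y ^ b₁ * u y ^ (1 - b₁))) := by ring
          _ ≤ _ := by gcongr
      linarith
  have hsum := Finset.sum_le_sum fun x (_ : x ∈ Finset.univ) =>
    Finset.sum_le_sum fun y (_ : y ∈ Finset.univ) => hpt x y
  simp only [Finset.sum_add_distrib, ← Finset.mul_sum] at hsum
  have e1 : (4 * κ * L) ^ (b - b₁) * ∑ x, ∑ y, P x * (w x y ^ b₁ * u y ^ (1 - b₁)) ≤
      (4 * κ * L) ^ (b - b₁) * (4 ^ (b₁ - 1) * exp (scaledInfo P w b₁)) := by gcongr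
  have e2 : R ^ (b - b₂) * ∑ x, ∑ y, P x * (w x y ^ b₂ * u y ^ (1 - b₂)) ≤
      R ^ (b - b₂) * (4 ^ (b₂ - 1) * exp (scaledInfo P w b₂)) := by gcongr
  simp only [← Finset.mul_sum] at e1 e2 hbm
  linarith

end Tail

/-! ### Choice of orders and the asymptotic tail bound -/

theorem eventually_mul_exp_le {x y : ℝ} (h : x < y) (c : ℝ) :
    ∀ᶠ n : ℕ in atTop, c * exp (n * x) ≤ exp (n * y) := by
  have : Tendsto (fun n : ℕ => exp ((n : ℝ) * (y - x))) atTop atTop :=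
    tendsto_exp_atTop.comp
      (tendsto_natCast_atTop_atTop.atTop_mul_const (by linarith : 0 < y - x))
  filter_upwards [this.eventually_ge_atTop c] with n hn
  calc c * exp (n * x) ≤ exp (n * (y - x)) * exp (n * x) := by gcongr
    _ = exp (n * y) := by rw [← exp_add]; ring_nf

/-- Near a constrained maximiser of `(b - 1) r - g b` one finds orders whose difference
quotients localise the tilted likelihood ratio. -/
theorem exists_orders_of_bound {g : ℝ → ℝ} (hg : ∀ b, 0 < b → DifferentiableAt ℝ g b)
    {a r₁ r₂ C ε : ℝ} (ha : 1 ≤ a) (hr : r₁ < r₂)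
    (hC : ∀ b, a ≤ b → (b - 1) * r₂ - g b ≤ C) (hε : 0 < ε) :
    ∃ b₁ b b₂ R δ : ℝ, 1 ≤ b₁ ∧ b₁ < b ∧ b < b₂ ∧ a ≤ b ∧ 0 < δ ∧
      (r₁ + δ) * (b - b₁) + g b₁ < g b ∧ g b₂ - R * (b₂ - b) < g b ∧
      R * (b - a) + r₁ * (a - 1) - g b < C + ε := by
  -- At a rate strictly below `r₂` the bound `hC` forces `h` to decrease at least linearly, so its
  -- maximum is attained; a rate strictly above `r₁` leaves room for `δ`.
  set r := (r₁ + r₂) / 2 with hrdef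
  set h : ℝ → ℝ := fun b => (b - 1) * r - g b with hh
  have hcont : ContinuousOn h (Set.Ici a) := fun b hb => by
    have hb' : a ≤ b := hb
    have := (hg b (by linarith)).continuousAt
    exact ContinuousAt.continuousWithinAt (by fun_prop)
  obtain ⟨c, hac, hmax⟩ : ∃ c, a ≤ c ∧ ∀ b, a ≤ b → h b ≤ h c := by
    set D := max a (1 + (C - h a) / (r₂ - r)) with hD
    have hr' : 0 < r₂ - r := by rw [hrdef]; linarith
    obtain ⟨c, hc, hcmax⟩ := isCompact_Icc.exists_isMaxOn
      (Set.nonempty_Icc.mpr (le_max_left a (1 + (C - h a) / (r₂ - r))))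
      (hcont.mono Set.Icc_subset_Ici_self)
    refine ⟨c, hc.1, fun b hb => ?_⟩
    by_cases hbD : b ≤ D
    · exact hcmax ⟨hb, hbD⟩
    · have h1 : h a ≤ h c := hcmax ⟨le_rfl, le_max_left _ _⟩
      have h2 := hC b hb
      have h3 : 1 + (C - h a) / (r₂ - r) < b :=
        lt_of_le_of_lt (le_max_right _ _) (not_le.mp hbD)
      have h4 : C - h a < (b - 1) * (r₂ - r) := by
        rw [← div_lt_iff₀ hr']; linarith
      have h5 : h b = (b - 1) * r₂ - g b - (b - 1) * (r₂ - r) := by simp only [hh]; ring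
      linarith
  have hc0 : 0 < c := by linarith
  obtain ⟨ρ, hρ⟩ : ∃ ρ, HasDerivAt g ρ c := ⟨_, (hg c hc0).hasDerivAt⟩
  have hslope : Tendsto (fun s => s⁻¹ * (g (c + s) - g c)) (𝓝[>] 0) (𝓝 ρ) := by
    have := hρ.tendsto_slope_zero_right
    simpa using this
  have hρr : r ≤ ρ := by
    refine ge_of_tendsto hslope ?_
    filter_upwards [self_mem_nhdsWithin] with s hs
    have hs : 0 < s := hs
    have := hmax (c + s) (by linarith)
    simp only [hh] at this
    rw [inv_mul_eq_div, le_div_iff₀ hs]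
    linarith
  -- Complementary slackness: an interior maximiser is stationary, otherwise it is the endpoint `a`.
  -- Either way `(ρ - r) * (c - a) = 0`, so the limit below is at most `C`.
  have hρ' : c = a ∨ ρ = r := by
    rcases hac.eq_or_lt with h1 | h1
    · exact Or.inl h1.symm
    · right
      have hd : HasDerivAt h (1 * r - ρ) c := (((hasDerivAt_id c).sub_const 1).mul_const r).sub hρ
      have hloc : IsLocalMax h c := by
        filter_upwards [lt_mem_nhds h1] with b hb using hmax b hb.le
      linarith [hloc.hasDerivAt_eq_zero hd]
  have hslope2 : Tendsto (fun s => s⁻¹ * (g (c + 2 * s) - g (c + s))) (𝓝[>] 0) (𝓝 ρ) := by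
    have h2 : Tendsto (fun s : ℝ => 2 * s) (𝓝[>] 0) (𝓝[>] 0) := by
      refine tendsto_nhdsWithin_of_tendsto_nhds_of_eventually_within _ ?_ ?_
      · have : Continuous fun s : ℝ => 2 * s := by fun_prop
        simpa using (this.tendsto 0).mono_left nhdsWithin_le_nhds
      · filter_upwards [self_mem_nhdsWithin] with s hs
        have hs : 0 < s := hs
        exact (by positivity : 0 < 2 * s)
    have h3 := ((hslope.comp h2).const_mul 2).sub hslope
    have e : 2 * ρ - ρ = ρ := by ring
    rw [e] at h3
    refine h3.congr' ?_
    filter_upwards [self_mem_nhdsWithin] with s hs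
    have hs : s ≠ 0 := (show 0 < s from hs).ne'
    simp only [Function.comp]
    field_simp
    ring
  have hid : Tendsto (fun s : ℝ => s) (𝓝[>] 0) (𝓝 0) := tendsto_nhdsWithin_of_tendsto_nhds tendsto_id
  have hgc : Tendsto (fun s : ℝ => g (c + s)) (𝓝[>] 0) (𝓝 (g c)) := by
    have h1 : Tendsto (fun s : ℝ => c + s) (𝓝[>] 0) (𝓝 c) := by simpa using hid.const_add c
    exact hρ.continuousAt.tendsto.comp h1
  have hlim : Tendsto (fun s => (s⁻¹ * (g (c + 2 * s) - g (c + s)) + s) * (c + s - a) +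
      r₁ * (a - 1) - g (c + s)) (𝓝[>] 0) (𝓝 ((ρ + 0) * (c + 0 - a) + r₁ * (a - 1) - g c)) :=
    (((hslope2.add hid).mul ((hid.const_add c).sub_const a)).add_const _).sub hgc
  have hfin : (ρ + 0) * (c + 0 - a) + r₁ * (a - 1) - g c < C + ε := by
    have h1 := hC c hac
    have h2 : (ρ - r) * (c - a) = 0 := by
      rcases hρ' with h | h
      · rw [h]; ring
      · rw [h]; ring
    have h3 : r ≤ r₂ := by rw [hrdef]; linarith
    have h4 : r₁ ≤ r := by rw [hrdef]; linarith
    nlinarith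
  have hδ : r₁ + (r₂ - r₁) / 4 < ρ := by
    have : r₁ + (r₂ - r₁) / 4 < r := by rw [hrdef]; linarith
    linarith
  obtain ⟨s, ⟨hs1, hs2⟩, hs0⟩ := (((hslope.eventually_const_lt hδ).and
    (hlim.eventually_lt_const hfin)).and self_mem_nhdsWithin).exists
  have hs0 : 0 < s := hs0
  -- Three equally spaced orders starting at the maximiser, so the constraint `a ≤ b` is kept. The
  -- extra `s` in `R` makes the second slope inequality strict.
  refine ⟨c, c + s, c + 2 * s, s⁻¹ * (g (c + 2 * s) - g (c + s)) + s, (r₂ - r₁) / 4, by linarith,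
    by linarith, by linarith, by linarith, by linarith, ?_, ?_, hs2⟩
  · rw [inv_mul_eq_div, lt_div_iff₀ hs0] at hs1
    linarith
  · have e : (s⁻¹ * (g (c + 2 * s) - g (c + s)) + s) * (c + 2 * s - (c + s)) =
      g (c + 2 * s) - g (c + s) + s ^ 2 := by
      field_simp
      ring
    rw [e]
    have : 0 < s ^ 2 := by positivity
    linarith

/-- Asymptotic lower bound on the tail of the likelihood ratio between `n` uses of a channel and
an arbitrary output distribution. -/
theorem eventually_exp_le_sum_tail {X Y : Type*} [Fintype X] [Fintype Y] {P : X → ℝ}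
    {w : X → Y → ℝ} (hP : P ∈ stdSimplex ℝ X) (hw : ∀ x, w x ∈ stdSimplex ℝ Y)
    {a r₁ r₂ C ε : ℝ} (ha : 1 ≤ a) (hr : r₁ < r₂)
    (hC : ∀ b, a ≤ b → (b - 1) * r₂ - scaledInfo P w b ≤ C) (hε : 0 < ε) :
    ∃ δ > 0, ∀ᶠ n : ℕ in atTop, ∀ Q ∈ stdSimplex ℝ (Fin n → Y), ∃ B : (Fin n → Y) → ℝ,
      (∀ y, 0 < B y) ∧ (∀ y, exp (n * r₁) * Q y ≤ B y) ∧
      exp (n * -(C + ε)) ≤ ∑ x, ∑ y, if exp (n * δ) * B y < prodMat w n x y then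
        prodVec P n x * (prodMat w n x y ^ a * B y ^ (1 - a)) else 0 := by
  obtain ⟨b₁, b, b₂, R, δ, hb₁, hb₁b, hbb₂, hab, hδ, h1, h2, h3⟩ := exists_orders_of_bound
    (fun b hb => differentiableAt_scaledInfo hP hw hb) ha hr hC hε
  refine ⟨δ, hδ, ?_⟩
  -- The leading factors `4` make each error term at most a quarter of the main term, so half of the
  -- latter survives; the third bound absorbs that `2` and the prefactor `4 ^ (a - 1)`.
  filter_upwards [eventually_mul_exp_le h1 (4 * (4 ^ (b - b₁) * 4 ^ (b₁ - 1))),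
    eventually_mul_exp_le h2 (4 * 4 ^ (b₂ - 1)),
    eventually_mul_exp_le (neg_lt_neg h3) (2 * 4 ^ (a - 1))] with n h1 h2 h3 Q hQ
  obtain ⟨B, hB, hQB, hle⟩ := exists_le_sum_tail (prodVec_mem hP n) (prodMat_mem hw n) hab hb₁
    hb₁b hbb₂ (exp_pos (n * r₁)) (exp_pos (n * δ)) (exp_pos (n * R)) hQ
  refine ⟨B, hB, hQB, ?_⟩
  simp only [scaledInfo_prod hP hw] at hle
  have e1 : (4 * exp (n * δ) * exp (n * r₁)) ^ (b - b₁) *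
      (4 ^ (b₁ - 1) * exp (n * scaledInfo P w b₁)) = 4 ^ (b - b₁) * 4 ^ (b₁ - 1) *
        exp (n * ((r₁ + δ) * (b - b₁) + scaledInfo P w b₁)) := by
    rw [mul_assoc, ← exp_add, mul_rpow (by positivity) (by positivity), ← exp_mul,
      show (n : ℝ) * ((r₁ + δ) * (b - b₁) + scaledInfo P w b₁) =
        (n * δ + n * r₁) * (b - b₁) + n * scaledInfo P w b₁ by ring, exp_add]
    ring
  have e2 : exp (n * R) ^ (b - b₂) * (4 ^ (b₂ - 1) * exp (n * scaledInfo P w b₂)) =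
      4 ^ (b₂ - 1) * exp (n * (scaledInfo P w b₂ - R * (b₂ - b))) := by
    rw [← exp_mul, show (n : ℝ) * (scaledInfo P w b₂ - R * (b₂ - b)) =
      n * R * (b - b₂) + n * scaledInfo P w b₂ by ring, exp_add]
    ring
  rw [e1, e2] at hle
  set T := ∑ x, ∑ y, if exp (n * δ) * B y < prodMat w n x y then
        prodVec P n x * (prodMat w n x y ^ a * B y ^ (1 - a)) else 0 with hT
  have e3 : (4 * exp (n * r₁)) ^ (a - 1) * exp (n * R) ^ (b - a) =
      4 ^ (a - 1) * exp (n * (R * (b - a) + r₁ * (a - 1))) := by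
    rw [mul_rpow (by positivity) (by positivity), ← exp_mul, ← exp_mul, mul_assoc, ← exp_add]
    ring_nf
  rw [e3] at hle
  have h4 : exp (n * scaledInfo P w b) ≤
      2 * 4 ^ (a - 1) * exp (n * (R * (b - a) + r₁ * (a - 1))) * T := by linarith
  have h5 : 0 < 2 * (4 : ℝ) ^ (a - 1) * exp (n * (R * (b - a) + r₁ * (a - 1))) := by positivity
  have h6 : (2 * (4 : ℝ) ^ (a - 1) * exp (n * (R * (b - a) + r₁ * (a - 1)))) *
      exp (n * -(C + ε)) ≤ exp (n * scaledInfo P w b) := by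
    calc _ = 2 * (4 : ℝ) ^ (a - 1) * exp (n * -(C + ε)) *
          exp (n * (R * (b - a) + r₁ * (a - 1))) := by ring
      _ ≤ exp (n * -(R * (b - a) + r₁ * (a - 1) - scaledInfo P w b)) *
          exp (n * (R * (b - a) + r₁ * (a - 1))) := by gcongr
      _ = _ := by rw [← exp_add]; ring_nf
  exact le_of_mul_le_mul_left (h6.trans h4) h5

/-! ### Distributions as real vectors -/

section Vectors

variable {ι : Type*}

/-- The probability vector of a distribution. -/
def toVec (μ : PMF ι) (i : ι) : ℝ := (μ i).toReal

theorem sum_coe_eq_one [Fintype ι] (μ : PMF ι) : ∑ i, μ i = 1 := by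
  simpa [tsum_fintype] using μ.tsum_coe

theorem toVec_mem [Fintype ι] (μ : PMF ι) : toVec μ ∈ stdSimplex ℝ ι := by
  refine ⟨fun i => ENNReal.toReal_nonneg, ?_⟩
  simp only [toVec]
  rw [← ENNReal.toReal_sum fun i _ => μ.apply_ne_top i, sum_coe_eq_one, ENNReal.toReal_one]

/-- The distribution with a given probability vector. -/
def ofVec [Fintype ι] (p : ι → ℝ) (hp : p ∈ stdSimplex ℝ ι) : PMF ι :=
  PMF.ofFintype (fun i => ENNReal.ofReal (p i)) (by
    rw [← ENNReal.ofReal_sum_of_nonneg fun i _ => hp.1 i, hp.2, ENNReal.ofReal_one])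

theorem ofVec_apply [Fintype ι] (p : ι → ℝ) (hp : p ∈ stdSimplex ℝ ι) (i : ι) :
    ofVec p hp i = ENNReal.ofReal (p i) := rfl

theorem toVec_ofVec [Fintype ι] (p : ι → ℝ) (hp : p ∈ stdSimplex ℝ ι) : toVec (ofVec p hp) = p := by
  ext i
  rw [toVec, ofVec_apply, ENNReal.toReal_ofReal (hp.1 i)]

variable {X Y : Type*}

/-- The transition matrix of a channel. -/
def toMat (W : Channel X Y) (x : X) : Y → ℝ := toVec (W x)

theorem toMat_mem [Fintype Y] (W : Channel X Y) (x : X) : toMat W x ∈ stdSimplex ℝ Y := toVec_mem _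

theorem toMat_power [Fintype Y] (W : Channel X Y) (n : ℕ) : toMat (power W n) = prodMat (toMat W) n := by
  ext x y
  simp [toMat, toVec, power, prodMat, PMF.ofFintype_apply, ENNReal.toReal_prod]

theorem sum_joint [Fintype X] [Fintype Y] (P : PMF X) (W : Channel X Y) : ∑ z, joint P W z = 1 := by
  rw [Fintype.sum_prod_type]
  simp only [joint, ← Finset.mul_sum, sum_coe_eq_one, mul_one]

theorem joint_ne_top (P : PMF X) (W : Channel X Y) (z : X × Y) : joint P W z ≠ ∞ :=
  ENNReal.mul_ne_top (P.apply_ne_top _) ((W _).apply_ne_top _)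

theorem toReal_joint (P : PMF X) (W : Channel X Y) (x : X) (y : Y) :
    (joint P W (x, y)).toReal = toVec P x * toMat W x y := ENNReal.toReal_mul

theorem prodDist_eq_joint (P : PMF X) (Q : PMF Y) : prodDist P Q = joint P fun _ => Q := rfl

end Vectors

/-! ### Base-two logarithms and divergences -/

theorem log2_le_coe {x : ℝ≥0∞} {c : ℝ} :
    log2 x ≤ (c : EReal) ↔ x ≤ ENNReal.ofReal (exp (c * log 2)) := by
  have h2 : (0 : EReal) < ((log 2 : ℝ) : EReal) := by exact_mod_cast log_pos one_lt_two
  rw [log2, EReal.div_le_iff_le_mul h2 (EReal.coe_ne_top _), ← EReal.coe_mul, mul_comm,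
    ← ENNReal.log_le_log_iff, ENNReal.log_ofReal_of_pos (exp_pos _), log_exp]

theorem coe_le_log2 {x : ℝ≥0∞} {c : ℝ} :
    (c : EReal) ≤ log2 x ↔ ENNReal.ofReal (exp (c * log 2)) ≤ x := by
  have h2 : (0 : EReal) < ((log 2 : ℝ) : EReal) := by exact_mod_cast log_pos one_lt_two
  rw [log2, EReal.le_div_iff_mul_le h2 (EReal.coe_ne_top _), ← EReal.coe_mul,
    ← ENNReal.log_le_log_iff, ENNReal.log_ofReal_of_pos (exp_pos _), log_exp]

section Renyi

variable {ι : Type*} [Fintype ι] {α : ℝ≥0∞} {p q : ι → ℝ≥0∞}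

theorem coe_le_renyiDiv {d : ℝ} :
    (d : EReal) ≤ renyiDiv α p q ↔ fidelity α p q ≤ ENNReal.ofReal (exp (-d * log 2)) := by
  rw [renyiDiv, EReal.le_neg, ← EReal.coe_neg, log2_le_coe]

theorem renyiDiv_le_coe {d : ℝ} :
    renyiDiv α p q ≤ (d : EReal) ↔ ENNReal.ofReal (exp (-d * log 2)) ≤ fidelity α p q := by
  rw [renyiDiv, EReal.neg_le, ← EReal.coe_neg, coe_le_log2]

theorem renyiDiv_eq_top (h : fidelity α p q = 0) : renyiDiv α p q = ⊤ := by
  have h2 : (0 : EReal) < ((log 2 : ℝ) : EReal) := by exact_mod_cast log_pos one_lt_two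
  rw [renyiDiv, h, log2, ENNReal.log_zero, EReal.bot_div_of_pos_ne_top h2 (EReal.coe_ne_top _),
    EReal.neg_bot]

/-- The sum `∑ p ^ a q ^ (1 - a)` over real vectors. -/
def affinity (a : ℝ) (p q : ι → ℝ≥0∞) : ℝ := ∑ i, (p i).toReal ^ a * (q i).toReal ^ (1 - a)

theorem fidelity_eq_rpow (h0 : α ≠ 0) (h1 : α ≠ 1) (hT : α ≠ ∞) :
    fidelity α p q =
      (∑ i, p i ^ α.toReal * q i ^ (1 - α.toReal)) ^ (1 / (1 - α.toReal)) := by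
  rw [fidelity, if_neg h0, if_neg h1, if_neg hT]

/-- For `a > 1` the two sides treat `q i = 0 < p i` differently: the extended term is `∞`, whereas
the real power `0 ^ (1 - a)` defaults to `0`. Hence the support condition. -/
theorem sum_rpow_eq_ofReal_affinity {a : ℝ} (ha : 0 < a) (hp : ∀ i, p i ≠ ∞) (hq : ∀ i, q i ≠ ∞)
    (hpq : 1 < a → ∀ i, p i ≠ 0 → q i ≠ 0) :
    ∑ i, p i ^ a * q i ^ (1 - a) = ENNReal.ofReal (affinity a p q) := by
  rw [affinity, ENNReal.ofReal_sum_of_nonneg fun i _ =>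
    mul_nonneg (rpow_nonneg ENNReal.toReal_nonneg _) (rpow_nonneg ENNReal.toReal_nonneg _)]
  refine Finset.sum_congr rfl fun i _ => ?_
  by_cases hi : p i = 0
  · simp [hi, ENNReal.zero_rpow_of_pos ha, zero_rpow ha.ne']
  rw [ENNReal.ofReal_mul (rpow_nonneg ENNReal.toReal_nonneg _), ENNReal.toReal_rpow,
    ENNReal.toReal_rpow, ENNReal.ofReal_toReal, ENNReal.ofReal_toReal]
  · rcases le_or_gt a 1 with h | h
    · exact ENNReal.rpow_ne_top_of_nonneg (by linarith) (hq i)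
    · exact ENNReal.rpow_ne_top_of_ne_zero (hpq h i hi) (hq i)
  · exact ENNReal.rpow_ne_top_of_nonneg ha.le (hp i)

theorem ennreal_rpow_le_rpow_of_nonpos {s : ℝ} (hs : s ≤ 0) {u v : ℝ≥0∞} (h : u ≤ v) :
    v ^ s ≤ u ^ s := by
  rw [← neg_neg s, ENNReal.rpow_neg v, ENNReal.rpow_neg u]
  exact ENNReal.inv_le_inv.mpr (ENNReal.rpow_le_rpow h (neg_nonneg.mpr hs))

theorem ofReal_exp_rpow (c s : ℝ) :
    ENNReal.ofReal (exp c) ^ s = ENNReal.ofReal (exp (c * s)) := by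
  rw [ENNReal.ofReal_rpow_of_pos (exp_pos _), exp_mul]

theorem toReal_lt_one_of_lt_one {α : ℝ≥0∞} (h : α < 1) : α.toReal < 1 := by
  simpa using (ENNReal.toReal_lt_toReal h.ne_top ENNReal.one_ne_top).mpr h

theorem one_lt_toReal_of_one_lt {α : ℝ≥0∞} (h : 1 < α) (hT : α ≠ ∞) : 1 < α.toReal := by
  simpa using (ENNReal.toReal_lt_toReal ENNReal.one_ne_top hT).mpr h

theorem le_renyiDiv_of_lt_one (h0 : 0 < α) (h1 : α < 1) (hp : ∀ i, p i ≠ ∞) (hq : ∀ i, q i ≠ ∞)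
    {d : ℝ} (h : affinity α.toReal p q ≤ exp (-d * log 2 * (1 - α.toReal))) :
    (d : EReal) ≤ renyiDiv α p q := by
  have ha1 := toReal_lt_one_of_lt_one h1
  have ha0 : 0 < α.toReal := ENNReal.toReal_pos h0.ne' h1.ne_top
  rw [coe_le_renyiDiv, fidelity_eq_rpow h0.ne' h1.ne h1.ne_top,
    sum_rpow_eq_ofReal_affinity ha0 hp hq fun h => absurd h (by linarith)]
  refine (ENNReal.rpow_le_rpow (ENNReal.ofReal_le_ofReal h) (by
    rw [one_div, inv_nonneg]; linarith)).trans (le_of_eq ?_)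
  rw [ofReal_exp_rpow]
  congr 2
  have : 1 - α.toReal ≠ 0 := by linarith
  field_simp

theorem renyiDiv_le_of_lt_one (h0 : 0 < α) (h1 : α < 1) (hp : ∀ i, p i ≠ ∞) (hq : ∀ i, q i ≠ ∞)
    {d : ℝ} (h : exp (-d * log 2 * (1 - α.toReal)) ≤ affinity α.toReal p q) :
    renyiDiv α p q ≤ (d : EReal) := by
  have ha1 := toReal_lt_one_of_lt_one h1
  have ha0 : 0 < α.toReal := ENNReal.toReal_pos h0.ne' h1.ne_top
  rw [renyiDiv_le_coe, fidelity_eq_rpow h0.ne' h1.ne h1.ne_top,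
    sum_rpow_eq_ofReal_affinity ha0 hp hq fun h => absurd h (by linarith)]
  refine (le_of_eq ?_).trans (ENNReal.rpow_le_rpow (ENNReal.ofReal_le_ofReal h) (by
    rw [one_div, inv_nonneg]; linarith))
  rw [ofReal_exp_rpow]
  congr 2
  have : 1 - α.toReal ≠ 0 := by linarith
  field_simp

theorem fidelity_eq_zero_of_one_le (h1 : 1 ≤ α) (hT : α ≠ ∞) (hp : ∀ i, p i ≠ ∞) {i : ι}
    (hi : p i ≠ 0) (hqi : q i = 0) : fidelity α p q = 0 := by
  rcases h1.eq_or_lt with rfl | h1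
  · rw [fidelity, if_neg one_ne_zero, if_pos rfl]
    refine Finset.prod_eq_zero (Finset.mem_univ i) ?_
    rw [hqi, ENNReal.zero_div, ENNReal.zero_rpow_of_pos (ENNReal.toReal_pos hi (hp i))]
  · have ha := one_lt_toReal_of_one_lt h1 hT
    rw [fidelity_eq_rpow (by positivity) h1.ne' hT]
    have : ∑ i, p i ^ α.toReal * q i ^ (1 - α.toReal) = ∞ := by
      rw [ENNReal.sum_eq_top]
      refine ⟨i, Finset.mem_univ _, ?_⟩
      rw [hqi, ENNReal.zero_rpow_of_neg (by linarith), ENNReal.mul_top]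
      exact (ENNReal.rpow_pos (pos_iff_ne_zero.mpr hi) (hp i)).ne'
    rw [this, ENNReal.top_rpow_of_neg]
    rw [one_div, inv_lt_zero]; linarith

/-- Absolute continuity may be assumed when proving the affinity bound, because the divergence is
infinite without it. -/
theorem le_renyiDiv_of_one_lt (h1 : 1 < α) (hT : α ≠ ∞) (hp : ∀ i, p i ≠ ∞) (hq : ∀ i, q i ≠ ∞)
    {d : ℝ} (h : (∀ i, p i ≠ 0 → q i ≠ 0) →
      exp (d * log 2 * (α.toReal - 1)) ≤ affinity α.toReal p q) :
    (d : EReal) ≤ renyiDiv α p q := by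
  by_cases hpq : ∀ i, p i ≠ 0 → q i ≠ 0
  · have ha := one_lt_toReal_of_one_lt h1 hT
    rw [coe_le_renyiDiv, fidelity_eq_rpow (by positivity) h1.ne' hT,
      sum_rpow_eq_ofReal_affinity (by linarith) hp hq fun _ => hpq]
    refine (ennreal_rpow_le_rpow_of_nonpos (by
      rw [one_div, inv_nonpos]; linarith) (ENNReal.ofReal_le_ofReal (h hpq))).trans (le_of_eq ?_)
    rw [ofReal_exp_rpow]
    congr 2
    have : 1 - α.toReal ≠ 0 := by linarith
    field_simp
    ring
  · push Not at hpq
    obtain ⟨i, hi, hqi⟩ := hpq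
    rw [renyiDiv_eq_top (fidelity_eq_zero_of_one_le h1.le hT hp hi hqi)]
    exact le_top

theorem renyiDiv_le_of_one_lt (h1 : 1 < α) (hT : α ≠ ∞) (hp : ∀ i, p i ≠ ∞) (hq : ∀ i, q i ≠ ∞)
    (hpq : ∀ i, p i ≠ 0 → q i ≠ 0) {d : ℝ}
    (h : affinity α.toReal p q ≤ exp (d * log 2 * (α.toReal - 1))) :
    renyiDiv α p q ≤ (d : EReal) := by
  have ha := one_lt_toReal_of_one_lt h1 hT
  rw [renyiDiv_le_coe, fidelity_eq_rpow (by positivity) h1.ne' hT,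
    sum_rpow_eq_ofReal_affinity (by linarith) hp hq fun _ => hpq]
  refine (le_of_eq ?_).trans (ennreal_rpow_le_rpow_of_nonpos (by
    rw [one_div, inv_nonpos]; linarith) (ENNReal.ofReal_le_ofReal h))
  rw [ofReal_exp_rpow]
  congr 2
  have : 1 - α.toReal ≠ 0 := by linarith
  field_simp
  ring

/-! ### Monotonicity in the order around order one -/

/-- Relative entropy in nats. -/
def klNats (p q : ι → ℝ≥0∞) : ℝ := ∑ i, (p i).toReal * log ((p i).toReal / (q i).toReal)

theorem sum_toReal_eq_one (hp1 : ∑ i, p i = 1) : ∑ i, (p i).toReal = 1 := by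
  have hp : ∀ i, p i ≠ ∞ := fun i =>
    ENNReal.sum_ne_top.mp (by rw [hp1]; exact ENNReal.one_ne_top) i (Finset.mem_univ i)
  rw [← ENNReal.toReal_sum fun i _ => hp i, hp1, ENNReal.toReal_one]

/-- Jensen for `exp` with weights `p`, applied to `(a - 1) * log (p / q)`. The sign of `a - 1` is
free, so one inequality compares order one with orders on both sides. -/
theorem exp_mul_klNats_le (hp1 : ∑ i, p i = 1) (hp : ∀ i, p i ≠ ∞) (hq : ∀ i, q i ≠ ∞)
    (hpq : ∀ i, p i ≠ 0 → q i ≠ 0) {a : ℝ} (ha : 0 < a) :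
    exp ((a - 1) * klNats p q) ≤ affinity a p q := by
  have h := convexOn_exp.map_sum_le (t := Finset.univ) (w := fun i => (p i).toReal)
    (p := fun i => (a - 1) * log ((p i).toReal / (q i).toReal))
    (fun i _ => ENNReal.toReal_nonneg) (sum_toReal_eq_one hp1) fun i _ => Set.mem_univ _
  simp only [smul_eq_mul] at h
  refine (le_of_eq ?_).trans (h.trans (le_of_eq ?_))
  · rw [klNats, Finset.mul_sum]
    congr 1
    exact Finset.sum_congr rfl fun i _ => by ring
  · refine Finset.sum_congr rfl fun i _ => ?_
    by_cases hi : p i = 0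
    · simp [hi, zero_rpow ha.ne']
    · have h1 : 0 < (p i).toReal := ENNReal.toReal_pos hi (hp i)
      have h2 : 0 < (q i).toReal := ENNReal.toReal_pos (hpq i hi) (hq i)
      rw [mul_comm (a - 1), ← rpow_def_of_pos (by positivity), rpow_mul_rpow_one_sub h1 h2 a 1]
      simp [mul_comm]

theorem fidelity_one (hp : ∀ i, p i ≠ ∞) (hq : ∀ i, q i ≠ ∞)
    (hpq : ∀ i, p i ≠ 0 → q i ≠ 0) :
    fidelity 1 p q = ENNReal.ofReal (exp (-klNats p q)) := by
  rw [fidelity, if_neg one_ne_zero, if_pos rfl, klNats, ← Finset.sum_neg_distrib, exp_sum,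
    ENNReal.ofReal_prod_of_nonneg fun i _ => (exp_pos _).le]
  refine Finset.prod_congr rfl fun i _ => ?_
  by_cases hi : p i = 0
  · simp [hi]
  · have h1 : 0 < (p i).toReal := ENNReal.toReal_pos hi (hp i)
    have h2 : 0 < (q i).toReal := ENNReal.toReal_pos (hpq i hi) (hq i)
    have h3 : q i / p i = ENNReal.ofReal ((q i).toReal / (p i).toReal) := by
      rw [ENNReal.ofReal_div_of_pos h1, ENNReal.ofReal_toReal (hp i), ENNReal.ofReal_toReal (hq i)]
    rw [h3, ENNReal.ofReal_rpow_of_pos (by positivity), rpow_def_of_pos (by positivity)]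
    congr 2
    rw [log_div h1.ne' h2.ne', log_div h2.ne' h1.ne']
    ring

theorem renyiDiv_one (hp : ∀ i, p i ≠ ∞) (hq : ∀ i, q i ≠ ∞)
    (hpq : ∀ i, p i ≠ 0 → q i ≠ 0) :
    renyiDiv 1 p q = ((klNats p q / log 2 : ℝ) : EReal) := by
  have h2 : log 2 ≠ 0 := (log_pos one_lt_two).ne'
  refine le_antisymm ?_ ?_
  · rw [renyiDiv_le_coe, fidelity_one hp hq hpq]
    refine ENNReal.ofReal_le_ofReal (exp_le_exp.mpr (le_of_eq ?_))
    field_simp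
  · rw [coe_le_renyiDiv, fidelity_one hp hq hpq]
    refine ENNReal.ofReal_le_ofReal (exp_le_exp.mpr (le_of_eq ?_))
    field_simp

theorem renyiDiv_le_renyiDiv_one (hp1 : ∑ i, p i = 1) (hp : ∀ i, p i ≠ ∞) (hq : ∀ i, q i ≠ ∞)
    (h0 : 0 < α) (h1 : α ≤ 1) : renyiDiv α p q ≤ renyiDiv 1 p q := by
  rcases h1.eq_or_lt with rfl | h1
  · exact le_rfl
  by_cases hpq : ∀ i, p i ≠ 0 → q i ≠ 0
  · rw [renyiDiv_one hp hq hpq]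
    refine renyiDiv_le_of_lt_one h0 h1 hp hq ?_
    refine (le_of_eq ?_).trans (exp_mul_klNats_le hp1 hp hq hpq (ENNReal.toReal_pos h0.ne' h1.ne_top))
    have h2 : log 2 ≠ 0 := (log_pos one_lt_two).ne'
    congr 1
    field_simp
    ring
  · push Not at hpq
    obtain ⟨i, hi, hqi⟩ := hpq
    rw [renyiDiv_eq_top (α := 1)
      (fidelity_eq_zero_of_one_le le_rfl ENNReal.one_ne_top hp hi hqi)]
    exact le_top

theorem renyiDiv_one_le_renyiDiv (hp1 : ∑ i, p i = 1) (hp : ∀ i, p i ≠ ∞) (hq : ∀ i, q i ≠ ∞)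
    (h1 : 1 < α) (hT : α ≠ ∞) : renyiDiv 1 p q ≤ renyiDiv α p q := by
  by_cases hpq : ∀ i, p i ≠ 0 → q i ≠ 0
  · rw [renyiDiv_one hp hq hpq]
    refine le_renyiDiv_of_one_lt h1 hT hp hq fun _ => ?_
    refine (le_of_eq ?_).trans (exp_mul_klNats_le hp1 hp hq hpq
      (by linarith [one_lt_toReal_of_one_lt h1 hT]))
    have h2 : log 2 ≠ 0 := (log_pos one_lt_two).ne'
    congr 1
    field_simp
  · push Not at hpq
    obtain ⟨i, hi, hqi⟩ := hpq
    rw [renyiDiv_eq_top (α := α) (fidelity_eq_zero_of_one_le h1.le hT hp hi hqi)]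
    exact le_top

/-- If `q` dominates `c p` pointwise then every fidelity is at least `c`. -/
theorem le_fidelity_of_mul_le (hp1 : ∑ i, p i = 1) {c : ℝ≥0∞} (hc0 : c ≠ 0) (hcT : c ≠ ∞)
    (h : ∀ i, c * p i ≤ q i) : c ≤ fidelity α p q := by
  have hp : ∀ i, p i ≠ ∞ := fun i =>
    ENNReal.sum_ne_top.mp (by rw [hp1]; exact ENNReal.one_ne_top) i (Finset.mem_univ i)
  have hdiv : ∀ i, p i ≠ 0 → c ≤ q i / p i := fun i hi => by
    rw [ENNReal.le_div_iff_mul_le (Or.inl hi) (Or.inl (hp i))]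
    exact h i
  -- For `q = c p` the fidelity of a finite order other than zero and one is exactly `c`; those
  -- orders follow by comparing termwise with this case.
  have hsum : ∀ s : ℝ, ∀ i, p i ≠ 0 → p i ^ s * (c * p i) ^ (1 - s) = c ^ (1 - s) * p i := by
    intro s i hi
    rw [ENNReal.mul_rpow_of_ne_top hcT (hp i), mul_left_comm, ← ENNReal.rpow_add _ _ hi (hp i)]
    simp
  have hc : ∀ s : ℝ, s ≠ 1 → (c ^ (1 - s)) ^ (1 / (1 - s)) = c := by
    intro s hs
    rw [← ENNReal.rpow_mul, mul_one_div_cancel (sub_ne_zero.mpr hs.symm), ENNReal.rpow_one]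
  by_cases h0 : α = 0
  · rw [fidelity, if_pos h0]
    calc c = ∑ i, c * p i := by rw [← Finset.mul_sum, hp1, mul_one]
      _ ≤ _ := Finset.sum_le_sum fun i _ => ?_
    by_cases hi : p i = 0
    · simp [hi]
    · rw [Set.indicator_of_mem (by simpa using hi)]
      exact h i
  by_cases h1 : α = 1
  · rw [fidelity, if_neg h0, if_pos h1]
    have hprod : ∀ s : Finset ι, ∏ i ∈ s, c ^ (p i).toReal = c ^ (∑ i ∈ s, (p i).toReal) := by
      intro s
      induction s using Finset.cons_induction with
      | empty => simp
      | cons i s hi ih =>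
        rw [Finset.prod_cons, Finset.sum_cons, ih, ENNReal.rpow_add _ _ hc0 hcT]
    calc c = ∏ i, c ^ (p i).toReal := by rw [hprod, sum_toReal_eq_one hp1, ENNReal.rpow_one]
      _ ≤ _ := Finset.prod_le_prod' fun i _ => ?_
    by_cases hi : p i = 0
    · simp [hi]
    · exact ENNReal.rpow_le_rpow (hdiv i hi) ENNReal.toReal_nonneg
  by_cases hT : α = ∞
  · rw [fidelity, if_neg h0, if_neg h1, if_pos hT]
    exact le_iInf₂ fun i hi => hdiv i hi
  rw [fidelity_eq_rpow h0 h1 hT]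
  have ha0 : 0 < α.toReal := ENNReal.toReal_pos h0 hT
  rcases lt_or_gt_of_ne h1 with h1 | h1
  · have ha1 := toReal_lt_one_of_lt_one h1
    rw [← hc α.toReal ha1.ne]
    refine ENNReal.rpow_le_rpow ?_ (by rw [one_div, inv_nonneg]; linarith)
    calc c ^ (1 - α.toReal) = ∑ i, c ^ (1 - α.toReal) * p i := by
          rw [← Finset.mul_sum, hp1, mul_one]
      _ ≤ _ := Finset.sum_le_sum fun i _ => ?_
    by_cases hi : p i = 0
    · simp [hi]
    · rw [← hsum _ i hi]
      gcongr
      exact h i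
  · have ha1 := one_lt_toReal_of_one_lt h1 hT
    rw [← hc α.toReal ha1.ne']
    refine ennreal_rpow_le_rpow_of_nonpos (by rw [one_div, inv_nonpos]; linarith) ?_
    calc _ ≤ ∑ i, c ^ (1 - α.toReal) * p i := Finset.sum_le_sum fun i _ => ?_
      _ = c ^ (1 - α.toReal) := by rw [← Finset.mul_sum, hp1, mul_one]
    by_cases hi : p i = 0
    · simp [hi, ENNReal.zero_rpow_of_pos ha0]
    · rw [← hsum _ i hi]
      refine mul_le_mul_right ?_ _
      exact ennreal_rpow_le_rpow_of_nonpos (by linarith) (h i)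

end Renyi

/-! ### Simulations -/

section Simulation

variable {X Y : Type*}

/-- `N` is realised by shared randomness and one of `M` messages; transition matrices are read as
real matrices. -/
def IsSimulationOfSize (N : Channel X Y) (M : ℕ) : Prop :=
  ∃ (K : Type) (_ : Fintype K) (PK : PMF K)
    (E : Channel (X × K) (Fin M)) (D : Channel (Fin M × K) Y),
    ∀ x y, toMat N x y = ∑ k, toVec PK k * ∑ j, toVec (E (x, k)) j * toVec (D (j, k)) y

theorem toReal_sum_sum_mul {K : Type*} [Fintype K] {M : ℕ} (PK : PMF K) (E : K → PMF (Fin M))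
    (D : Fin M → K → PMF Y) (y : Y) :
    (∑ k, ∑ j, PK k * E k j * D j k y).toReal =
      ∑ k, toVec PK k * ∑ j, toVec (E k) j * toVec (D j k) y := by
  have hT : ∀ k j, PK k * E k j * D j k y ≠ ∞ := fun k j =>
    ENNReal.mul_ne_top (ENNReal.mul_ne_top (PK.apply_ne_top _) ((E k).apply_ne_top _))
      ((D j k).apply_ne_top _)
  rw [ENNReal.toReal_sum fun k _ => ENNReal.sum_ne_top.mpr fun j _ => hT k j]
  refine Finset.sum_congr rfl fun k _ => ?_
  rw [ENNReal.toReal_sum fun j _ => hT k j, Finset.mul_sum]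
  refine Finset.sum_congr rfl fun j _ => ?_
  simp only [ENNReal.toReal_mul, toVec, mul_assoc]

theorem isSimulation_iff {N : Channel X Y} {c : ℝ} :
    IsSimulation N c ↔ ∃ M : ℕ, 1 ≤ M ∧ logb 2 M ≤ c ∧ IsSimulationOfSize N M := by
  refine exists_congr fun M => and_congr_right fun _ => and_congr_right fun _ => ?_
  refine exists_congr fun K => exists_congr fun _ => exists_congr fun PK =>
    exists_congr fun E => exists_congr fun D => forall_congr' fun x => forall_congr' fun y => ?_
  rw [← toReal_sum_sum_mul PK (fun k => E (x, k)) (fun j k => D (j, k)), toMat, toVec,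
    ENNReal.toReal_eq_toReal_iff' ((N x).apply_ne_top y)]
  exact ENNReal.sum_ne_top.mpr fun k _ => ENNReal.sum_ne_top.mpr fun j _ =>
    ENNReal.mul_ne_top (ENNReal.mul_ne_top (PK.apply_ne_top _) ((E _).apply_ne_top _))
      ((D _).apply_ne_top _)

/-- A simulated channel is dominated by a constant channel times the number of messages. -/
theorem IsSimulation.exists_le [Fintype Y] {N : Channel X Y} {c : ℝ} (h : IsSimulation N c) :
    ∃ q ∈ stdSimplex ℝ Y, ∀ x y, toMat N x y ≤ exp (c * log 2) * q y := by
  obtain ⟨M, hM, hMc, K, _, PK, E, D, hN⟩ := isSimulation_iff.mp h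
  have hM0 : (0 : ℝ) < M := by exact_mod_cast hM
  have hMle : (M : ℝ) ≤ exp (c * log 2) := by
    have h2 : 0 < log 2 := log_pos one_lt_two
    rw [logb, div_le_iff₀ h2] at hMc
    rwa [← log_le_iff_le_exp hM0]
  have hPK := toVec_mem PK
  -- The receiver's output law when the message is uniform and ignores `x`; bounding every encoder
  -- probability by one costs the factor `M`.
  set q : Y → ℝ := fun y => ∑ k, toVec PK k * ∑ j, (M : ℝ)⁻¹ * toVec (D (j, k)) y with hq
  have hqmem : q ∈ stdSimplex ℝ Y := by
    refine ⟨fun y => Finset.sum_nonneg fun k _ => mul_nonneg (hPK.1 k)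
      (Finset.sum_nonneg fun j _ => mul_nonneg (by positivity) ((toVec_mem _).1 y)), ?_⟩
    simp only [hq]
    rw [Finset.sum_comm]
    simp only [← Finset.mul_sum]
    have : ∀ k, ∑ y, ∑ j, toVec (D (j, k)) y = M := by
      intro k
      rw [Finset.sum_comm]
      simp [(toVec_mem _).2]
    simp only [this, inv_mul_cancel₀ hM0.ne', mul_one, hPK.2]
  refine ⟨q, hqmem, fun x y => ?_⟩
  calc toMat N x y ≤ M * q y := by
        rw [hN, hq]
        simp only [Finset.mul_sum]
        refine Finset.sum_le_sum fun k _ => Finset.sum_le_sum fun j _ => ?_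
        have h1 : toVec (E (x, k)) j ≤ 1 := by
          rw [← (toVec_mem (E (x, k))).2]
          exact Finset.single_le_sum (fun i _ => (toVec_mem (E (x, k))).1 i) (Finset.mem_univ j)
        have h2 := hPK.1 k
        have h3 := (toVec_mem (D (j, k))).1 y
        calc toVec PK k * (toVec (E (x, k)) j * toVec (D (j, k)) y)
            ≤ toVec PK k * (1 * toVec (D (j, k)) y) := by gcongr
          _ = _ := by field_simp
    _ ≤ _ := by
        have := hqmem.1 y
        gcongr

theorem isSimulationOfSize_const [Fintype Y] (Q : PMF Y) :
    IsSimulationOfSize (fun _ : X => Q) 1 := by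
  refine ⟨Unit, inferInstance, PMF.pure (), fun _ => PMF.pure 0, fun _ => Q, fun x y => ?_⟩
  simp [toMat, toVec]

/-- One additional message allows one round of rejection sampling. -/
theorem IsSimulationOfSize.step [Fintype Y] {N : Channel X Y} {M : ℕ}
    (h : IsSimulationOfSize N M) (Q : PMF Y) {v : X → Y → ℝ} (hv : ∀ x y, 0 ≤ v x y)
    (hvQ : ∀ x y, v x y ≤ toVec Q y) :
    ∃ N' : Channel X Y, IsSimulationOfSize N' (M + 1) ∧
      ∀ x y, toMat N' x y = v x y + (1 - ∑ y', v x y') * toMat N x y := by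
  classical
  have hv1 : ∀ x, ∑ y, v x y ≤ 1 := fun x => by
    rw [← (toVec_mem Q).2]
    exact Finset.sum_le_sum fun y _ => hvQ x y
  obtain ⟨K, _, PK, E, D, hN⟩ := h
  have hQ := toVec_mem Q
  have hmem : ∀ x, (fun y => v x y + (1 - ∑ y', v x y') * toMat N x y) ∈ stdSimplex ℝ Y := by
    intro x
    refine ⟨fun y => add_nonneg (hv x y) (mul_nonneg (by linarith [hv1 x]) ((toMat_mem N x).1 y)),
      ?_⟩
    rw [Finset.sum_add_distrib, ← Finset.mul_sum, (toMat_mem N x).2]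
    ring
  refine ⟨fun x => ofVec _ (hmem x), ?_, fun x y => by rw [toMat, toVec_ofVec]⟩
  -- The shared randomness gains a sample from `Q`. It must live in `Type`, so the sample is indexed
  -- by `Fin (Fintype.card Y)`.
  let e := Fintype.equivFin Y
  let Q' : Fin (Fintype.card Y) → ℝ := fun i => toVec Q (e.symm i)
  let a : X → Fin (Fintype.card Y) → ℝ := fun x i => v x (e.symm i) / Q' i
  have ha0 : ∀ x i, 0 ≤ a x i := fun x i => div_nonneg (hv _ _) (hQ.1 _)
  have ha1 : ∀ x i, a x i ≤ 1 := fun x i => div_le_one_of_le₀ (hvQ _ _) (hQ.1 _)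
  -- Where `Q'` vanishes so does `v`, and the default `0 / 0 = 0` for the acceptance probability is
  -- harmless.
  have haQ : ∀ x i, Q' i * a x i = v x (e.symm i) := by
    intro x i
    by_cases h : Q' i = 0
    · have : v x (e.symm i) = 0 := le_antisymm ((hvQ _ _).trans h.le) (hv _ _)
      rw [h, this, zero_mul]
    · exact mul_div_cancel₀ _ h
  have hQ'1 : ∑ i, Q' i = 1 := by rw [← hQ.2]; exact e.symm.sum_comp (toVec Q)
  have hPK' : (fun z : K × Fin (Fintype.card Y) => toVec PK z.1 * Q' z.2) ∈
      stdSimplex ℝ (K × Fin (Fintype.card Y)) := by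
    refine ⟨fun z => mul_nonneg ((toVec_mem PK).1 _) (hQ.1 _), ?_⟩
    rw [Fintype.sum_prod_type]
    simp only [← Finset.mul_sum, hQ'1, mul_one, (toVec_mem PK).2]
  -- Message `0` says that the shared sample is accepted; otherwise the old protocol runs with its
  -- messages shifted by one.
  have hE' : ∀ z : X × (K × Fin (Fintype.card Y)),
      (Fin.cons (a z.1 z.2.2) (fun j => (1 - a z.1 z.2.2) * toVec (E (z.1, z.2.1)) j) :
        Fin (M + 1) → ℝ) ∈ stdSimplex ℝ (Fin (M + 1)) := by
    intro z
    refine ⟨fun j => ?_, ?_⟩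
    · refine Fin.cases ?_ (fun j => ?_) j
      · simpa using ha0 _ _
      · simpa using mul_nonneg (by linarith [ha1 z.1 z.2.2]) ((toVec_mem _).1 j)
    · rw [Fin.sum_univ_succ]
      simp [← Finset.mul_sum, (toVec_mem _).2]
  refine ⟨K × Fin (Fintype.card Y), inferInstance, ofVec _ hPK', fun z => ofVec _ (hE' z),
    fun z => Fin.cases (PMF.pure (e.symm z.2.2)) (fun j => D (j, z.2.1)) z.1, fun x y => ?_⟩
  rw [toMat]
  simp only [toVec_ofVec, Fin.sum_univ_succ, Fin.cons_zero, Fin.cons_succ, Fin.cases_zero,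
    Fin.cases_succ, Fintype.sum_prod_type]
  have hpure : ∀ i, toVec (PMF.pure (e.symm i)) y = if i = e y then 1 else 0 := by
    intro i
    by_cases h : i = e y
    · simp [toVec, h]
    · have : y ≠ e.symm i := fun h' => h (by rw [h']; simp)
      simp [toVec, h, this]
  have key : ∀ k, ∑ i, toVec PK k * Q' i * (a x i * toVec (PMF.pure (e.symm i)) y +
      ∑ j, (1 - a x i) * toVec (E (x, k)) j * toVec (D (j, k)) y) =
      toVec PK k * v x y + (1 - ∑ y', v x y') *
        (toVec PK k * ∑ j, toVec (E (x, k)) j * toVec (D (j, k)) y) := by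
    intro k
    set S := ∑ j, toVec (E (x, k)) j * toVec (D (j, k)) y with hS
    have h1 : ∀ i, toVec PK k * Q' i * (a x i * toVec (PMF.pure (e.symm i)) y +
        ∑ j, (1 - a x i) * toVec (E (x, k)) j * toVec (D (j, k)) y) =
        toVec PK k * (v x (e.symm i) * if i = e y then 1 else 0) +
          toVec PK k * S * Q' i - toVec PK k * S * v x (e.symm i) := by
      intro i
      have : ∑ j, (1 - a x i) * toVec (E (x, k)) j * toVec (D (j, k)) y = (1 - a x i) * S := by
        rw [hS, Finset.mul_sum]
        exact Finset.sum_congr rfl fun j _ => by ring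
      rw [this, hpure, ← haQ x i]
      ring
    simp only [h1]
    rw [Finset.sum_sub_distrib, Finset.sum_add_distrib, ← Finset.mul_sum, ← Finset.mul_sum,
      ← Finset.mul_sum, hQ'1, e.symm.sum_comp (v x)]
    simp
    ring
  simp only [key]
  rw [Finset.sum_add_distrib, ← Finset.sum_mul, ← Finset.mul_sum, (toVec_mem PK).2, ← hN, one_mul]

/-- Acceptance after `j` rejections contributes `(1 - ∑ v) ^ j * v`. Induction puts a new round in
front; the base case outputs the sample unconditionally, since `v ≤ Q`. -/
theorem exists_isSimulationOfSize_geom [Fintype Y] (Q : PMF Y) {v : X → Y → ℝ}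
    (hv : ∀ x y, 0 ≤ v x y) (hvQ : ∀ x y, v x y ≤ toVec Q y) (M : ℕ) :
    ∃ N : Channel X Y, IsSimulationOfSize N (M + 1) ∧
      ∀ x y, (∑ j ∈ Finset.range (M + 1), (1 - ∑ y', v x y') ^ j) * v x y ≤ toMat N x y := by
  induction M with
  | zero => exact ⟨_, isSimulationOfSize_const Q, fun x y => by simpa [toMat] using hvQ x y⟩
  | succ M ih =>
    obtain ⟨N, hN, hle⟩ := ih
    obtain ⟨N', hN', heq⟩ := hN.step Q hv hvQ
    refine ⟨N', hN', fun x y => ?_⟩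
    have h1 : 0 ≤ 1 - ∑ y', v x y' := by
      rw [← (toVec_mem Q).2, sub_nonneg]
      exact Finset.sum_le_sum fun y _ => hvQ x y
    have hsucc : ∑ j ∈ Finset.range (M + 1), (1 - ∑ y', v x y') ^ (j + 1) =
        (1 - ∑ y', v x y') * ∑ j ∈ Finset.range (M + 1), (1 - ∑ y', v x y') ^ j := by
      rw [Finset.mul_sum]
      exact Finset.sum_congr rfl fun j _ => by rw [pow_succ']
    rw [heq, Finset.sum_range_succ', pow_zero, hsucc]
    have := mul_le_mul_of_nonneg_left (hle x y) h1
    linarith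

/-- Rejection sampling: a subchannel dominated by `L` times a fixed output distribution is
simulated with `M` messages up to a multiplicative error `exp (-M / L)`. -/
theorem exists_isSimulationOfSize [Fintype Y] (Q : PMF Y) {u : X → Y → ℝ} {L : ℝ} (hL : 1 ≤ L)
    (hu : ∀ x y, 0 ≤ u x y) (huQ : ∀ x y, u x y ≤ L * toVec Q y) (hu1 : ∀ x, ∑ y, u x y ≤ 1)
    {M : ℕ} (hM : 1 ≤ M) :
    ∃ N : Channel X Y, IsSimulationOfSize N M ∧
      ∀ x y, (1 - exp (-(M / L))) * u x y ≤ toMat N x y := by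
  have hL0 : 0 < L := by linarith
  obtain ⟨m, rfl⟩ : ∃ m, M = m + 1 := ⟨M - 1, by omega⟩
  obtain ⟨N, hN, hle⟩ := exists_isSimulationOfSize_geom Q (v := fun x y => u x y / L)
    (fun x y => div_nonneg (hu x y) hL0.le)
    (fun x y => by rw [div_le_iff₀ hL0, mul_comm]; exact huQ x y) m
  refine ⟨N, hN, fun x y => le_trans ?_ (hle x y)⟩
  -- Rejection has probability at least `1 - 1 / L`, so the geometric sum may be evaluated at that
  -- value for all rows.
  have hp : ∑ y', u x y' / L ≤ 1 / L := by
    rw [← Finset.sum_div]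
    exact div_le_div_of_nonneg_right (hu1 x) hL0.le
  have hL1 : 0 ≤ 1 - 1 / L := by rw [sub_nonneg, div_le_one hL0]; exact hL
  have hgeom : (∑ j ∈ Finset.range (m + 1), (1 - 1 / L) ^ j) = L * (1 - (1 - 1 / L) ^ (m + 1)) := by
    have := geom_sum_mul (1 - 1 / L) (m + 1)
    field_simp at this ⊢
    linarith
  have hexp : (1 - 1 / L) ^ (m + 1) ≤ exp (-((m + 1 : ℕ) / L)) := by
    calc (1 - 1 / L) ^ (m + 1) ≤ exp (-(1 / L)) ^ (m + 1) := by
          refine pow_le_pow_left₀ hL1 ?_ _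
          have := add_one_le_exp (-(1 / L))
          linarith
      _ = _ := by rw [← exp_nat_mul]; congr 1; ring
  calc (1 - exp (-((m + 1 : ℕ) / L))) * u x y ≤ (1 - (1 - 1 / L) ^ (m + 1)) * u x y := by
        have := hu x y
        gcongr
    _ = (∑ j ∈ Finset.range (m + 1), (1 - 1 / L) ^ j) * (u x y / L) := by
        rw [hgeom]; field_simp
    _ ≤ _ := by
        have := hu x y
        refine mul_le_mul_of_nonneg_right (Finset.sum_le_sum fun j _ => ?_) (by positivity)
        exact pow_le_pow_left₀ hL1 (by linarith) _

end Simulation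

/-! ### Capacities -/

section Capacity

theorem joint_ne_zero_iff {X Y : Type*} (P : PMF X) (W : Channel X Y) (x : X) (y : Y) :
    joint P W (x, y) ≠ 0 ↔ toVec P x * toMat W x y ≠ 0 := by
  rw [← toReal_joint, ENNReal.toReal_ne_zero]
  exact ⟨fun h => ⟨h, joint_ne_top P W _⟩, fun h => h.1⟩

theorem exists_forall_le_apply {X Y : Type*} [Fintype X] (w : X → Y → ℝ) (p : X → Prop) (hp : ∃ x, p x) :
    ∃ ξ : Y → X, ∀ y, p (ξ y) ∧ ∀ x, p x → w x y ≤ w (ξ y) y := by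
  classical
  have : ∀ y, ∃ x, p x ∧ ∀ x', p x' → w x' y ≤ w x y := by
    intro y
    obtain ⟨x, hx, hmax⟩ := (Finset.univ.filter p).exists_max_image (fun x => w x y)
      (by obtain ⟨x, hx⟩ := hp; exact ⟨x, by simpa using hx⟩)
    exact ⟨x, by simpa using hx, fun x' hx' => hmax x' (by simpa using hx')⟩
  choose ξ hξ using this
  exact ⟨ξ, hξ⟩

variable {X Y : Type*} [Fintype X] [Fintype Y]

theorem affinity_joint {a : ℝ} (ha : 0 < a) (P : PMF X) (W N : Channel X Y) :
    affinity a (joint P W) (joint P N) =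
      ∑ x, ∑ y, toVec P x * (toMat W x y ^ a * toMat N x y ^ (1 - a)) := by
  rw [affinity, Fintype.sum_prod_type]
  refine Finset.sum_congr rfl fun x _ => Finset.sum_congr rfl fun y _ => ?_
  rw [toReal_joint, toReal_joint]
  rcases ((toVec_mem P).1 x).eq_or_lt with h | h
  · rw [← h]
    simp [zero_rpow ha.ne']
  · have e : toVec P x ^ a * toVec P x ^ (1 - a) = toVec P x := by
      rw [← rpow_add h]; simp
    rw [mul_rpow h.le ((toMat_mem W x).1 y), mul_rpow h.le ((toMat_mem N x).1 y)]
    nth_rw 3 [← e]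
    ring

/-- Sibson's identity: `exp_scaledInfo_le` bounds every `Q`, and `sibsonOutput` attains the bound.
-/
theorem mutualInfo_eq {β : ℝ≥0∞} (h1 : 1 < β) (hT : β ≠ ∞) (P : PMF X) (W : Channel X Y) :
    mutualInfo β P W =
      ((scaledInfo (toVec P) (toMat W) β.toReal / ((β.toReal - 1) * log 2) : ℝ) : EReal) := by
  have hb := one_lt_toReal_of_one_lt h1 hT
  have hb' : β.toReal - 1 ≠ 0 := by linarith
  have h2 : log 2 ≠ 0 := (log_pos one_lt_two).ne'
  have hP := toVec_mem P
  have hW := toMat_mem W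
  have e : scaledInfo (toVec P) (toMat W) β.toReal / ((β.toReal - 1) * log 2) * log 2 *
      (β.toReal - 1) = scaledInfo (toVec P) (toMat W) β.toReal := by field_simp
  refine le_antisymm ?_ (le_iInf fun Q => ?_)
  · refine iInf_le_of_le (ofVec _ (sibsonOutput_mem hP hW β.toReal)) ?_
    rw [prodDist_eq_joint]
    refine renyiDiv_le_of_one_lt h1 hT (joint_ne_top _ _) (joint_ne_top _ _) ?_ ?_
    · rintro ⟨x, y⟩ h
      rw [joint_ne_zero_iff] at h ⊢
      rw [toMat, toVec_ofVec]
      exact mul_ne_zero (left_ne_zero_of_mul h) (sibsonOutput_pos hP hW _ h).ne'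
    · rw [e, affinity_joint (by linarith), ← sum_sum_sibsonOutput hP hW (by linarith)]
      simp only [toMat, toVec_ofVec]
      exact le_rfl
  · rw [prodDist_eq_joint]
    refine le_renyiDiv_of_one_lt h1 hT (joint_ne_top _ _) (joint_ne_top _ _) fun hpq => ?_
    rw [e, affinity_joint (by linarith)]
    refine exp_scaledInfo_le hP hW hb.le (toVec_mem Q).1 (toVec_mem Q).2.le fun x y h => ?_
    have := hpq (x, y) ((joint_ne_zero_iff P W x y).mpr h)
    rw [joint_ne_zero_iff] at this
    exact right_ne_zero_of_mul this

theorem stdSimplex_nonempty (ι : Type*) [Fintype ι] [Nonempty ι] : (stdSimplex ℝ ι).Nonempty := by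
  classical
  exact ⟨_, single_mem_stdSimplex ℝ (Classical.arbitrary ι)⟩

/-- The capacity of a finite order above one is attained. -/
theorem exists_capacity_eq [Nonempty X] {β : ℝ≥0∞} (h1 : 1 < β) (hT : β ≠ ∞) (W : Channel X Y) :
    ∃ P ∈ stdSimplex ℝ X,
      capacity β W =
        ((scaledInfo P (toMat W) β.toReal / ((β.toReal - 1) * log 2) : ℝ) : EReal) ∧
      ∀ P' ∈ stdSimplex ℝ X,
        scaledInfo P' (toMat W) β.toReal ≤ scaledInfo P (toMat W) β.toReal := by
  have hb := one_lt_toReal_of_one_lt h1 hT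
  obtain ⟨P, hP, hmax⟩ := (isCompact_stdSimplex ℝ X).exists_isMaxOn (stdSimplex_nonempty X)
    (continuousOn_scaledInfo (toMat_mem W) (by linarith : 0 < β.toReal))
  refine ⟨P, hP, le_antisymm (iSup_le fun P' => ?_) ?_, hmax⟩
  · rw [mutualInfo_eq h1 hT, EReal.coe_le_coe_iff]
    refine div_le_div_of_nonneg_right (hmax (toVec_mem P')) ?_
    exact mul_nonneg (by linarith) (log_pos one_lt_two).le
  · refine le_iSup_of_le (ofVec P hP) ?_
    rw [mutualInfo_eq h1 hT, toVec_ofVec]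

/-- Minimax for capacities of finite order: a strictly positive, nearly optimal output
distribution. -/
theorem exists_output_of_scaledInfo_lt {w : X → Y → ℝ} [Nonempty X]
    (hw : ∀ x, w x ∈ stdSimplex ℝ Y) {b s t : ℝ}
    (hb : 1 < b) (hs : ∀ P ∈ stdSimplex ℝ X, scaledInfo P w b ≤ s) (hst : s < t) :
    ∃ q ∈ stdSimplex ℝ Y, (∀ y, 0 < q y) ∧
      ∀ x, ∑ y, w x y ^ b * q y ^ (1 - b) ≤ exp t := by
  classical
  have hY : Nonempty Y :=
    ⟨(exists_pos_of_mem_stdSimplex (hw (Classical.arbitrary X))).choose⟩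
  have hcard : (0 : ℝ) < Fintype.card Y := by exact_mod_cast Fintype.card_pos
  -- Mixing an output distribution with weight `u` against the uniform one costs at most `u ^ (1 -
  -- b) = exp (t - s)`, exactly the available slack.
  set u := exp (-((t - s) / (b - 1))) with hu
  have hu0 : 0 < u := exp_pos _
  have hu1 : u < 1 := by
    rw [hu, exp_lt_one_iff, neg_lt_zero]
    exact div_pos (by linarith) (by linarith)
  have hub : u ^ (1 - b) = exp (t - s) := by
    rw [hu, ← exp_mul]
    congr 1
    have : b - 1 ≠ 0 := by linarith
    field_simp
    ring
  set η := (1 - u) / Fintype.card Y with hη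
  have hη0 : 0 < η := div_pos (by linarith) hcard
  -- The floor `η` keeps the compact set away from the boundary, where `q ^ (1 - b)` is not
  -- continuous.
  set S : Set (Y → ℝ) := stdSimplex ℝ Y ∩ {q | ∀ y, η ≤ q y} with hS
  have hSc : IsClosed {q : Y → ℝ | ∀ y, η ≤ q y} := by
    simp only [Set.ofPred_forall]
    exact isClosed_iInter fun y => isClosed_le continuous_const (continuous_apply y)
  have hmix : ∀ q ∈ stdSimplex ℝ Y, (fun y => u * q y + η) ∈ S := by
    intro q hq
    refine ⟨⟨fun y => add_nonneg (mul_nonneg hu0.le (hq.1 y)) hη0.le, ?_⟩, fun y => ?_⟩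
    · rw [Finset.sum_add_distrib, ← Finset.mul_sum, hq.2, Finset.sum_const, Finset.card_univ,
        nsmul_eq_mul, hη]
      field_simp
      ring
    · have := mul_nonneg hu0.le (hq.1 y)
      linarith
  obtain ⟨q₀, hq₀⟩ := stdSimplex_nonempty Y
  have hpos : ∀ q ∈ S, ∀ y, 0 < q y := fun q hq y => lt_of_lt_of_le hη0 (hq.2 y)
  obtain ⟨q, hq, hle⟩ := exists_forall_le_of_forall_exists_le (S := S) (T := stdSimplex ℝ X)
    (f := fun q P => ∑ x, P x * ∑ y, w x y ^ b * q y ^ (1 - b)) (C := exp t)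
    ⟨_, hmix q₀ hq₀⟩
    ((convex_stdSimplex ℝ Y).inter (by
      intro q hq q' hq' c d hc hd hcd y
      have h1 : η ≤ q y := hq y
      have h2 : η ≤ q' y := hq' y
      simp only [Pi.add_apply, Pi.smul_apply, smul_eq_mul]
      calc η = c * η + d * η := by rw [← add_mul, hcd, one_mul]
        _ ≤ _ := by gcongr))
    ((isCompact_stdSimplex ℝ Y).inter_right hSc) (convex_stdSimplex ℝ X)
    (by
      intro P _
      refine continuousOn_finsetSum _ fun x _ => continuousOn_const.mul
        (continuousOn_finsetSum _ fun y _ => continuousOn_const.mul ?_)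
      exact (continuous_apply y).continuousOn.rpow_const fun q hq => Or.inl (hpos q hq y).ne')
    (by
      intro P hP
      refine ConvexOn.quasiconvexOn ⟨?_, ?_⟩
      · refine (convex_stdSimplex ℝ Y).inter ?_
        intro q hq q' hq' c d hc hd hcd y
        have h1 : η ≤ q y := hq y
        have h2 : η ≤ q' y := hq' y
        simp only [Pi.add_apply, Pi.smul_apply, smul_eq_mul]
        calc η = c * η + d * η := by rw [← add_mul, hcd, one_mul]
          _ ≤ _ := by gcongr
      · intro q hq q' hq' c d hc hd hcd
        simp only [Finset.mul_sum, smul_eq_mul, Pi.add_apply, Pi.smul_apply]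
        rw [← Finset.sum_add_distrib]
        refine Finset.sum_le_sum fun x _ => ?_
        rw [← Finset.sum_add_distrib]
        refine Finset.sum_le_sum fun y _ => ?_
        have h1 := (convexOn_rpow_of_nonpos (by linarith : 1 - b ≤ 0)).2 (hpos q hq y)
          (hpos q' hq' y) hc hd hcd
        simp only [smul_eq_mul] at h1
        have h2 : 0 ≤ P x * w x y ^ b := mul_nonneg (hP.1 x) (rpow_nonneg ((hw x).1 y) _)
        calc _ = P x * w x y ^ b * (c * q y + d * q' y) ^ (1 - b) := by ring
          _ ≤ P x * w x y ^ b * (c * q y ^ (1 - b) + d * q' y ^ (1 - b)) := by gcongr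
          _ = _ := by ring)
    (by intro q _; fun_prop)
    (by
      intro q _
      refine ConcaveOn.quasiconcaveOn ⟨convex_stdSimplex ℝ X, ?_⟩
      intro P _ P' _ c d _ _ _
      simp only [smul_eq_mul, Pi.add_apply, Pi.smul_apply]
      rw [Finset.mul_sum, Finset.mul_sum, ← Finset.sum_add_distrib]
      exact Finset.sum_le_sum fun x _ => le_of_eq (by ring))
    (by
      intro P hP
      refine ⟨_, hmix _ (sibsonOutput_mem hP hw b), ?_⟩
      calc ∑ x, P x * ∑ y, w x y ^ b * (u * sibsonOutput P w b y + η) ^ (1 - b)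
          ≤ ∑ x, ∑ y, u ^ (1 - b) * (P x * (w x y ^ b * sibsonOutput P w b y ^ (1 - b))) := by
            refine Finset.sum_le_sum fun x _ => ?_
            rw [Finset.mul_sum]
            refine Finset.sum_le_sum fun y _ => ?_
            by_cases h : P x * w x y = 0
            · rcases mul_eq_zero.mp h with h | h
              · simp [h]
              · rw [h, zero_rpow (by linarith)]; simp
            · have h1 : 0 < sibsonOutput P w b y := sibsonOutput_pos hP hw b h
              have h2 : (u * sibsonOutput P w b y + η) ^ (1 - b) ≤
                  (u * sibsonOutput P w b y) ^ (1 - b) :=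
                rpow_le_rpow_of_nonpos (by positivity) (by linarith) (by linarith)
              rw [mul_rpow hu0.le h1.le] at h2
              have h3 := hP.1 x
              have h4 : 0 ≤ w x y ^ b := rpow_nonneg ((hw x).1 y) _
              calc _ ≤ P x * (w x y ^ b * (u ^ (1 - b) * sibsonOutput P w b y ^ (1 - b))) := by
                    gcongr
                _ = _ := by ring
        _ = exp (t - s) * exp (scaledInfo P w b) := by
            simp only [← Finset.mul_sum]
            rw [hub, ← sum_sum_sibsonOutput hP hw (by linarith)]
            simp only [← Finset.mul_sum]
        _ ≤ exp (t - s) * exp s := by gcongr; exact hs P hP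
        _ = exp t := by rw [← exp_add]; ring_nf)
  refine ⟨q, hq.1, hpos q hq, fun x => ?_⟩
  -- A point mass as input turns the averaged bound into one for the row `x`.
  have := hle _ (single_mem_stdSimplex ℝ x)
  simpa [Pi.single_apply] using this

/-- Minimax for the exponent: one input distribution bounds all orders simultaneously. -/
theorem exists_input_forall_order {w : X → Y → ℝ} [Nonempty X]
    (hw : ∀ x, w x ∈ stdSimplex ℝ Y) {a r C : ℝ} (ha : 1 ≤ a)
    (h : ∀ b, a ≤ b → ∃ P ∈ stdSimplex ℝ X, (b - 1) * r - scaledInfo P w b ≤ C) :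
    ∃ P ∈ stdSimplex ℝ X, ∀ b, a ≤ b → (b - 1) * r - scaledInfo P w b ≤ C := by
  refine exists_forall_le_of_forall_exists_le (S := stdSimplex ℝ X) (T := Set.Ici a)
    (f := fun P b => (b - 1) * r - scaledInfo P w b) (stdSimplex_nonempty X)
    (convex_stdSimplex ℝ X) (isCompact_stdSimplex ℝ X) (convex_Ici a) ?_ ?_ ?_ ?_ h
  · intro b hb
    have hb : a ≤ b := hb
    exact continuousOn_const.sub (continuousOn_scaledInfo hw (by linarith))
  · intro b hb
    have hb : a ≤ b := hb
    have hb0 : 0 < b := by linarith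
    -- Sublevel sets in `P` are superlevel sets of the concave functional `sibson`, hence convex.
    have hsib : ∀ P ∈ stdSimplex ℝ X, ∀ c, (b - 1) * r - scaledInfo P w b ≤ c ↔
        exp (((b - 1) * r - c) / b) ≤ sibson P w b := by
      intro P hP c
      rw [← le_log_iff_exp_le (sibson_pos hP hw b), div_le_iff₀ hb0, scaledInfo, mul_comm]
      constructor <;> intro h <;> linarith
    intro c
    have := (concaveOn_sibson hw (by linarith : 1 ≤ b)).quasiconcaveOn
      (exp (((b - 1) * r - c) / b))
    have e : {P ∈ stdSimplex ℝ X | (b - 1) * r - scaledInfo P w b ≤ c} =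
        {P ∈ stdSimplex ℝ X | exp (((b - 1) * r - c) / b) ≤ sibson P w b} :=
      Set.ext fun P => and_congr_right fun hP => hsib P hP c
    exact e ▸ this
  · intro P hP b hb
    have hb : a ≤ b := hb
    have := (differentiableAt_scaledInfo hP hw (by linarith : 0 < b)).continuousAt
    exact ContinuousAt.continuousWithinAt (by fun_prop)
  · intro P hP
    refine ConcaveOn.quasiconcaveOn ⟨convex_Ici a, ?_⟩
    intro b hb b' hb' c d hc hd hcd
    have hb : a ≤ b := hb
    have hb' : a ≤ b' := hb'
    have := (scaledInfo_convex hP hw).2 (by linarith : 0 < b) (by linarith : 0 < b') hc hd hcd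
    simp only [smul_eq_mul] at this ⊢
    have e : (c * b + d * b' - 1) * r = c * ((b - 1) * r) + d * ((b' - 1) * r) := by
      have : d = 1 - c := by linarith
      rw [this]; ring
    rw [e]
    linarith

/-! ### Capacity of order infinity and column maxima -/

theorem fidelity_top (p q : X → ℝ≥0∞) :
    fidelity ∞ p q = ⨅ x ∈ Function.support p, q x / p x := by
  rw [fidelity, if_neg ENNReal.top_ne_zero, if_neg ENNReal.top_ne_one, if_pos rfl]

/-- The input probability cancels in each likelihood ratio, so order infinity depends on `P` only
through its support. -/
theorem le_fidelity_top_joint {P : PMF X} {W N : Channel X Y} {c : ℝ} (hc : 0 ≤ c) :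
    ENNReal.ofReal c ≤ fidelity ∞ (joint P W) (joint P N) ↔
      ∀ x y, toVec P x ≠ 0 → c * toMat W x y ≤ toMat N x y := by
  rw [fidelity_top, le_iInf₂_iff, Prod.forall]
  refine forall_congr' fun x => forall_congr' fun y => ?_
  have hP := (toVec_mem P).1 x
  have hN := (toMat_mem N x).1 y
  rw [Function.mem_support, joint_ne_zero_iff]
  constructor
  · intro h hPx
    by_cases hW : toMat W x y = 0
    · rw [hW, mul_zero]
      exact hN
    · have h1 := h (mul_ne_zero hPx hW)
      rw [ENNReal.le_div_iff_mul_le (Or.inl ((joint_ne_zero_iff P W x y).mpr (mul_ne_zero hPx hW)))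
        (Or.inl (joint_ne_top _ _ _)), ← ENNReal.ofReal_toReal (joint_ne_top P W (x, y)),
        ← ENNReal.ofReal_toReal (joint_ne_top P N (x, y)), ← ENNReal.ofReal_mul hc,
        toReal_joint, toReal_joint, ENNReal.ofReal_le_ofReal_iff (mul_nonneg hP hN)] at h1
      have h2 : 0 < toVec P x := lt_of_le_of_ne hP hPx.symm
      refine le_of_mul_le_mul_left ?_ h2
      linarith
  · intro h hPW
    have h1 := h (left_ne_zero_of_mul hPW)
    rw [ENNReal.le_div_iff_mul_le (Or.inl ((joint_ne_zero_iff P W x y).mpr hPW))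
        (Or.inl (joint_ne_top _ _ _)), ← ENNReal.ofReal_toReal (joint_ne_top P W (x, y)),
        ← ENNReal.ofReal_toReal (joint_ne_top P N (x, y)), ← ENNReal.ofReal_mul hc,
        toReal_joint, toReal_joint]
    refine ENNReal.ofReal_le_ofReal ?_
    calc c * (toVec P x * toMat W x y) = toVec P x * (c * toMat W x y) := by ring
      _ ≤ _ := by gcongr

/-- A rate above the order-infinity capacity dominates the channel by one output distribution. -/
theorem exists_output_of_capacity_top_le [Nonempty X] {W : Channel X Y} {r : ℝ}
    (h : capacity ∞ W ≤ (r : EReal)) :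
    ∃ q ∈ stdSimplex ℝ Y, ∀ x y, toMat W x y ≤ exp (r * log 2) * q y := by
  have hW := toMat_mem W
  obtain ⟨ξ, hξ⟩ := exists_forall_le_apply (toMat W) (fun _ => True)
    ⟨Classical.arbitrary X, trivial⟩
  set m : Y → ℝ := fun y => toMat W (ξ y) y with hm
  have hm0 : ∀ y, 0 ≤ m y := fun y => (hW _).1 y
  have hle : ∀ x y, toMat W x y ≤ m y := fun x y => (hξ y).2 x trivial
  set s := ∑ y, m y with hs
  have hs1 : 1 ≤ s := by
    rw [← (hW (Classical.arbitrary X)).2]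
    exact Finset.sum_le_sum fun y _ => hle _ y
  have hs0 : 0 < s := by linarith
  have hmem : (fun y => m y / s) ∈ stdSimplex ℝ Y :=
    ⟨fun y => div_nonneg (hm0 y) hs0.le, by rw [← Finset.sum_div]; exact div_self hs0.ne'⟩
  refine ⟨_, hmem, fun x y => (hle x y).trans ?_⟩
  have hsr : s ≤ exp (r * log 2) := by
    -- The uniform input has full support. Any `Q` dominating a multiple of all rows dominates that
    -- multiple of the column maxima `m`; summing over `y` gives `log s ≤ r log 2`.
    have huni : (fun _ : X => (Fintype.card X : ℝ)⁻¹) ∈ stdSimplex ℝ X := by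
      refine ⟨fun x => by positivity, ?_⟩
      simp
    by_contra! hlt
    have hlog : r < log s / log 2 := by
      rw [lt_div_iff₀ (log_pos one_lt_two), lt_log_iff_exp_lt hs0]
      exact hlt
    have : ((log s / log 2 : ℝ) : EReal) ≤ capacity ∞ W := by
      refine le_iSup_of_le (ofVec _ huni) (le_iInf fun Q => ?_)
      refine le_of_forall_lt fun c hc => ?_
      obtain ⟨d, hcd, hd⟩ := EReal.lt_iff_exists_real_btwn.mp hc
      refine lt_of_lt_of_le hcd ?_
      by_contra! hlt'
      have h1 := renyiDiv_le_coe.mp hlt'.le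
      rw [prodDist_eq_joint, le_fidelity_top_joint (exp_pos _).le] at h1
      have h2 : ∀ y, exp (-d * log 2) * m y ≤ toVec Q y := fun y => by
        refine h1 (ξ y) y ?_
        rw [toVec_ofVec]
        have : (0 : ℝ) < Fintype.card X := by exact_mod_cast Fintype.card_pos
        positivity
      have h3 : exp (-d * log 2) * s ≤ 1 := by
        rw [hs, Finset.mul_sum, ← (toVec_mem Q).2]
        exact Finset.sum_le_sum fun y _ => h2 y
      have h4 : d < log s / log 2 := by exact_mod_cast hd
      rw [lt_div_iff₀ (log_pos one_lt_two), lt_log_iff_exp_lt hs0] at h4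
      have h5 : exp (-d * log 2) * exp (d * log 2) = 1 := by rw [← exp_add]; simp
      have h6 : exp (-d * log 2) * exp (d * log 2) < exp (-d * log 2) * s := by gcongr
      linarith
    have h7 := this.trans h
    have h8 : log s / log 2 ≤ r := by exact_mod_cast h7
    linarith
  calc m y = s * (m y / s) := by field_simp
    _ ≤ _ := by
      have := hmem.1 y
      gcongr

/-- A rate below the order-infinity capacity is exceeded by the column maxima over the support
of some input distribution. -/
theorem exists_input_of_lt_capacity_top [Nonempty X] {W : Channel X Y} {r : ℝ}
    (h : (r : EReal) < capacity ∞ W) :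
    ∃ P ∈ stdSimplex ℝ X, ∃ ξ : Y → X, (∀ y, 0 < P (ξ y)) ∧
      exp (r * log 2) < ∑ y, toMat W (ξ y) y := by
  obtain ⟨P, hP⟩ := lt_iSup_iff.mp h
  have hPv := toVec_mem P
  have hW := toMat_mem W
  obtain ⟨x₀, hx₀⟩ := exists_pos_of_mem_stdSimplex hPv
  obtain ⟨ξ, hξ⟩ := exists_forall_le_apply (toMat W) (fun x => 0 < toVec P x) ⟨x₀, hx₀⟩
  refine ⟨_, hPv, ξ, fun y => (hξ y).1, ?_⟩
  set s := ∑ y, toMat W (ξ y) y with hs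
  have hs1 : 1 ≤ s := by
    rw [← (hW x₀).2]
    exact Finset.sum_le_sum fun y _ => (hξ y).2 x₀ hx₀
  have hs0 : 0 < s := by linarith
  have hmem : (fun y => toMat W (ξ y) y / s) ∈ stdSimplex ℝ Y :=
    ⟨fun y => div_nonneg ((hW _).1 y) hs0.le, by rw [← Finset.sum_div]; exact div_self hs0.ne'⟩
  -- The normalised column maxima over the support serve as trial output distribution.
  have hle : mutualInfo ∞ P W ≤ ((log s / log 2 : ℝ) : EReal) := by
    refine iInf_le_of_le (ofVec _ hmem) ?_
    rw [prodDist_eq_joint, renyiDiv_le_coe, le_fidelity_top_joint (exp_pos _).le]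
    intro x y hx
    have h2 : log 2 ≠ 0 := (log_pos one_lt_two).ne'
    have h3 : -(log s / log 2) * log 2 = -log s := by field_simp
    rw [toMat, toMat, toVec_ofVec, h3, exp_neg, exp_log hs0, inv_mul_eq_div]
    exact div_le_div_of_nonneg_right
      ((hξ y).2 x (lt_of_le_of_ne (hPv.1 x) hx.symm)) hs0.le
  have h1 : (r : EReal) < ((log s / log 2 : ℝ) : EReal) := lt_of_lt_of_le hP hle
  have h2 : r < log s / log 2 := by exact_mod_cast h1
  rwa [lt_div_iff₀ (log_pos one_lt_two), lt_log_iff_exp_lt hs0] at h2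

/-- Keeping one row per column moment shows that `scaledInfo` grows at least linearly in the order,
with slope the logarithm of the sum of the selected entries. Below that slope the exponent terms
stay bounded. -/
theorem le_scaledInfo_of_column {P : X → ℝ} {w : X → Y → ℝ} (hP : P ∈ stdSimplex ℝ X)
    (hw : ∀ x, w x ∈ stdSimplex ℝ Y) {ξ : Y → X} {c : ℝ} (hc : 0 < c) (hcξ : ∀ y, c ≤ P (ξ y))
    (hs : 0 < ∑ y, w (ξ y) y) {b : ℝ} (hb : 0 < b) :
    log c + b * log (∑ y, w (ξ y) y) ≤ scaledInfo P w b := by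
  have h1 : c ^ (1 / b) * ∑ y, w (ξ y) y ≤ sibson P w b := by
    rw [Finset.mul_sum]
    refine Finset.sum_le_sum fun y _ => ?_
    have hwy := (hw (ξ y)).1 y
    have h2 : c * w (ξ y) y ^ b ≤ columnMoment P w b y := by
      calc c * w (ξ y) y ^ b ≤ P (ξ y) * w (ξ y) y ^ b := by gcongr; exact hcξ y
        _ ≤ _ := Finset.single_le_sum (f := fun x => P x * w x y ^ b)
          (fun x _ => mul_nonneg (hP.1 x) (rpow_nonneg ((hw x).1 y) _)) (Finset.mem_univ (ξ y))
    refine (le_of_eq ?_).trans (rpow_le_rpow (by positivity) h2 (by positivity))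
    rw [mul_rpow hc.le (by positivity), ← rpow_mul hwy, mul_one_div_cancel hb.ne', rpow_one]
  have h3 := log_le_log (by positivity) h1
  rw [log_mul (by positivity) hs.ne', log_rpow hc] at h3
  calc log c + b * log (∑ y, w (ξ y) y) = b * (1 / b * log c + log (∑ y, w (ξ y) y)) := by
        field_simp
    _ ≤ _ := by rw [scaledInfo]; gcongr

/-! ### Capacity of order zero and supports -/

theorem fidelity_zero_joint (P : PMF X) (W N : Channel X Y) :
    fidelity 0 (joint P W) (joint P N) =
      ENNReal.ofReal (∑ x, ∑ y, toVec P x * if toMat W x y = 0 then 0 else toMat N x y) := by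
  classical
  rw [fidelity, if_pos rfl, Fintype.sum_prod_type]
  have hnn : ∀ x y, 0 ≤ toVec P x * if toMat W x y = 0 then 0 else toMat N x y := fun x y =>
    mul_nonneg ((toVec_mem P).1 x) (by split_ifs; exacts [le_rfl, (toMat_mem N x).1 y])
  rw [ENNReal.ofReal_sum_of_nonneg fun x _ => Finset.sum_nonneg fun y _ => hnn x y]
  refine Finset.sum_congr rfl fun x _ => ?_
  rw [ENNReal.ofReal_sum_of_nonneg fun y _ => hnn x y]
  refine Finset.sum_congr rfl fun y _ => ?_
  rw [Set.indicator_apply, Function.mem_support, joint_ne_zero_iff]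
  by_cases hP : toVec P x = 0
  · simp [hP]
  by_cases hW : toMat W x y = 0
  · simp [hW]
  · rw [if_pos (mul_ne_zero hP hW), if_neg hW, ← toReal_joint,
      ENNReal.ofReal_toReal (joint_ne_top _ _ _)]

/-- A rate above the order-zero capacity yields an output distribution charging the support of
every row. -/
theorem exists_output_of_capacity_zero_lt [Nonempty X] {W : Channel X Y} {r : ℝ}
    (h : capacity 0 W < (r : EReal)) :
    ∃ q ∈ stdSimplex ℝ Y, ∀ x,
      exp (-r * log 2) ≤ ∑ y, if toMat W x y = 0 then 0 else q y := by
  classical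
  have hY : Nonempty Y :=
    ⟨(exists_pos_of_mem_stdSimplex (toMat_mem W (Classical.arbitrary X))).choose⟩
  have hcont : ∀ x y, Continuous fun q : Y → ℝ => if toMat W x y = 0 then 0 else q y := by
    intro x y
    split_ifs <;> fun_prop
  have hlin : ∀ (q q' : Y → ℝ) (c d : ℝ) x y,
      (if toMat W x y = 0 then 0 else (c • q + d • q') y) =
      c * (if toMat W x y = 0 then 0 else q y) + d * (if toMat W x y = 0 then 0 else q' y) := by
    intro q q' c d x y
    split_ifs <;> simp
  -- Order-zero fidelity is bilinear in input and output distribution, so the minimax applies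
  -- directly; the capacity bound supplies the response to each input.
  obtain ⟨q, hq, hle⟩ := exists_forall_le_of_forall_exists_le (S := stdSimplex ℝ Y)
    (T := stdSimplex ℝ X)
    (f := fun q P => -∑ x, P x * ∑ y, if toMat W x y = 0 then 0 else q y)
    (C := -exp (-r * log 2)) (stdSimplex_nonempty Y) (convex_stdSimplex ℝ Y)
    (isCompact_stdSimplex ℝ Y) (convex_stdSimplex ℝ X)
    (by
      intro P _
      exact (continuous_finsetSum _ fun x _ => continuous_const.mul
        (continuous_finsetSum _ fun y _ => hcont x y)).neg.continuousOn)
    (by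
      intro P _
      refine ConvexOn.quasiconvexOn ⟨convex_stdSimplex ℝ Y, ?_⟩
      intro q _ q' _ c d _ _ _
      simp only [hlin, smul_eq_mul, Finset.sum_add_distrib, ← Finset.mul_sum, mul_add]
      refine le_of_eq ?_
      simp only [mul_neg, Finset.mul_sum, neg_add]
      congr 2 <;> exact Finset.sum_congr rfl fun x _ =>
        Finset.sum_congr rfl fun y _ => by ring)
    (by intro q _; fun_prop)
    (by
      intro q _
      refine ConcaveOn.quasiconcaveOn ⟨convex_stdSimplex ℝ X, ?_⟩
      intro P _ P' _ c d _ _ _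
      refine le_of_eq ?_
      simp only [smul_eq_mul, Pi.add_apply, Pi.smul_apply, add_mul, Finset.sum_add_distrib,
        mul_neg, neg_add, mul_assoc, Finset.mul_sum])
    (by
      intro P hP
      have h1 : mutualInfo 0 (ofVec P hP) W < (r : EReal) := lt_of_le_of_lt (le_iSup (fun P => mutualInfo 0 P W) _) h
      obtain ⟨Q, hQ⟩ := iInf_lt_iff.mp h1
      refine ⟨toVec Q, toVec_mem Q, ?_⟩
      have h2 := renyiDiv_le_coe.mp hQ.le
      rw [prodDist_eq_joint, fidelity_zero_joint, ENNReal.ofReal_le_ofReal_iff'] at h2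
      rcases h2 with h2 | h2
      · rw [toVec_ofVec] at h2
        simp only [← Finset.mul_sum] at h2
        exact neg_le_neg h2
      · exact absurd h2 (not_le.mpr (exp_pos _)))
  refine ⟨q, hq, fun x => ?_⟩
  have := hle _ (single_mem_stdSimplex ℝ x)
  simp only [Pi.single_apply, ite_mul, one_mul, zero_mul, Finset.sum_ite_eq', Finset.mem_univ,
    if_true] at this
  linarith

/-- Testing the minimum over `Q` on point masses bounds, for each `y`, the probability of the inputs
that can produce `y`. -/
theorem exists_input_of_lt_capacity_zero {W : Channel X Y} {r : ℝ}
    (h : (r : EReal) < capacity 0 W) :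
    ∃ r' > r, ∃ P ∈ stdSimplex ℝ X, ∀ y,
      (∑ x, P x * if toMat W x y = 0 then 0 else 1) ≤ exp (-r' * log 2) := by
  classical
  obtain ⟨P, hP⟩ := lt_iSup_iff.mp h
  obtain ⟨r', hr, hr'⟩ := EReal.lt_iff_exists_real_btwn.mp hP
  refine ⟨r', by exact_mod_cast hr, toVec P, toVec_mem P, fun y => ?_⟩
  have h1 : (r' : EReal) ≤ renyiDiv 0 (joint P W) (prodDist P (PMF.pure y)) :=
    hr'.le.trans (iInf_le _ _)
  rw [coe_le_renyiDiv, prodDist_eq_joint, fidelity_zero_joint,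
    ENNReal.ofReal_le_ofReal_iff (exp_pos _).le] at h1
  refine (le_of_eq (Finset.sum_congr rfl fun x _ => ?_)).trans h1
  rw [Finset.sum_eq_single y]
  · rw [show toMat (fun _ : X => PMF.pure y) x y = 1 by simp [toMat, toVec]]
  · intro y' _ hy'
    simp [toMat, toVec, hy']
  · simp

end Capacity

/-! ### Bounding the reliability function -/

section Reliability

variable {X Y : Type*} [Fintype X] [Fintype Y] {α : ℝ≥0∞} {W : Channel X Y} {r e : ℝ}

theorem coe_mul_log2_bounds {n : ℕ} (hn : n ≠ 0) {D : EReal} {e : ℝ} :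
    (D ≤ ((exp (n * -(e * log 2)) : ℝ) : EReal) →
      (e : EReal) ≤ ((-1 / n : ℝ) : EReal) * log2 D.toENNReal) ∧
    (((exp (n * -(e * log 2)) : ℝ) : EReal) ≤ D →
      ((-1 / n : ℝ) : EReal) * log2 D.toENNReal ≤ (e : EReal)) := by
  have hn0 : (0 : ℝ) < n := by exact_mod_cast Nat.pos_of_ne_zero hn
  have hneg : ((-1 / n : ℝ) : EReal) ≤ 0 := by
    have : -1 / (n : ℝ) ≤ 0 := div_nonpos_of_nonpos_of_nonneg (by norm_num) hn0.le
    exact_mod_cast this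
  have he : (e : EReal) = ((-(n * e) : ℝ) : EReal) * ((-1 / n : ℝ) : EReal) := by
    rw [← EReal.coe_mul]
    congr 1
    field_simp
  have hexp : exp (n * -(e * log 2)) = exp (-(n * e) * log 2) := by ring_nf
  constructor
  · intro h
    have h1 := EReal.toENNReal_le_toENNReal h
    rw [EReal.real_coe_toENNReal, hexp, ← log2_le_coe] at h1
    rw [mul_comm, he]
    exact EReal.mul_le_mul_of_nonpos_right h1 hneg
  · intro h
    have h1 := EReal.toENNReal_le_toENNReal h
    rw [EReal.real_coe_toENNReal, hexp, ← coe_le_log2] at h1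
    rw [mul_comm, he]
    exact EReal.mul_le_mul_of_nonpos_right h1 hneg

theorem le_reliability (c : ℕ → ℝ)
    (hc : limsup (fun n : ℕ => ((c n / n : ℝ) : EReal)) atTop ≤ (r : EReal))
    (h : ∀ᶠ n : ℕ in atTop, ∃ N : Channel (Fin n → X) (Fin n → Y), IsSimulation N (c n) ∧
      channelDiv α (power W n) N ≤ ((exp (n * -(e * log 2)) : ℝ) : EReal)) :
    (e : EReal) ≤ reliability α W r := by
  refine le_iSup₂_of_le c hc (le_liminf_of_le (h := ?_))
  filter_upwards [h, eventually_ne_atTop 0] with n ⟨N, hN, hle⟩ hn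
  exact (coe_mul_log2_bounds hn).1 ((iInf₂_le N hN).trans hle)

/-- A cost sequence of rate at most `r` is eventually below `n * r'`, and a simulation stays one
when the allowed cost grows. -/
theorem reliability_le {r' : ℝ} (hr : r < r')
    (h : ∀ᶠ n : ℕ in atTop, ∀ N : Channel (Fin n → X) (Fin n → Y), IsSimulation N (n * r') →
      ((exp (n * -(e * log 2)) : ℝ) : EReal) ≤ channelDiv α (power W n) N) :
    reliability α W r ≤ (e : EReal) := by
  refine iSup₂_le fun c hc => liminf_le_of_frequently_le' (Eventually.frequently ?_)
  have hc' : limsup (fun n : ℕ => ((c n / n : ℝ) : EReal)) atTop < (r' : EReal) :=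
    lt_of_le_of_lt hc (by exact_mod_cast hr)
  filter_upwards [h, eventually_ne_atTop 0, eventually_lt_of_limsup_lt hc'] with n h hn hcn
  refine (coe_mul_log2_bounds hn).2 (le_iInf₂ fun N hN => h N ?_)
  have hn0 : (0 : ℝ) < n := by exact_mod_cast Nat.pos_of_ne_zero hn
  have hcn' : c n / n < r' := by exact_mod_cast hcn
  rw [div_lt_iff₀ hn0] at hcn'
  obtain ⟨M, hM, hMc, hN⟩ := hN
  exact ⟨M, hM, by linarith, hN⟩

theorem natCast_le_exp {δ : ℝ} (hδ : 0 < δ) (n : ℕ) : (n : ℝ) ≤ δ⁻¹ * exp (n * δ) := by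
  have := add_one_le_exp (n * δ)
  rw [inv_mul_eq_div, le_div_iff₀ hδ]
  linarith

/-- Number of messages at rate `r`, up to a quadratic factor. -/
def messageCount (r : ℝ) (n : ℕ) : ℕ := ⌈(n : ℝ) ^ 2 * exp (n * (r * log 2))⌉₊

theorem one_le_messageCount (r : ℝ) {n : ℕ} (hn : n ≠ 0) : 1 ≤ messageCount r n := by
  have hn0 : (0 : ℝ) < n := by exact_mod_cast Nat.pos_of_ne_zero hn
  exact Nat.ceil_pos.mpr (by positivity)

/-- The factor `n ^ 2` is subexponential. Nonnegativity of `r` makes the argument of the ceiling at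
least one, so rounding at most doubles it. -/
theorem limsup_messageCount_le (hr : 0 ≤ r) :
    limsup (fun n : ℕ => ((logb 2 (messageCount r n) / n : ℝ) : EReal)) atTop ≤ (r : EReal) := by
  refine EReal.le_of_forall_lt_iff_le.mp fun r' hr' => limsup_le_of_le (h := ?_)
  have hr' : r < r' := by exact_mod_cast hr'
  have h2 : 0 < log 2 := log_pos one_lt_two
  set δ := (r' - r) * log 2 with hδ
  have hδ0 : 0 < δ := mul_pos (by linarith) h2
  filter_upwards [eventually_ne_atTop 0, eventually_mul_exp_le
    (by linarith : r * log 2 + δ / 2 < r * log 2 + δ) (2 * ((δ / 4)⁻¹) ^ 2)] with n hn hle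
  have hn0 : (0 : ℝ) < n := by exact_mod_cast Nat.pos_of_ne_zero hn
  have hn1 : (1 : ℝ) ≤ n := by exact_mod_cast Nat.one_le_iff_ne_zero.mpr hn
  have hM1 : (0 : ℝ) < messageCount r n := by exact_mod_cast one_le_messageCount r hn
  have hge : 1 ≤ (n : ℝ) ^ 2 * exp (n * (r * log 2)) :=
    one_le_mul_of_one_le_of_one_le (one_le_pow₀ hn1) (one_le_exp (by positivity))
  have hM : (messageCount r n : ℝ) ≤ 2 * ((n : ℝ) ^ 2 * exp (n * (r * log 2))) := by
    have := (Nat.ceil_lt_add_one (by positivity :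
      0 ≤ (n : ℝ) ^ 2 * exp (n * (r * log 2)))).le
    rw [messageCount]
    linarith
  have hsq : (n : ℝ) ^ 2 ≤ ((δ / 4)⁻¹) ^ 2 * exp (n * (δ / 2)) := by
    calc (n : ℝ) ^ 2 ≤ ((δ / 4)⁻¹ * exp (n * (δ / 4))) ^ 2 := by
          gcongr
          exact natCast_le_exp (by positivity) n
      _ = _ := by rw [mul_pow, ← exp_nat_mul]; ring_nf
  have hMle : (messageCount r n : ℝ) ≤ exp (n * (r * log 2 + δ)) := by
    calc (messageCount r n : ℝ) ≤
          2 * ((((δ / 4)⁻¹) ^ 2 * exp (n * (δ / 2))) * exp (n * (r * log 2))) :=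
          hM.trans (by gcongr)
      _ = 2 * ((δ / 4)⁻¹) ^ 2 * exp (n * (r * log 2 + δ / 2)) := by
          rw [mul_add, exp_add]; ring
      _ ≤ _ := hle
  have hlog := (log_le_iff_le_exp hM1).mpr hMle
  have : logb 2 (messageCount r n) / n ≤ r' := by
    rw [logb, div_le_iff₀ hn0, div_le_iff₀ h2]
    refine hlog.trans (le_of_eq ?_)
    rw [hδ]
    ring
  exact_mod_cast this

/-- Rejection sampling at rate `r` for blocklength `n`. -/
theorem exists_simulation_of_le {X Y : Type*} [Fintype Y] {r : ℝ} {n : ℕ} (hn : n ≠ 0) (hr : 0 ≤ r) {q : (Fin n → Y) → ℝ}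
    (hq : q ∈ stdSimplex ℝ (Fin n → Y)) {u : (Fin n → X) → (Fin n → Y) → ℝ}
    (hu : ∀ x y, 0 ≤ u x y) (huq : ∀ x y, u x y ≤ exp (n * (r * log 2)) * q y)
    (hu1 : ∀ x, ∑ y, u x y ≤ 1) :
    ∃ N : Channel (Fin n → X) (Fin n → Y), IsSimulation N (logb 2 (messageCount r n)) ∧
      ∀ x y, exp (-(2 * exp (-(n : ℝ) ^ 2))) * u x y ≤ toMat N x y := by
  have hn1 : (1 : ℝ) ≤ n := by exact_mod_cast Nat.one_le_iff_ne_zero.mpr hn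
  have h2 : 0 < log 2 := log_pos one_lt_two
  have hL : 1 ≤ exp (n * (r * log 2)) := one_le_exp (by positivity)
  obtain ⟨N, hN, hle⟩ := exists_isSimulationOfSize (ofVec q hq) hL hu
    (by simpa only [toVec_ofVec] using huq) hu1 (one_le_messageCount r hn)
  refine ⟨N, isSimulation_iff.mpr ⟨_, one_le_messageCount r hn, le_rfl, hN⟩, fun x y =>
    le_trans (mul_le_mul_of_nonneg_right ?_ (hu x y)) (hle x y)⟩
  -- The purpose of the factor `n ^ 2` in `messageCount`: the sampling loss beats every exponential.
  have h1 : exp (-(messageCount r n / exp (n * (r * log 2)))) ≤ exp (-(n : ℝ) ^ 2) := by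
    rw [exp_le_exp, neg_le_neg_iff, le_div_iff₀ (exp_pos _)]
    exact Nat.le_ceil _
  -- Needed because `exp (-2t) ≤ 1 - t` is obtained from `(1 - t) * (1 + 2t) ≥ 1`, that is, `0 ≤ t ≤
  -- 1 / 2`.
  have hhalf : exp (-(n : ℝ) ^ 2) ≤ 1 / 2 := by
    have h3 : exp (-(n : ℝ) ^ 2) ≤ exp (-1) := exp_le_exp.mpr (by nlinarith)
    have h4 := exp_neg_one_lt_half
    linarith
  set t := exp (-(n : ℝ) ^ 2) with ht
  have ht0 : 0 < t := exp_pos _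
  have h5 : exp (-(2 * t)) ≤ 1 - t := by
    rw [exp_neg, inv_le_comm₀ (exp_pos _) (by linarith), inv_eq_one_div,
      div_le_iff₀ (by linarith)]
    have := add_one_le_exp (2 * t)
    nlinarith
  linarith

theorem eventually_const_mul_exp_neg_sq_le (c A : ℝ) (hc : 0 ≤ c) :
    ∀ᶠ n : ℕ in atTop, c * exp (-(n : ℝ) ^ 2) ≤ exp (n * -A) := by
  filter_upwards [eventually_mul_exp_le (by linarith : -A - 1 < -A) c,
    (tendsto_natCast_atTop_atTop (R := ℝ)).eventually_ge_atTop (A + 1)] with n h1 h2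
  refine le_trans ?_ h1
  gcongr
  have : (0 : ℝ) ≤ n := Nat.cast_nonneg n
  nlinarith

theorem channelDiv_le_of_mul_le {X Y : Type*} [Fintype X] [Fintype Y] {α : ℝ≥0∞}
    {W N : Channel X Y} {d : ℝ}
    (h : ∀ x y, exp (-d * log 2) * toMat W x y ≤ toMat N x y) :
    channelDiv α W N ≤ (d : EReal) := by
  refine iSup_le fun P => renyiDiv_le_coe.mpr (le_fidelity_of_mul_le (sum_joint P W)
    (ENNReal.ofReal_pos.mpr (exp_pos _)).ne' ENNReal.ofReal_ne_top ?_)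
  rintro ⟨x, y⟩
  rw [← ENNReal.ofReal_toReal (joint_ne_top P W (x, y)),
    ← ENNReal.ofReal_toReal (joint_ne_top P N (x, y)), ← ENNReal.ofReal_mul (exp_pos _).le,
    toReal_joint, toReal_joint]
  refine ENNReal.ofReal_le_ofReal ?_
  calc exp (-d * log 2) * (toVec P x * toMat W x y)
      = toVec P x * (exp (-d * log 2) * toMat W x y) := by ring
    _ ≤ _ := mul_le_mul_of_nonneg_left (h x y) ((toVec_mem P).1 x)

theorem channelDiv_zero_le {X Y : Type*} [Fintype X] [Fintype Y] {W N : Channel X Y} {d : ℝ}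
    (h : ∀ x, exp (-d * log 2) ≤ ∑ y, if toMat W x y = 0 then 0 else toMat N x y) :
    channelDiv 0 W N ≤ (d : EReal) := by
  refine iSup_le fun P => renyiDiv_le_coe.mpr ?_
  rw [fidelity_zero_joint]
  refine ENNReal.ofReal_le_ofReal ?_
  calc exp (-d * log 2) = ∑ x, toVec P x * exp (-d * log 2) := by
        rw [← Finset.sum_mul, (toVec_mem P).2, one_mul]
    _ ≤ _ := Finset.sum_le_sum fun x _ => by
        rw [← Finset.mul_sum]
        exact mul_le_mul_of_nonneg_left (h x) ((toVec_mem P).1 x)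

theorem prodMat_le_exp_mul {X Y : Type*} {w : X → Y → ℝ} (hw : ∀ x y, 0 ≤ w x y) {q : Y → ℝ} {s : ℝ}
    (h : ∀ x y, w x y ≤ exp s * q y) (n : ℕ) (x : Fin n → X) (y : Fin n → Y) :
    prodMat w n x y ≤ exp (n * s) * prodVec q n y := by
  calc prodMat w n x y ≤ ∏ i, exp s * q (y i) :=
        Finset.prod_le_prod (fun i _ => hw _ _) fun i _ => h _ _
    _ = _ := by
        rw [Finset.prod_mul_distrib, Finset.prod_const, Finset.card_univ, Fintype.card_fin,
          ← exp_nat_mul, prodVec]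

theorem eq_top_of_forall_coe_le {z : EReal} (h : ∀ e : ℝ, (e : EReal) ≤ z) : z = ⊤ :=
  EReal.eq_top_iff_forall_lt z |>.mpr fun e =>
    lt_of_lt_of_le (by exact_mod_cast lt_add_one e) (h (e + 1))

/-- Above the order-infinity capacity the simulation error decays superexponentially. -/
theorem reliability_eq_top_of_capacity_top_le [Nonempty X] (h : capacity ∞ W ≤ (r : EReal)) :
    reliability α W r = ⊤ := by
  obtain ⟨q, hq, hle⟩ := exists_output_of_capacity_top_le h
  have h2 : 0 < log 2 := log_pos one_lt_two
  have hW := toMat_mem W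
  have hr : 0 ≤ r := by
    have h1 : (1 : ℝ) ≤ exp (r * log 2) := by
      rw [← (hW (Classical.arbitrary X)).2, ← mul_one (exp _), ← hq.2, Finset.mul_sum]
      exact Finset.sum_le_sum fun y _ => hle _ y
    exact nonneg_of_mul_nonneg_left (one_le_exp_iff.mp h1) h2
  refine eq_top_of_forall_coe_le fun e => le_reliability _ (limsup_messageCount_le hr) ?_
  filter_upwards [eventually_ne_atTop 0,
    eventually_const_mul_exp_neg_sq_le (2 / log 2) (e * log 2) (by positivity)] with n hn hexp
  -- The whole channel lies below `exp (n * (r * log 2))` times a product distribution, so sampling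
  -- loss is the only error.
  obtain ⟨N, hN, hNle⟩ := exists_simulation_of_le hn hr (prodVec_mem hq n)
    (u := prodMat (toMat W) n) (fun x y => (prodMat_mem hW n x).1 y)
    (fun x y => prodMat_le_exp_mul (fun x y => (hW x).1 y) hle n x y)
    (fun x => (prodMat_mem hW n x).2.le)
  refine ⟨N, hN, (channelDiv_le_of_mul_le (d := 2 / log 2 * exp (-(n : ℝ) ^ 2)) ?_).trans
    (by exact_mod_cast hexp)⟩
  intro x y
  rw [toMat_power]
  refine (le_of_eq ?_).trans (hNle x y)
  congr 2
  field_simp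

/-- Above the order-zero capacity the order-zero error decays superexponentially. -/
theorem reliability_zero_eq_top [Nonempty X] (h : capacity 0 W < (r : EReal)) :
    reliability 0 W r = ⊤ := by
  classical
  obtain ⟨q, hq, hle⟩ := exists_output_of_capacity_zero_lt h
  have h2 : 0 < log 2 := log_pos one_lt_two
  set v : X → Y → ℝ := fun x y => if toMat W x y = 0 then 0 else q y with hv
  have hv0 : ∀ x y, 0 ≤ v x y := fun x y => by
    simp only [hv]; split_ifs; exacts [le_rfl, hq.1 y]
  have hvq : ∀ x y, v x y ≤ q y := fun x y => by
    simp only [hv]; split_ifs; exacts [hq.1 y, le_rfl]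
  have hr : 0 ≤ r := by
    have h1 : exp (-r * log 2) ≤ 1 := by
      refine (hle (Classical.arbitrary X)).trans ?_
      rw [← hq.2]
      exact Finset.sum_le_sum fun y _ => hvq _ y
    rw [exp_le_one_iff] at h1
    nlinarith
  refine eq_top_of_forall_coe_le fun e => le_reliability _ (limsup_messageCount_le hr) ?_
  filter_upwards [eventually_ne_atTop 0,
    eventually_const_mul_exp_neg_sq_le (2 / log 2) (e * log 2) (by positivity)] with n hn hexp
  have hV0 : ∀ x y, 0 ≤ prodMat v n x y := fun x y => Finset.prod_nonneg fun i _ => hv0 _ _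
  have hVq : ∀ x y, prodMat v n x y ≤ prodVec q n y := fun x y =>
    Finset.prod_le_prod (fun i _ => hv0 _ _) fun i _ => hvq _ _
  have hVs : ∀ x, exp (-(n * (r * log 2))) ≤ ∑ y, prodMat v n x y := by
    intro x
    rw [sum_prodMat]
    calc exp (-(n * (r * log 2))) = ∏ _i : Fin n, exp (-r * log 2) := by
          rw [Finset.prod_const, Finset.card_univ, Fintype.card_fin, ← exp_nat_mul]
          ring_nf
      _ ≤ _ := Finset.prod_le_prod (fun i _ => (exp_pos _).le) fun i _ => hle _
  have hVs0 : ∀ x, 0 < ∑ y, prodMat v n x y := fun x => lt_of_lt_of_le (exp_pos _) (hVs x)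
  -- The product output law conditioned on the support of the row. The conditioning event has
  -- probability at least `exp (-(n * (r * log 2)))`, which is the domination that sampling
  -- requires.
  set u : (Fin n → X) → (Fin n → Y) → ℝ := fun x y =>
    prodMat v n x y / ∑ y', prodMat v n x y' with hu
  have hu1 : ∀ x, ∑ y, u x y = 1 := fun x => by
    simp only [hu]
    rw [← Finset.sum_div]
    exact div_self (hVs0 x).ne'
  obtain ⟨N, hN, hNle⟩ := exists_simulation_of_le hn hr (prodVec_mem hq n) (u := u)
    (fun x y => div_nonneg (hV0 x y) (hVs0 x).le)
    (fun x y => by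
      rw [hu, div_le_iff₀ (hVs0 x)]
      have h3 : 1 ≤ exp (n * (r * log 2)) * ∑ y', prodMat v n x y' := by
        calc (1 : ℝ) = exp (n * (r * log 2)) * exp (-(n * (r * log 2))) := by
              rw [← exp_add]; simp
          _ ≤ _ := by gcongr; exact hVs x
      calc prodMat v n x y ≤ 1 * prodVec q n y := by rw [one_mul]; exact hVq x y
        _ ≤ (exp (n * (r * log 2)) * ∑ y', prodMat v n x y') * prodVec q n y :=
          mul_le_mul_of_nonneg_right h3 ((prodVec_mem hq n).1 y)
        _ = _ := by ring)
    (fun x => (hu1 x).le)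
  refine ⟨N, hN, (channelDiv_zero_le (d := 2 / log 2 * exp (-(n : ℝ) ^ 2)) ?_).trans
    (by exact_mod_cast hexp)⟩
  intro x
  rw [toMat_power]
  calc exp (-(2 / log 2 * exp (-(n : ℝ) ^ 2)) * log 2)
      = ∑ y, exp (-(2 * exp (-(n : ℝ) ^ 2))) * u x y := by
        rw [← Finset.mul_sum, hu1, mul_one]
        congr 1
        field_simp
    _ ≤ _ := Finset.sum_le_sum fun y _ => by
        split_ifs with h0
        · have : prodMat v n x y = 0 := by
            obtain ⟨i, _, hi⟩ := Finset.prod_eq_zero_iff.mp h0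
            exact Finset.prod_eq_zero (Finset.mem_univ i) (by simp only [hv]; rw [if_pos hi])
          simp [hu, this]
        · exact hNle x y

/-- With no communication the uniform output already has divergence at most `n * log |Y| / log 2`,
which is subexponential. -/
theorem reliability_nonneg [Nonempty X] (hr : 0 ≤ r) : 0 ≤ reliability α W r := by
  have hY : Nonempty Y :=
    ⟨(exists_pos_of_mem_stdSimplex (toMat_mem W (Classical.arbitrary X))).choose⟩
  have h2 : 0 < log 2 := log_pos one_lt_two
  have hcard : (0 : ℝ) < Fintype.card Y := by exact_mod_cast Fintype.card_pos
  have hcard1 : (1 : ℝ) ≤ Fintype.card Y := by exact_mod_cast Fintype.card_pos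
  set k := log (Fintype.card Y) with hk
  have hk0 : 0 ≤ k := log_nonneg hcard1
  have huni : (fun _ : Y => (Fintype.card Y : ℝ)⁻¹) ∈ stdSimplex ℝ Y :=
    ⟨fun y => by positivity, by simp⟩
  refine EReal.ge_of_forall_gt_iff_ge.mp fun e he => ?_
  have he : e < 0 := by exact_mod_cast he
  refine le_reliability (fun _ => 0) (by simpa using hr) ?_
  have hδ : 0 < -(e * log 2) / 2 := by nlinarith
  filter_upwards [eventually_mul_exp_le (by linarith : -(e * log 2) / 2 < -(e * log 2))
    (k / log 2 * (-(e * log 2) / 2)⁻¹)] with n hexp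
  refine ⟨fun _ => ofVec _ (prodVec_mem huni n), isSimulation_iff.mpr ⟨1, le_rfl, by simp,
    isSimulationOfSize_const _⟩, (channelDiv_le_of_mul_le (d := n * (k / log 2)) ?_).trans ?_⟩
  · intro x y
    rw [toMat_power, toMat, toVec_ofVec]
    have h3 : ∀ x y, toMat W x y ≤ exp k * (Fintype.card Y : ℝ)⁻¹ := by
      intro x y
      rw [hk, exp_log hcard, mul_inv_cancel₀ hcard.ne', ← (toMat_mem W x).2]
      exact Finset.single_le_sum (fun y _ => (toMat_mem W x).1 y) (Finset.mem_univ y)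
    have h4 := prodMat_le_exp_mul (fun x y => (toMat_mem W x).1 y)
      (q := fun _ : Y => (Fintype.card Y : ℝ)⁻¹) h3 n x y
    calc exp (-(n * (k / log 2)) * log 2) * prodMat (toMat W) n x y
        ≤ exp (-(n * (k / log 2)) * log 2) * (exp (n * k) * prodVec _ n y) := by gcongr
      _ = _ := by
        rw [← mul_assoc, ← exp_add]
        have : -(n * (k / log 2)) * log 2 + n * k = 0 := by field_simp; ring
        rw [this, exp_zero, one_mul]
  · have : n * (k / log 2) ≤ exp (n * -(e * log 2)) := by
      refine le_trans ?_ hexp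
      calc n * (k / log 2) ≤ ((-(e * log 2) / 2)⁻¹ * exp (n * (-(e * log 2) / 2))) * (k / log 2) := by
            gcongr
            exact natCast_le_exp hδ n
        _ = _ := by ring
    exact_mod_cast this

end Reliability

/-! ### Achievability below the order-infinity capacity -/

section Achievability

variable {X Y : Type*} [Fintype X] [Fintype Y]

/-- Where `W ≤ L q` the truncated summand is just `W`; elsewhere `W / (L q) ≥ 1`, so raising the
order from `a` to `b` only increases it. The affinity is thus at most `exp (t * (a - 1)) * (1 + L ^
(1 - b) * K)` on every row, whatever the input. -/
theorem channelDiv_le_of_truncation {α : ℝ≥0∞} (h1 : 1 < α) (hT : α ≠ ∞) {W N : Channel X Y}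
    {b t L K : ℝ} (hb : α.toReal ≤ b) (hL : 0 < L) {q : Y → ℝ} (hq : ∀ y, 0 < q y)
    (hN : ∀ x y, exp (-t) * min (toMat W x y) (L * q y) ≤ toMat N x y)
    (hK : ∀ x, ∑ y, toMat W x y ^ b * q y ^ (1 - b) ≤ K) :
    channelDiv α W N ≤
      (((t + L ^ (1 - b) * K / (α.toReal - 1)) / log 2 : ℝ) : EReal) := by
  have ha := one_lt_toReal_of_one_lt h1 hT
  set a := α.toReal with haa
  have h2 : log 2 ≠ 0 := (log_pos one_lt_two).ne'
  have hW := toMat_mem W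
  have hNpos : ∀ x y, 0 < toMat W x y → 0 < toMat N x y := fun x y h =>
    lt_of_lt_of_le (mul_pos (exp_pos _) (lt_min h (mul_pos hL (hq y)))) (hN x y)
  have hpt : ∀ x y, toMat W x y ^ a * toMat N x y ^ (1 - a) ≤
      exp (t * (a - 1)) * (toMat W x y + L ^ (1 - b) * (toMat W x y ^ b * q y ^ (1 - b))) := by
    intro x y
    have hqy := hq y
    rcases ((hW x).1 y).eq_or_lt with h | h
    · rw [← h, zero_rpow (by linarith), zero_rpow (by linarith)]
      simp
    · have hLq : 0 < L * q y := mul_pos hL hqy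
      have hmin : 0 < min (toMat W x y) (L * q y) := lt_min h hLq
      have e1 : toMat N x y ^ (1 - a) ≤
          exp (t * (a - 1)) * min (toMat W x y) (L * q y) ^ (1 - a) := by
        refine (rpow_le_rpow_of_nonpos (mul_pos (exp_pos _) hmin) (hN x y)
          (by linarith)).trans (le_of_eq ?_)
        rw [mul_rpow (exp_pos _).le hmin.le, ← exp_mul]
        ring_nf
      have e2 : toMat W x y ^ a * min (toMat W x y) (L * q y) ^ (1 - a) ≤
          toMat W x y + L ^ (1 - b) * (toMat W x y ^ b * q y ^ (1 - b)) := by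
        have n1 : 0 ≤ L ^ (1 - b) * (toMat W x y ^ b * q y ^ (1 - b)) := by positivity
        rcases le_total (toMat W x y) (L * q y) with hle | hle
        · rw [min_eq_left hle, ← rpow_add h, add_sub_cancel, rpow_one]
          linarith
        · rw [min_eq_right hle]
          have e3 : toMat W x y ^ a * (L * q y) ^ (1 - a) ≤
              toMat W x y ^ b * (L * q y) ^ (1 - b) := by
            rw [rpow_mul_rpow_one_sub h hLq b a]
            refine le_mul_of_one_le_left (by positivity) ?_
            exact one_le_rpow (by rw [le_div_iff₀ hLq]; linarith) (by linarith)
          rw [mul_rpow hL.le hqy.le (z := 1 - b)] at e3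
          linarith
      calc toMat W x y ^ a * toMat N x y ^ (1 - a)
          ≤ toMat W x y ^ a *
            (exp (t * (a - 1)) * min (toMat W x y) (L * q y) ^ (1 - a)) := by gcongr
        _ = exp (t * (a - 1)) *
            (toMat W x y ^ a * min (toMat W x y) (L * q y) ^ (1 - a)) := by ring
        _ ≤ _ := by gcongr
  have hrow : ∀ x, ∑ y, toMat W x y ^ a * toMat N x y ^ (1 - a) ≤
      exp (t * (a - 1)) * (1 + L ^ (1 - b) * K) := by
    intro x
    calc _ ≤ ∑ y, exp (t * (a - 1)) *
          (toMat W x y + L ^ (1 - b) * (toMat W x y ^ b * q y ^ (1 - b))) :=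
          Finset.sum_le_sum fun y _ => hpt x y
      _ = exp (t * (a - 1)) *
          (1 + L ^ (1 - b) * ∑ y, toMat W x y ^ b * q y ^ (1 - b)) := by
          rw [← Finset.mul_sum, Finset.sum_add_distrib, (hW x).2, ← Finset.mul_sum]
      _ ≤ _ := by gcongr; exact hK x
  refine iSup_le fun P => renyiDiv_le_of_one_lt h1 hT (joint_ne_top _ _) (joint_ne_top _ _) ?_ ?_
  · rintro ⟨x, y⟩ h
    rw [joint_ne_zero_iff] at h ⊢
    exact mul_ne_zero (left_ne_zero_of_mul h) (hNpos x y
      (lt_of_le_of_ne ((hW x).1 y) (right_ne_zero_of_mul h).symm)).ne'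
  · rw [← haa, affinity_joint (by linarith)]
    have e : (t + L ^ (1 - b) * K / (a - 1)) / log 2 * log 2 * (a - 1) =
        t * (a - 1) + L ^ (1 - b) * K := by
      have : a - 1 ≠ 0 := by linarith
      field_simp
    rw [e, exp_add]
    calc ∑ x, ∑ y, toVec P x * (toMat W x y ^ a * toMat N x y ^ (1 - a))
        ≤ ∑ x, toVec P x * (exp (t * (a - 1)) * (1 + L ^ (1 - b) * K)) :=
          Finset.sum_le_sum fun x _ => by
            rw [← Finset.mul_sum]
            exact mul_le_mul_of_nonneg_left (hrow x) ((toVec_mem P).1 x)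
      _ = exp (t * (a - 1)) * (1 + L ^ (1 - b) * K) := by
          rw [← Finset.sum_mul, (toVec_mem P).2, one_mul]
      _ ≤ _ := by
          gcongr
          linarith [add_one_le_exp (L ^ (1 - b) * K)]

theorem eventually_exists_simulation [Nonempty X] {W : Channel X Y} {α β : ℝ≥0∞} (h1 : 1 < α)
    (hαβ : α ≤ β) (hT : β ≠ ∞) {r s e : ℝ} (hr : 0 ≤ r)
    (hs : ∀ P ∈ stdSimplex ℝ X, scaledInfo P (toMat W) β.toReal ≤ s)
    (he : e * log 2 < (β.toReal - 1) * (r * log 2) - s) :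
    ∀ᶠ n : ℕ in atTop, ∃ N : Channel (Fin n → X) (Fin n → Y),
      IsSimulation N (logb 2 (messageCount r n)) ∧
      channelDiv α (power W n) N ≤ ((exp (n * -(e * log 2)) : ℝ) : EReal) := by
  have h2 : 0 < log 2 := log_pos one_lt_two
  have hαT : α ≠ ∞ := ne_top_of_le_ne_top hT hαβ
  have ha := one_lt_toReal_of_one_lt h1 hαT
  have hab : α.toReal ≤ β.toReal := ENNReal.toReal_mono hT hαβ
  set a := α.toReal with haa
  set b := β.toReal with hbb
  have hW := toMat_mem W
  obtain ⟨t, hst, ht⟩ := exists_between (by linarith : s < (b - 1) * (r * log 2) - e * log 2)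
  obtain ⟨q, hq, hq0, hqle⟩ := exists_output_of_scaledInfo_lt hW (by linarith : 1 < b) hs hst
  have hexp2 := eventually_mul_exp_le
    (by linarith : t - (b - 1) * (r * log 2) < -(e * log 2)) (2 / ((a - 1) * log 2))
  filter_upwards [eventually_ne_atTop 0, hexp2,
    eventually_const_mul_exp_neg_sq_le (4 / log 2) (e * log 2) (by positivity)] with n hn hx1 hx2
  have hWn := prodMat_mem hW n
  have hqn := prodVec_mem hq n
  obtain ⟨N, hN, hNle⟩ := exists_simulation_of_le hn hr hqn
    (u := fun x y => min (prodMat (toMat W) n x y) (exp (n * (r * log 2)) * prodVec q n y))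
    (fun x y => le_min ((hWn x).1 y) (mul_nonneg (exp_pos _).le (hqn.1 y)))
    (fun x y => min_le_right _ _)
    (fun x => (Finset.sum_le_sum fun y _ => min_le_left _ _).trans (hWn x).2.le)
  refine ⟨N, hN, (channelDiv_le_of_truncation h1 hαT (b := b) (K := exp (n * t)) hab
    (exp_pos (n * (r * log 2))) (q := prodVec q n)
    (fun y => Finset.prod_pos fun i _ => hq0 (y i))
    (by simpa only [toMat_power] using hNle) ?_).trans ?_⟩
  · intro x
    rw [toMat_power]
    calc ∑ y, prodMat (toMat W) n x y ^ b * prodVec q n y ^ (1 - b)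
        = ∑ y, prodMat (fun x y => toMat W x y ^ b * q y ^ (1 - b)) n x y := by
          refine Finset.sum_congr rfl fun y _ => ?_
          simp only [prodMat, prodVec]
          rw [Finset.prod_mul_distrib, Real.finsetProd_rpow _ _ fun i _ => (hW (x i)).1 (y i),
            Real.finsetProd_rpow _ _ fun i _ => (hq0 (y i)).le]
      _ = ∏ i, ∑ y, toMat W (x i) y ^ b * q y ^ (1 - b) := sum_prodMat _ n x
      _ ≤ ∏ _i : Fin n, exp t := Finset.prod_le_prod (fun i _ => Finset.sum_nonneg fun y _ =>
          mul_nonneg (rpow_nonneg ((hW (x i)).1 y) _) (rpow_nonneg (hq0 y).le _))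
          fun i _ => hqle (x i)
      _ = exp (n * t) := by
          rw [Finset.prod_const, Finset.card_univ, Fintype.card_fin, ← exp_nat_mul]
  · rw [← haa, EReal.coe_le_coe_iff, ← exp_mul, ← exp_add]
    have e1 : (n : ℝ) * (r * log 2) * (1 - b) + n * t = n * (t - (b - 1) * (r * log 2)) := by ring
    rw [e1]
    set A := exp (n * (t - (b - 1) * (r * log 2)))
    set B := exp (-(n : ℝ) ^ 2)
    have h3 : a - 1 ≠ 0 := by linarith
    -- An average of two quantities each already below the target; this explains the constants `4`
    -- and `2` in the eventual bounds.
    have e2 : (2 * B + A / (a - 1)) / log 2 =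
        (4 / log 2 * B + 2 / ((a - 1) * log 2) * A) / 2 := by
      field_simp
      ring
    rw [e2]
    linarith

theorem channelDiv_le_channelDiv {α β : ℝ≥0∞} (h0 : 0 < α) (h1 : α ≤ 1) (hβ : 1 < β)
    (hT : β ≠ ∞) (W N : Channel X Y) : channelDiv α W N ≤ channelDiv β W N :=
  iSup_mono fun P =>
    (renyiDiv_le_renyiDiv_one (sum_joint P W) (joint_ne_top _ _) (joint_ne_top _ _) h0 h1).trans
      (renyiDiv_one_le_renyiDiv (sum_joint P W) (joint_ne_top _ _) (joint_ne_top _ _) hβ hT)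

/-- The exponent term of order `β`, in real numbers. -/
theorem exponent_term_eq {W : Channel X Y} {β : ℝ≥0∞} (h1 : 1 < β) (hT : β ≠ ∞) {r s : ℝ}
    (hs : capacity β W = ((s / ((β.toReal - 1) * log 2) : ℝ) : EReal)) :
    ((β : EReal) - 1) * ((r : EReal) - capacity β W) =
      ((((β.toReal - 1) * (r * log 2) - s) / log 2 : ℝ) : EReal) := by
  have hb := one_lt_toReal_of_one_lt h1 hT
  have hβ : (β : EReal) = ((β.toReal : ℝ) : EReal) := (EReal.coe_ennreal_toReal hT).symm
  rw [hs, hβ, ← EReal.coe_one, ← EReal.coe_sub, ← EReal.coe_sub, ← EReal.coe_mul]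
  congr 1
  have h2 : log 2 ≠ 0 := (log_pos one_lt_two).ne'
  have h3 : β.toReal - 1 ≠ 0 := by linarith
  field_simp

/-- Each finite order at least `α` contributes its term to the reliability. -/
theorem exponent_term_le_reliability [Nonempty X] {W : Channel X Y} {α β : ℝ≥0∞} {r : ℝ}
    (hr : 0 ≤ r) (h0 : 0 < α) (hαβ : α ≤ β) (h1 : 1 < β) (hT : β ≠ ∞) :
    ((β : EReal) - 1) * ((r : EReal) - capacity β W) ≤ reliability α W r := by
  have h2 : 0 < log 2 := log_pos one_lt_two
  obtain ⟨P, hP, hcap, hmax⟩ := exists_capacity_eq h1 hT W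
  rw [exponent_term_eq h1 hT hcap]
  refine EReal.ge_of_forall_gt_iff_ge.mp fun e he => ?_
  have he : e < ((β.toReal - 1) * (r * log 2) - scaledInfo P (toMat W) β.toReal) / log 2 := by
    exact_mod_cast he
  rw [lt_div_iff₀ h2] at he
  refine le_reliability _ (limsup_messageCount_le hr) ?_
  rcases lt_or_ge 1 α with hα | hα
  · exact eventually_exists_simulation hα hαβ hT hr hmax he
  -- For `α ≤ 1` the simulation is built for the order `β` itself and its divergence is compared
  -- through order one.
  · filter_upwards [eventually_exists_simulation h1 le_rfl hT hr hmax he] with n ⟨N, hN, hle⟩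
    exact ⟨N, hN, (channelDiv_le_channelDiv h0 hα h1 hT _ _).trans hle⟩

end Achievability

/-! ### Converse -/

section Converse

/-- With `T` the `p`-mass of `S`: the large ratio makes `S` contribute at most `a / 2 * T`, while
Hölder and Bernoulli bound the complement by `(1 - T) ^ a ≤ 1 - a * T`. -/
theorem sum_rpow_mul_rpow_le_of_tail {ι : Type*} [Fintype ι] {p q : ι → ℝ} (hp : ∀ i, 0 ≤ p i)
    (hq : ∀ i, 0 ≤ q i) (hp1 : ∑ i, p i = 1) (hq1 : ∑ i, q i = 1) (S : Finset ι) {κ a : ℝ}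
    (hκ : 0 < κ) (hS : ∀ i ∈ S, κ * q i ≤ p i) (ha0 : 0 < a) (ha1 : a < 1)
    (hκa : κ ^ (a - 1) ≤ a / 2) :
    ∑ i, p i ^ a * q i ^ (1 - a) ≤ 1 - a / 2 * ∑ i ∈ S, p i := by
  classical
  set T := ∑ i ∈ S, p i with hT
  have hsplit : T + ∑ i ∈ Sᶜ, p i = 1 := by rw [hT, Finset.sum_add_sum_compl, hp1]
  have hT0 : 0 ≤ T := Finset.sum_nonneg fun i _ => hp i
  have hT1 : T ≤ 1 := by
    have : 0 ≤ ∑ i ∈ Sᶜ, p i := Finset.sum_nonneg fun i _ => hp i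
    linarith
  have h1 : ∑ i ∈ S, p i ^ a * q i ^ (1 - a) ≤ a / 2 * T := by
    calc ∑ i ∈ S, p i ^ a * q i ^ (1 - a) ≤ ∑ i ∈ S, κ ^ (a - 1) * p i := by
          refine Finset.sum_le_sum fun i hi => ?_
          have h2 : q i ^ (1 - a) ≤ (κ⁻¹ * p i) ^ (1 - a) := by
            refine rpow_le_rpow (hq i) ?_ (by linarith)
            rw [inv_mul_eq_div, le_div_iff₀ hκ, mul_comm]
            exact hS i hi
          have hpi := hp i
          calc p i ^ a * q i ^ (1 - a) ≤ p i ^ a * (κ⁻¹ * p i) ^ (1 - a) := by gcongr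
            _ = κ ^ (a - 1) * p i := by
              rcases hpi.eq_or_lt with h | h
              · rw [← h, zero_rpow ha0.ne']; simp
              · rw [mul_rpow (by positivity) h.le, inv_rpow hκ.le, ← rpow_neg hκ.le, neg_sub,
                  mul_left_comm, ← rpow_add h]
                simp
      _ = κ ^ (a - 1) * T := by rw [hT, Finset.mul_sum]
      _ ≤ _ := by gcongr
  have h2 : ∑ i ∈ Sᶜ, p i ^ a * q i ^ (1 - a) ≤ 1 - a * T := by
    calc ∑ i ∈ Sᶜ, p i ^ a * q i ^ (1 - a)
        ≤ (∑ i ∈ Sᶜ, p i) ^ a * (∑ i ∈ Sᶜ, q i) ^ (1 - a) :=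
          sum_rpow_mul_rpow_le _ (fun i _ => hp i) (fun i _ => hq i) ha0 ha1
      _ ≤ (1 - T) ^ a * 1 := by
          have e : ∑ i ∈ Sᶜ, p i = 1 - T := by linarith
          rw [e]
          refine mul_le_mul_of_nonneg_left ?_ (rpow_nonneg (by linarith) _)
          refine rpow_le_one (Finset.sum_nonneg fun i _ => hq i) ?_ (by linarith)
          rw [← hq1]
          exact Finset.sum_le_univ_sum_of_nonneg hq
      _ ≤ 1 - a * T := by
          have := rpow_one_add_le_one_add_mul_self (by linarith : -1 ≤ -T) ha0.le ha1.le
          rw [mul_one]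
          calc (1 - T) ^ a = (1 + -T) ^ a := by ring_nf
            _ ≤ 1 + a * -T := this
            _ = _ := by ring
  rw [← Finset.sum_add_sum_compl S]
  linarith

/-- The counterpart above one: reverse Hölder and Bernoulli leave at least `1 - a * T` off `S`, and
on `S` the large ratio makes the moment at least `2 * a * T`, so half of it pays for the loss. -/
theorem le_sum_rpow_mul_rpow_of_tail {ι : Type*} [Fintype ι] {p q : ι → ℝ} (hp : ∀ i, 0 ≤ p i)
    (hq : ∀ i, 0 ≤ q i) (hp1 : ∑ i, p i = 1) (hq1 : ∑ i, q i = 1)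
    (hpq : ∀ i, p i ≠ 0 → q i ≠ 0) (S : Finset ι) {κ a : ℝ}
    (hκ : 0 < κ) (hS : ∀ i ∈ S, κ * q i ≤ p i) (ha : 1 < a) (hκa : a * κ ^ (1 - a) ≤ 1 / 2) :
    1 + (∑ i ∈ S, p i ^ a * q i ^ (1 - a)) / 2 ≤ ∑ i, p i ^ a * q i ^ (1 - a) := by
  classical
  set T := ∑ i ∈ S, p i with hT
  set A := ∑ i ∈ S, p i ^ a * q i ^ (1 - a) with hA
  have hsplit : T + ∑ i ∈ Sᶜ, p i = 1 := by rw [hT, Finset.sum_add_sum_compl, hp1]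
  have hT1 : T ≤ 1 := by
    have : 0 ≤ ∑ i ∈ Sᶜ, p i := Finset.sum_nonneg fun i _ => hp i
    linarith
  have hA0 : 0 ≤ A := Finset.sum_nonneg fun i _ =>
    mul_nonneg (rpow_nonneg (hp i) _) (rpow_nonneg (hq i) _)
  have h1 : T ≤ κ ^ (1 - a) * A := by
    rw [hT, hA, Finset.mul_sum]
    refine Finset.sum_le_sum fun i hi => ?_
    rcases (hp i).eq_or_lt with h | h
    · rw [← h, zero_rpow (by linarith)]; simp
    · have hqi : 0 < q i := lt_of_le_of_ne (hq i) (hpq i h.ne').symm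
      have h2 : κ ^ (a - 1) ≤ (p i / q i) ^ (a - 1) :=
        rpow_le_rpow hκ.le (by rw [le_div_iff₀ hqi]; exact hS i hi) (by linarith)
      have h3 : p i ^ a * q i ^ (1 - a) = (p i / q i) ^ (a - 1) * p i := by
        rw [rpow_mul_rpow_one_sub h hqi a 1]; simp
      have h4 : κ ^ (1 - a) * κ ^ (a - 1) = 1 := by rw [← rpow_add hκ]; simp
      calc p i = κ ^ (1 - a) * (κ ^ (a - 1) * p i) := by rw [← mul_assoc, h4, one_mul]
        _ ≤ κ ^ (1 - a) * ((p i / q i) ^ (a - 1) * p i) := by gcongr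
        _ = _ := by rw [h3]
  have h2 : 1 - a * T ≤ ∑ i ∈ Sᶜ, p i ^ a * q i ^ (1 - a) := by
    have h3 := one_add_mul_self_le_rpow_one_add (by linarith : -1 ≤ -T) ha.le
    have h4 := rpow_sum_le_sum_rpow_mul_rpow Sᶜ (p := p) (q := q) (b := a) (fun i _ => hp i)
      (fun i _ => hq i) (fun i _ => hpq i) ha.le
      (by rw [← hq1]; exact Finset.sum_le_univ_sum_of_nonneg hq)
    have e : ∑ i ∈ Sᶜ, p i = 1 + -T := by linarith
    rw [e] at h4
    linarith
  have h5 : a * T ≤ A / 2 := by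
    calc a * T ≤ a * (κ ^ (1 - a) * A) := by gcongr
      _ = a * κ ^ (1 - a) * A := by ring
      _ ≤ 1 / 2 * A := by gcongr
      _ = _ := by ring
  rw [← Finset.sum_add_sum_compl S]
  linarith

variable {X Y : Type*} [Fintype X] [Fintype Y]

/-- Since `N ≤ B`, the ratio `W / N` exceeds `κ` on the tail set. The trivial powers `1` and `1 - 1`
match `eventually_exp_le_sum_tail` at order one. -/
theorem affinity_le_of_tail {P : PMF X} {W N : Channel X Y} {B : Y → ℝ} {κ a T : ℝ}
    (hNB : ∀ x y, toMat N x y ≤ B y) (hκ : 0 < κ) (ha0 : 0 < a) (ha1 : a < 1)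
    (hκa : κ ^ (a - 1) ≤ a / 2)
    (hT : T ≤ ∑ x, ∑ y, if κ * B y < toMat W x y then
      toVec P x * (toMat W x y ^ (1 : ℝ) * B y ^ (1 - 1 : ℝ)) else 0) :
    affinity a (joint P W) (joint P N) ≤ 1 - a / 2 * T := by
  classical
  have h := sum_rpow_mul_rpow_le_of_tail (p := fun z => (joint P W z).toReal)
    (q := fun z => (joint P N z).toReal) (fun _ => ENNReal.toReal_nonneg)
    (fun _ => ENNReal.toReal_nonneg) (sum_toReal_eq_one (sum_joint P W))
    (sum_toReal_eq_one (sum_joint P N))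
    (Finset.univ.filter fun z : X × Y => κ * B z.2 < toMat W z.1 z.2) hκ (by
      rintro ⟨x, y⟩ hz
      have hz : κ * B y < toMat W x y := by simpa using hz
      simp only [toReal_joint]
      have hP := (toVec_mem P).1 x
      calc κ * (toVec P x * toMat N x y) = toVec P x * (κ * toMat N x y) := by ring
        _ ≤ toVec P x * (κ * B y) := by gcongr; exact hNB x y
        _ ≤ _ := by gcongr) ha0 ha1 hκa
  refine h.trans ?_
  rw [Finset.sum_filter, Fintype.sum_prod_type]
  have : T ≤ ∑ x, ∑ y, if κ * B y < toMat W x y then (joint P W (x, y)).toReal else 0 := by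
    refine hT.trans (le_of_eq ?_)
    refine Finset.sum_congr rfl fun x _ => Finset.sum_congr rfl fun y _ => ?_
    simp [toReal_joint]
  have := mul_le_mul_of_nonneg_left this (by positivity : 0 ≤ a / 2)
  linarith

/-- Besides giving a large ratio on the tail set, `N ≤ B` yields `B ^ (1 - a) ≤ N ^ (1 - a)`, so the
tail moment against `B` bounds the one against `N` from below. -/
theorem le_affinity_of_tail {P : PMF X} {W N : Channel X Y} {B : Y → ℝ} {κ a T : ℝ}
    (hB : ∀ y, 0 < B y) (hNB : ∀ x y, toMat N x y ≤ B y) (hκ : 0 < κ) (ha : 1 < a)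
    (hκa : a * κ ^ (1 - a) ≤ 1 / 2) (hpq : ∀ z, joint P W z ≠ 0 → joint P N z ≠ 0)
    (hT : T ≤ ∑ x, ∑ y, if κ * B y < toMat W x y then
      toVec P x * (toMat W x y ^ a * B y ^ (1 - a)) else 0) :
    1 + T / 2 ≤ affinity a (joint P W) (joint P N) := by
  classical
  have h := le_sum_rpow_mul_rpow_of_tail (p := fun z => (joint P W z).toReal)
    (q := fun z => (joint P N z).toReal) (fun _ => ENNReal.toReal_nonneg)
    (fun _ => ENNReal.toReal_nonneg) (sum_toReal_eq_one (sum_joint P W))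
    (sum_toReal_eq_one (sum_joint P N))
    (fun z hz => (ENNReal.toReal_ne_zero).mpr
      ⟨hpq z (ENNReal.toReal_ne_zero.mp hz).1, joint_ne_top _ _ _⟩)
    (Finset.univ.filter fun z : X × Y => κ * B z.2 < toMat W z.1 z.2) hκ (by
      rintro ⟨x, y⟩ hz
      have hz : κ * B y < toMat W x y := by simpa using hz
      simp only [toReal_joint]
      have hP := (toVec_mem P).1 x
      calc κ * (toVec P x * toMat N x y) = toVec P x * (κ * toMat N x y) := by ring
        _ ≤ toVec P x * (κ * B y) := by gcongr; exact hNB x y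
        _ ≤ _ := by gcongr) ha hκa
  refine le_trans ?_ h
  rw [Finset.sum_filter, Fintype.sum_prod_type]
  have : T ≤ ∑ x, ∑ y, if κ * B y < toMat W x y then
      (joint P W (x, y)).toReal ^ a * (joint P N (x, y)).toReal ^ (1 - a) else 0 := by
    refine hT.trans (Finset.sum_le_sum fun x _ => Finset.sum_le_sum fun y _ => ?_)
    split_ifs with hz
    · have hBy := hB y
      have hw : 0 < toMat W x y := lt_trans (by positivity) hz
      rw [toReal_joint, toReal_joint]
      rcases ((toVec_mem P).1 x).eq_or_lt with hP | hP
      · rw [← hP]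
        simp [zero_rpow (by linarith : a ≠ 0)]
      · have hN : 0 < toMat N x y := by
          refine lt_of_le_of_ne ((toMat_mem N x).1 y) (Ne.symm ?_)
          have := hpq (x, y) ((joint_ne_zero_iff P W x y).mpr (mul_pos hP hw).ne')
          exact right_ne_zero_of_mul ((joint_ne_zero_iff P N x y).mp this)
        have h1 : B y ^ (1 - a) ≤ toMat N x y ^ (1 - a) :=
          rpow_le_rpow_of_nonpos hN (hNB x y) (by linarith)
        have e : toVec P x ^ a * toVec P x ^ (1 - a) = toVec P x := by
          rw [← rpow_add hP]; simp
        rw [mul_rpow hP.le hw.le, mul_rpow hP.le hN.le]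
        calc toVec P x * (toMat W x y ^ a * B y ^ (1 - a))
            ≤ toVec P x * (toMat W x y ^ a * toMat N x y ^ (1 - a)) := by gcongr
          _ = (toVec P x ^ a * toVec P x ^ (1 - a)) *
              (toMat W x y ^ a * toMat N x y ^ (1 - a)) := by rw [e]
          _ = _ := by ring
    · exact le_rfl
  linarith

/-- Lower bound on the divergence of every simulation at rate `r₁`, from one input distribution
that controls all orders at rate `r₂ > r₁`: orders below one. -/
theorem eventually_le_channelDiv_of_lt_one {W : Channel X Y} {α : ℝ≥0∞} (h0 : 0 < α) (h1 : α < 1)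
    {P : X → ℝ} (hP : P ∈ stdSimplex ℝ X) {r₁ r₂ C ε : ℝ} (hr : r₁ < r₂) (hε : 0 < ε)
    (hC : ∀ b, 1 ≤ b → (b - 1) * (r₂ * log 2) - scaledInfo P (toMat W) b ≤ C * log 2) :
    ∀ᶠ n : ℕ in atTop, ∀ N : Channel (Fin n → X) (Fin n → Y), IsSimulation N (n * r₁) →
      ((exp (n * -((C + ε) * log 2)) : ℝ) : EReal) ≤ channelDiv α (power W n) N := by
  have h2 : 0 < log 2 := log_pos one_lt_two
  have ha1 := toReal_lt_one_of_lt_one h1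
  have ha0 : 0 < α.toReal := ENNReal.toReal_pos h0.ne' h1.ne_top
  set a := α.toReal with haa
  have h1a : 0 < 1 - a := by linarith
  -- Taken at order one, where the tail sum is a plain probability: below order one the exponent
  -- does not depend on `α`.
  obtain ⟨δ, hδ, htail⟩ := eventually_exp_le_sum_tail hP (toMat_mem W) le_rfl
    (mul_lt_mul_of_pos_right hr h2) hC (by positivity : 0 < ε / 2 * log 2)
  have hlt : -((C + ε) * log 2) < -(C * log 2 + ε / 2 * log 2) := by nlinarith
  filter_upwards [htail, eventually_mul_exp_le (by nlinarith : δ * (a - 1) < 0) (2 / a),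
    eventually_mul_exp_le hlt (2 * (1 - a) * log 2 / a)] with n htail hκ hexp N hN
  obtain ⟨Q, hQ, hNQ⟩ := hN.exists_le
  obtain ⟨B, -, hQB, hT⟩ := htail Q hQ
  rw [mul_assoc] at hNQ
  have hκa : exp (n * δ) ^ (a - 1) ≤ a / 2 := by
    rw [← exp_mul, mul_assoc]
    rw [mul_zero, exp_zero] at hκ
    rw [le_div_iff₀ two_pos]
    calc _ = a * (2 / a * exp (n * (δ * (a - 1)))) := by field_simp
      _ ≤ a * 1 := by gcongr
      _ = a := mul_one a
  set T := exp (n * -(C * log 2 + ε / 2 * log 2)) with hTdef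
  refine le_iSup_of_le (ofVec _ (prodVec_mem hP n)) (le_renyiDiv_of_lt_one h0 h1
    (joint_ne_top _ _) (joint_ne_top _ _) ?_)
  have haff := affinity_le_of_tail (P := ofVec _ (prodVec_mem hP n)) (W := power W n) (N := N)
    (fun x y => (hNQ x y).trans (hQB y)) (exp_pos (n * δ)) ha0 ha1 hκa
    (by simpa only [toMat_power, toVec_ofVec] using hT)
  refine haff.trans ?_
  have h3 := add_one_le_exp (-(a / 2 * T))
  have h4 : exp (n * -((C + ε) * log 2)) * log 2 * (1 - a) ≤ a / 2 * T := by
    calc _ = a / 2 * (2 * (1 - a) * log 2 / a * exp (n * -((C + ε) * log 2))) := by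
          field_simp
      _ ≤ _ := by gcongr
  calc 1 - a / 2 * T ≤ exp (-(a / 2 * T)) := by linarith
    _ ≤ _ := exp_le_exp.mpr (by linarith)

theorem eventually_le_channelDiv_of_one_lt {W : Channel X Y} {α : ℝ≥0∞} (h1 : 1 < α) (hT : α ≠ ∞)
    {P : X → ℝ} (hP : P ∈ stdSimplex ℝ X) {r₁ r₂ C ε : ℝ} (hr : r₁ < r₂) (hε : 0 < ε)
    (hC0 : 0 ≤ C)
    (hC : ∀ b, α.toReal ≤ b →
      (b - 1) * (r₂ * log 2) - scaledInfo P (toMat W) b ≤ C * log 2) :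
    ∀ᶠ n : ℕ in atTop, ∀ N : Channel (Fin n → X) (Fin n → Y), IsSimulation N (n * r₁) →
      ((exp (n * -((C + ε) * log 2)) : ℝ) : EReal) ≤ channelDiv α (power W n) N := by
  have h2 : 0 < log 2 := log_pos one_lt_two
  have ha := one_lt_toReal_of_one_lt h1 hT
  set a := α.toReal with haa
  have h1a : 0 < a - 1 := by linarith
  obtain ⟨δ, hδ, htail⟩ := eventually_exp_le_sum_tail hP (toMat_mem W) ha.le
    (mul_lt_mul_of_pos_right hr h2) hC (by positivity : 0 < ε / 2 * log 2)
  have hlt : -((C + ε) * log 2) < -(C * log 2 + ε / 2 * log 2) := by nlinarith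
  filter_upwards [htail, eventually_mul_exp_le (by nlinarith : δ * (1 - a) < 0) (2 * a),
    eventually_mul_exp_le hlt (4 * (a - 1) * log 2)] with n htail hκ hexp N hN
  obtain ⟨Q, hQ, hNQ⟩ := hN.exists_le
  obtain ⟨B, hB, hQB, hT'⟩ := htail Q hQ
  rw [mul_assoc] at hNQ
  have hκa : a * exp (n * δ) ^ (1 - a) ≤ 1 / 2 := by
    rw [← exp_mul, mul_assoc (n : ℝ)]
    rw [mul_zero, exp_zero] at hκ
    linarith
  set T := exp (n * -(C * log 2 + ε / 2 * log 2)) with hTdef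
  -- This is where `0 ≤ C` enters: `exp (T / 4) ≤ 1 + T / 2` needs `T` bounded.
  have hT1 : T ≤ 1 := by
    rw [hTdef, exp_le_one_iff]
    have : 0 ≤ C * log 2 + ε / 2 * log 2 := by positivity
    have : (0 : ℝ) ≤ n := Nat.cast_nonneg n
    nlinarith
  have hT0 : 0 < T := exp_pos _
  refine le_iSup_of_le (ofVec _ (prodVec_mem hP n)) (le_renyiDiv_of_one_lt h1 hT
    (joint_ne_top _ _) (joint_ne_top _ _) fun hpq => ?_)
  have haff := le_affinity_of_tail (P := ofVec _ (prodVec_mem hP n)) (W := power W n) (N := N) hB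
    (fun x y => (hNQ x y).trans (hQB y)) (exp_pos (n * δ)) ha hκa hpq
    (by simpa only [toMat_power, toVec_ofVec] using hT')
  refine le_trans ?_ haff
  have h3 : exp (T / 4) ≤ 1 + T / 2 := by
    have := Real.abs_exp_sub_one_le (x := T / 4) (by rw [abs_of_pos (by positivity)]; linarith)
    rw [abs_of_pos (by positivity : 0 < T / 4)] at this
    linarith [le_abs_self (exp (T / 4) - 1)]
  refine le_trans (exp_le_exp.mpr ?_) h3
  linarith

theorem eventually_le_channelDiv {W : Channel X Y} {α : ℝ≥0∞} (h0 : 0 < α) (hT : α ≠ ∞)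
    {P : X → ℝ} (hP : P ∈ stdSimplex ℝ X) {r₁ r₂ C ε : ℝ} (hr : r₁ < r₂) (hε : 0 < ε)
    (hC0 : 0 ≤ C)
    (hC : ∀ b, max α.toReal 1 ≤ b →
      (b - 1) * (r₂ * log 2) - scaledInfo P (toMat W) b ≤ C * log 2) :
    ∀ᶠ n : ℕ in atTop, ∀ N : Channel (Fin n → X) (Fin n → Y), IsSimulation N (n * r₁) →
      ((exp (n * -((C + ε) * log 2)) : ℝ) : EReal) ≤ channelDiv α (power W n) N := by
  rcases lt_trichotomy α 1 with h1 | rfl | h1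
  · rw [max_eq_right (toReal_lt_one_of_lt_one h1).le] at hC
    exact eventually_le_channelDiv_of_lt_one h0 h1 hP hr hε hC
  · rw [ENNReal.toReal_one, max_self] at hC
    -- Order one borrows the bound of order one half, which has the same exponent and a smaller
    -- divergence.
    have hhalf : (0 : ℝ≥0∞) < 2⁻¹ := ENNReal.inv_pos.mpr ENNReal.ofNat_ne_top
    filter_upwards [eventually_le_channelDiv_of_lt_one hhalf ENNReal.one_half_lt_one hP hr hε
      hC] with n h N hN
    exact (h N hN).trans (iSup_mono fun P => renyiDiv_le_renyiDiv_one (sum_joint P _)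
      (joint_ne_top _ _) (joint_ne_top _ _) hhalf ENNReal.one_half_lt_one.le)
  · rw [max_eq_left (one_lt_toReal_of_one_lt h1 hT).le] at hC
    exact eventually_le_channelDiv_of_one_lt h1 hT hP hr hε hC0 hC

/-- Below the order-infinity capacity the exponent terms stay bounded at some larger rate. -/
theorem exists_scaledInfo_ge [Nonempty X] {W : Channel X Y} {r : ℝ}
    (h : (r : EReal) < capacity ∞ W) :
    ∃ P ∈ stdSimplex ℝ X, ∃ r' > r, ∃ C : ℝ, ∀ b, 0 < b →
      (b - 1) * (r' * log 2) - scaledInfo P (toMat W) b ≤ C := by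
  have h2 : 0 < log 2 := log_pos one_lt_two
  obtain ⟨P, hP, ξ, hξ, hs⟩ := exists_input_of_lt_capacity_top h
  have hY : Nonempty Y :=
    ⟨(exists_pos_of_mem_stdSimplex (toMat_mem W (Classical.arbitrary X))).choose⟩
  obtain ⟨y₀, hy₀⟩ := Finite.exists_min fun y => P (ξ y)
  set s := ∑ y, toMat W (ξ y) y with hsdef
  have hs0 : 0 < s := lt_trans (exp_pos _) hs
  refine ⟨P, hP, log s / log 2, ?_, -log s - log (P (ξ y₀)), fun b hb => ?_⟩
  · rwa [gt_iff_lt, lt_div_iff₀ h2, lt_log_iff_exp_lt hs0]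
  · have h3 := le_scaledInfo_of_column hP (toMat_mem W) (hξ y₀) hy₀ hs0 hb
    rw [div_mul_cancel₀ _ h2.ne']
    linarith

/-- A uniform bound on the exponent terms bounds the reliability function. -/
theorem reliability_le_of_forall_term_le [Nonempty X] {W : Channel X Y} {α : ℝ≥0∞} (h0 : 0 < α)
    (hT : α ≠ ∞) {r C : ℝ} (hr : (r : EReal) < capacity ∞ W) (hC0 : 0 ≤ C)
    (h : ∀ β : ℝ≥0∞, α ≤ β → 1 < β → β ≠ ∞ →
      ((β : EReal) - 1) * ((r : EReal) - capacity β W) ≤ (C : EReal)) :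
    reliability α W r ≤ (C : EReal) := by
  have h2 : 0 < log 2 := log_pos one_lt_two
  refine EReal.le_of_forall_lt_iff_le.mp fun C' hC' => ?_
  have hC' : C < C' := by exact_mod_cast hC'
  obtain ⟨C₂, hCC₂, hC₂⟩ := exists_between hC'
  obtain ⟨P₀, hP₀, r₃, hr₃, C₃, hP₀C⟩ := exists_scaledInfo_ge hr
  -- The exponent is affine in the rate. Mixing the bound `C` at `r` with a little of the bound at
  -- `r₃ > r` gives a rate `r₂ > r` with a bound barely above `C`.
  obtain ⟨t, ht0, ht1, ht⟩ : ∃ t : ℝ, 0 < t ∧ t ≤ 1 ∧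
      (1 - t) * (C * log 2) + t * C₃ ≤ C₂ * log 2 := by
    set k := |C₃ - C * log 2| + 1 with hk
    have hk0 : 0 < k := by positivity
    have hC₂' : 0 < (C₂ - C) * log 2 := mul_pos (by linarith) h2
    refine ⟨min 1 ((C₂ - C) * log 2 / k), lt_min one_pos (by positivity), min_le_left _ _, ?_⟩
    set t := min 1 ((C₂ - C) * log 2 / k) with ht
    have h3 : t * k ≤ (C₂ - C) * log 2 := by
      rw [← le_div_iff₀ hk0]; exact min_le_right _ _
    have ht0 : 0 ≤ t := le_min zero_le_one (by positivity)
    have h4 : C₃ - C * log 2 ≤ k := (le_abs_self _).trans (by linarith)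
    have h5 : t * (C₃ - C * log 2) ≤ t * k := by gcongr
    linarith
  set r₂ := (1 - t) * r + t * r₃ with hr₂
  have hrr₂ : r < r₂ := by rw [hr₂]; nlinarith
  obtain ⟨P, hP, hPle⟩ := exists_input_forall_order (toMat_mem W) (r := r₂ * log 2)
    (C := C₂ * log 2) (le_max_right α.toReal 1) (by
      intro b hb
      have hb1 : 1 ≤ b := (le_max_right _ _).trans hb
      rcases hb1.eq_or_lt with rfl | hb1
      · refine ⟨P₀, hP₀, ?_⟩
        rw [scaledInfo_one hP₀ (toMat_mem W)]
        have : 0 ≤ C₂ * log 2 := mul_nonneg (by linarith) h2.le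
        linarith
      have hb0 : 0 ≤ b := by linarith
      have hβ1 : 1 < ENNReal.ofReal b := by
        rw [← ENNReal.ofReal_one]
        exact (ENNReal.ofReal_lt_ofReal_iff (by linarith)).mpr hb1
      have hβT : ENNReal.ofReal b ≠ ∞ := ENNReal.ofReal_ne_top
      have hαβ : α ≤ ENNReal.ofReal b := by
        rw [ENNReal.le_ofReal_iff_toReal_le hT hb0]
        exact (le_max_left _ _).trans hb
      obtain ⟨P, hP, hcap, hmax⟩ := exists_capacity_eq hβ1 hβT W
      have h3 := h _ hαβ hβ1 hβT
      rw [exponent_term_eq hβ1 hβT hcap, EReal.coe_le_coe_iff, div_le_iff₀ h2] at h3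
      rw [ENNReal.toReal_ofReal hb0] at h3 hmax
      refine ⟨P, hP, le_trans ?_ ht⟩
      -- The maximiser at order `b` has at least the information of `P₀`, so it inherits the bound
      -- at `r₃`.
      have h4 := (sub_le_sub_left (hmax P₀ hP₀) ((b - 1) * (r₃ * log 2))).trans
        (hP₀C b (by linarith))
      have h5 := mul_le_mul_of_nonneg_left h3 (by linarith : 0 ≤ 1 - t)
      have h6 := mul_le_mul_of_nonneg_left h4 ht0.le
      calc (b - 1) * (r₂ * log 2) - scaledInfo P (toMat W) b
          = (1 - t) * ((b - 1) * (r * log 2) - scaledInfo P (toMat W) b) +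
            t * ((b - 1) * (r₃ * log 2) - scaledInfo P (toMat W) b) := by rw [hr₂]; ring
        _ ≤ _ := by linarith)
  obtain ⟨r₁, hr₁, hr₁₂⟩ := exists_between hrr₂
  refine reliability_le hr₁ ?_
  have := eventually_le_channelDiv (ε := C' - C₂) h0 hT hP hr₁₂ (by linarith) (by linarith) hPle
  simpa using this

/-! ### Non-decay at orders infinity and zero -/

theorem eventually_exp_le_const {e d : ℝ} (he : 0 < e) (hd : 0 < d) :
    ∀ᶠ n : ℕ in atTop, exp (n * -(e * log 2)) ≤ d := by
  have h2 : 0 < log 2 := log_pos one_lt_two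
  filter_upwards [eventually_mul_exp_le (by nlinarith : -(e * log 2) < 0) d⁻¹] with n hn
  rw [mul_zero, exp_zero, inv_mul_eq_div, div_le_one hd] at hn
  exact hn

/-- Below the order-infinity capacity, the order-infinity error does not decay. -/
theorem reliability_top_le_zero [Nonempty X] {W : Channel X Y} {r : ℝ}
    (h : (r : EReal) < capacity ∞ W) : reliability ∞ W r ≤ 0 := by
  have h2 : 0 < log 2 := log_pos one_lt_two
  obtain ⟨P, hP, ξ, hξ, hs⟩ := exists_input_of_lt_capacity_top h
  set s := ∑ y, toMat W (ξ y) y with hsdef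
  have hs0 : 0 < s := lt_trans (exp_pos _) hs
  have hrs : r < log s / log 2 := by rwa [lt_div_iff₀ h2, lt_log_iff_exp_lt hs0]
  obtain ⟨r₁, hr₁, hr₁s⟩ := exists_between hrs
  obtain ⟨r₂, hr₁₂, hr₂s⟩ := exists_between hr₁s
  rw [lt_div_iff₀ h2, lt_log_iff_exp_lt hs0] at hr₂s
  refine EReal.le_of_forall_lt_iff_le.mp fun e he => reliability_le hr₁ ?_
  have he : 0 < e := by exact_mod_cast he
  filter_upwards [eventually_exp_le_const he (by linarith : 0 < r₂ - r₁),
    eventually_ne_atTop 0] with n hexp hn N hN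
  have hn1 : (1 : ℝ) ≤ n := by exact_mod_cast Nat.one_le_iff_ne_zero.mpr hn
  have hexp' : ((exp (n * -(e * log 2)) : ℝ) : EReal) ≤ ((r₂ - r₁ : ℝ) : EReal) := by
    exact_mod_cast hexp
  refine hexp'.trans (le_iSup_of_le (ofVec _ (prodVec_mem hP n)) ?_)
  by_contra! hlt
  have hle := renyiDiv_le_coe.mp hlt.le
  rw [le_fidelity_top_joint (exp_pos _).le, toVec_ofVec, toMat_power] at hle
  obtain ⟨q, hq, hNq⟩ := hN.exists_le
  -- For each output word the input is the word of column maximisers; summing over `y` gives `s ^ n`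
  -- against `exp (n * r₁ * log 2)`, impossible if the divergence were below `r₂ - r₁`.
  have h3 : ∀ y : Fin n → Y, exp (-(r₂ - r₁) * log 2) * prodVec (fun y => toMat W (ξ y) y) n y ≤
      exp (n * r₁ * log 2) * q y := fun y =>
    (hle (fun i => ξ (y i)) y (Finset.prod_pos fun i _ => hξ (y i)).ne').trans (hNq _ y)
  have h4 : exp (-(r₂ - r₁) * log 2) * s ^ n ≤ exp (n * r₁ * log 2) := by
    have := Finset.sum_le_sum fun y (_ : y ∈ Finset.univ) => h3 y
    rwa [← Finset.mul_sum, ← Finset.mul_sum, sum_prodVec, hq.2, mul_one] at this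
  have h5 : exp (n * (r₂ * log 2)) < s ^ n := by
    rw [exp_nat_mul]
    exact pow_lt_pow_left₀ hr₂s (exp_pos _).le hn
  have h6 : exp (-(r₂ - r₁) * log 2) * exp (n * (r₂ * log 2)) < exp (n * r₁ * log 2) :=
    lt_of_lt_of_le (mul_lt_mul_of_pos_left h5 (exp_pos _)) h4
  rw [← exp_add, exp_lt_exp] at h6
  have h7 : 0 ≤ (n - 1) * ((r₂ - r₁) * log 2) :=
    mul_nonneg (by linarith) (mul_nonneg (by linarith) h2.le)
  linarith

/-- Below the order-zero capacity, the order-zero error does not decay. -/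
theorem reliability_zero_le_zero {W : Channel X Y} {r : ℝ}
    (h : (r : EReal) < capacity 0 W) : reliability 0 W r ≤ 0 := by
  classical
  have h2 : 0 < log 2 := log_pos one_lt_two
  obtain ⟨r₂, hr₂, P, hP, hPle⟩ := exists_input_of_lt_capacity_zero h
  obtain ⟨r₁, hr₁, hr₁₂⟩ := exists_between hr₂
  refine EReal.le_of_forall_lt_iff_le.mp fun e he => reliability_le hr₁ ?_
  have he : 0 < e := by exact_mod_cast he
  filter_upwards [eventually_exp_le_const he (by linarith : 0 < r₂ - r₁),
    eventually_ne_atTop 0] with n hexp hn N hN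
  have hn1 : (1 : ℝ) ≤ n := by exact_mod_cast Nat.one_le_iff_ne_zero.mpr hn
  have hexp' : ((exp (n * -(e * log 2)) : ℝ) : EReal) ≤ ((r₂ - r₁ : ℝ) : EReal) := by
    exact_mod_cast hexp
  refine hexp'.trans (le_iSup_of_le (ofVec _ (prodVec_mem hP n)) ?_)
  rw [coe_le_renyiDiv, fidelity_zero_joint, toVec_ofVec, toMat_power]
  refine ENNReal.ofReal_le_ofReal ?_
  obtain ⟨q, hq, hNq⟩ := hN.exists_le
  have hPn := prodVec_mem hP n
  -- The inputs able to produce a given output word have probability at most `2 ^ (-n r₂)`, by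
  -- independence. Domination by `2 ^ (n r₁) q` then caps the fidelity.
  have hcol : ∀ y : Fin n → Y,
      ∑ x, prodVec P n x * (if prodMat (toMat W) n x y = 0 then 0 else 1) ≤
        exp (n * (-r₂ * log 2)) := by
    intro y
    calc ∑ x, prodVec P n x * (if prodMat (toMat W) n x y = 0 then 0 else 1)
        = ∑ x : Fin n → X, ∏ i, P (x i) * (if toMat W (x i) (y i) = 0 then 0 else 1) := by
          refine Finset.sum_congr rfl fun x _ => ?_
          rw [Finset.prod_mul_distrib, prodVec]
          congr 1
          by_cases h0 : prodMat (toMat W) n x y = 0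
          · obtain ⟨i, _, hi⟩ := Finset.prod_eq_zero_iff.mp h0
            rw [if_pos h0, Finset.prod_eq_zero (Finset.mem_univ i) (by rw [if_pos hi])]
          · rw [if_neg h0]
            refine (Finset.prod_eq_one fun i _ => ?_).symm
            exact if_neg (Finset.prod_ne_zero_iff.mp h0 i (Finset.mem_univ i))
      _ = ∏ i, ∑ x, P x * (if toMat W x (y i) = 0 then 0 else 1) :=
          (Fintype.prod_sum fun i x => P x * (if toMat W x (y i) = 0 then 0 else 1)).symm
      _ ≤ ∏ _i : Fin n, exp (-r₂ * log 2) := Finset.prod_le_prod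
          (fun i _ => Finset.sum_nonneg fun x _ => mul_nonneg (hP.1 x) (by split_ifs <;> simp))
          fun i _ => hPle (y i)
      _ = _ := by rw [Finset.prod_const, Finset.card_univ, Fintype.card_fin, ← exp_nat_mul]
  calc ∑ x, ∑ y, prodVec P n x * (if prodMat (toMat W) n x y = 0 then 0 else toMat N x y)
      ≤ ∑ x, ∑ y, (exp (n * r₁ * log 2) * q y) *
          (prodVec P n x * (if prodMat (toMat W) n x y = 0 then 0 else 1)) := by
        refine Finset.sum_le_sum fun x _ => Finset.sum_le_sum fun y _ => ?_
        split_ifs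
        · simp
        · have := mul_le_mul_of_nonneg_left (hNq x y) (hPn.1 x)
          linarith
    _ = ∑ y, (exp (n * r₁ * log 2) * q y) *
          ∑ x, prodVec P n x * (if prodMat (toMat W) n x y = 0 then 0 else 1) := by
        rw [Finset.sum_comm]
        simp only [Finset.mul_sum]
    _ ≤ ∑ y, (exp (n * r₁ * log 2) * q y) * exp (n * (-r₂ * log 2)) :=
        Finset.sum_le_sum fun y _ =>
          mul_le_mul_of_nonneg_left (hcol y) (mul_nonneg (exp_pos _).le (hq.1 y))
    _ = exp (n * r₁ * log 2 + n * (-r₂ * log 2)) := by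
        rw [← Finset.sum_mul, ← Finset.mul_sum, hq.2, mul_one, ← exp_add]
    _ ≤ exp (-(r₂ - r₁) * log 2) := by
        refine exp_le_exp.mpr ?_
        have h7 : 0 ≤ (n - 1) * ((r₂ - r₁) * log 2) :=
          mul_nonneg (by linarith) (mul_nonneg (by linarith) h2.le)
        linarith

/-- Extended arithmetic, `⊤` times a negative number, reproduces the convention that the term at `β
= ∞` is `-∞`. -/
theorem exponent_term_top {W : Channel X Y} {r : ℝ} (h : (r : EReal) < capacity ∞ W) :
    (((∞ : ℝ≥0∞) : EReal) - 1) * ((r : EReal) - capacity ∞ W) = ⊥ := by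
  have h1 : (((∞ : ℝ≥0∞) : EReal) - 1) = ⊤ := by
    rw [EReal.coe_ennreal_top, ← EReal.coe_one, EReal.top_sub_coe]
  rw [h1]
  refine EReal.top_mul_of_neg ?_
  generalize capacity ∞ W = c at h
  induction c with
  | bot => exact absurd h not_lt_bot
  | top => simp
  | coe c =>
    have : r < c := by exact_mod_cast h
    have : r - c < 0 := by linarith
    exact_mod_cast this

end Converse

end ChannelSimulation

end

/-! ### Assembly of the regimes -/

open ChannelSimulation in
theorem theorem2 {X Y : Type*} [Fintype X] [Nonempty X] [Fintype Y]
    (W : ChannelSimulation.Channel X Y) :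
    (∀ r : ℝ, 0 ≤ r → (r : EReal) < ChannelSimulation.capacity ∞ W →
      (∀ α : ℝ≥0∞, 0 < α → α ≤ 1 →
        ChannelSimulation.reliability α W r =
          ⨆ (β : ℝ≥0∞) (_ : 1 ≤ β),
            ((β : EReal) - 1) * ((r : EReal) - ChannelSimulation.capacity β W)) ∧
      (∀ α : ℝ≥0∞, 1 < α →
        ChannelSimulation.reliability α W r =
          max (⨆ (β : ℝ≥0∞) (_ : α ≤ β),
            ((β : EReal) - 1) * ((r : EReal) - ChannelSimulation.capacity β W)) 0)) ∧
    (∀ (r : ℝ) (α : ℝ≥0∞), ChannelSimulation.capacity ∞ W ≤ (r : EReal) →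
      ChannelSimulation.reliability α W r = ⊤) ∧
    (∀ r : ℝ, ChannelSimulation.capacity 0 W < (r : EReal) →
      ChannelSimulation.reliability 0 W r = ⊤) ∧
    (∀ r : ℝ, 0 ≤ r → (r : EReal) < ChannelSimulation.capacity 0 W →
      ChannelSimulation.reliability 0 W r = 0) := by
  refine ⟨fun r hr hcap => ⟨fun α h0 h1 => ?_, fun α h1 => ?_⟩,
    fun r α h => reliability_eq_top_of_capacity_top_le h, fun r h => reliability_zero_eq_top h,
    fun r hr h => le_antisymm (reliability_zero_le_zero h) (reliability_nonneg hr)⟩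
  · refine le_antisymm ?_ (iSup₂_le fun β hβ => ?_)
    · refine EReal.le_of_forall_lt_iff_le.mp fun C hC => ?_
      have hterm : ∀ β : ℝ≥0∞, 1 ≤ β → ((β : EReal) - 1) * ((r : EReal) - capacity β W) ≤ C :=
        fun β hβ => (le_iSup₂ (f := fun (β : ℝ≥0∞) (_ : 1 ≤ β) =>
          ((β : EReal) - 1) * ((r : EReal) - capacity β W)) β hβ).trans hC.le
      -- The term at `β = 1` vanishes, so for `α ≤ 1` the supremum is nonnegative without a positive
      -- part.
      have hC0 : 0 ≤ C := by
        have := hterm 1 le_rfl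
        rw [EReal.coe_ennreal_one, ← EReal.coe_one, EReal.sub_self (EReal.coe_ne_top 1) (EReal.coe_ne_bot 1), zero_mul] at this
        exact_mod_cast this
      exact reliability_le_of_forall_term_le h0 (ne_top_of_le_ne_top ENNReal.one_ne_top h1) hcap hC0
        fun β _ hβ _ => hterm β hβ.le
    · rcases hβ.eq_or_lt with rfl | hβ
      · rw [EReal.coe_ennreal_one, ← EReal.coe_one, EReal.sub_self (EReal.coe_ne_top 1) (EReal.coe_ne_bot 1), zero_mul]
        exact reliability_nonneg hr
      by_cases hT : β = ∞
      · rw [hT, exponent_term_top hcap]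
        exact bot_le
      · exact exponent_term_le_reliability hr h0 (h1.trans hβ.le) hβ hT
  · refine le_antisymm ?_ (max_le (iSup₂_le fun β hβ => ?_) (reliability_nonneg hr))
    · by_cases hT : α = ∞
      · rw [hT]
        exact (reliability_top_le_zero hcap).trans (le_max_right _ _)
      refine EReal.le_of_forall_lt_iff_le.mp fun C hC => ?_
      have hC0 : 0 ≤ C := by exact_mod_cast (le_max_right _ _).trans hC.le
      exact reliability_le_of_forall_term_le (zero_lt_one.trans h1) hT hcap hC0
        fun β hβ _ _ => (le_iSup₂ (f := fun (β : ℝ≥0∞) (_ : α ≤ β) =>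
          ((β : EReal) - 1) * ((r : EReal) - capacity β W)) β hβ).trans
            ((le_max_left _ _).trans hC.le)
    · by_cases hT : β = ∞
      · rw [hT, exponent_term_top hcap]
        exact bot_le
      · exact exponent_term_le_reliability hr (zero_lt_one.trans h1) hβ (h1.trans_le hβ) hT
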